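/- **Setting.** Let $X_{i,j}=(X_{i,j}(t))_{t\ge 0}$, $i,j\in\mathbb N$, be independent centered Gaussian processes with almost surely continuous paths on a probability space $(\Omega,\mathcal F,\mathbb P)$ and common covariance $\mathbb E[X_{i,j}(s)X_{i,j}(t)]=R(s,t)$. Assume: (H1) $s\mapsto R(s,s)$ is continuously differentiable on $(0,\infty)$ and continuous at $0$, and for every $T>0$: $\frac{d}{ds}R(s,s)$ has finitely many zeros in $(0,T]$, the map $s\mapsto R(s,t)$ is absolutely continuous on $[0,T]$ for every $t\in[0,T]$, and there is $\alpha>1$ with $$\sup_{0\le t\le T}\int_0^T\Big|\frac{\partial R}{\partial s}(s,t)\Big|^\alpha ds<\infty ; \tag{1}$$ (H2) there are $\kappa,\gamma>0$ with $R(s,s)-2R(s,t)+R(t,t)\le\kappa|t-s|^\gamma$ for all $s,t>0$. Let $n\ge 1$, let $A=(A_{i,j})$ be a real symmetric $n\times n$ matrix, and let $Y(t)$ be the symmetric $n\times n$ matrix with entries $Y_{i,j}(t)=n^{-1/2}X_{i,j}(t)+A_{i,j}$ for $i<j$ and $Y_{i,i}(t)=\sqrt2\,n^{-1/2}X_{i,i}(t)+A_{i,i}$.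 For $y=(y_{k,h})_{1\le k\le h\le n}\in\mathbb R^{n(n+1)/2}$ let $\Phi_1(y)\ge\dots\ge\Phi_n(y)$ be the ordered eigenvalues of the symmetric matrix with entries $y_{k,h}$ for $k<h$ and $\sqrt2\,y_{k,k}$ on the diagonal, and identify $Y(t)$ with its coordinates $y$. Thus $\lambda_i(t)=\Phi_i(Y(t))$ are the ordered eigenvalues of $Y(t)$; put $\mu_t=\frac1n\sum_{j}\delta_{\lambda_j(t)}$ and $\langle\mu,f\rangle=\int f\,d\mu$. Call an open set $G\subset\mathbb R^{n(n+1)/2}$ *regular* if $G^c$ is Lebesgue-null and all $\Phi_i$ are infinitely differentiable on $G$. **Extended Skorokhod integral.** Let $T>0$, let $\alpha>1$ be such that (1) holds, and put $\beta=\alpha/(\alpha-1)$. For a step function $\psi=\sum_jc_j\mathbf 1_{[0,t_j]}$ on $[0,T]$ and $\varphi\in L^\beta[0,T]$ put $\langle\psi,\varphi\rangle=\sum_jc_j\int_0^T\varphi(s)\frac{\partial R}{\partial s}(s,t_j)\,ds$; for vectors $(h^{k,h'})_{k\le h'}$ of step functions and $(u^{k,h'})_{k\le h'}$ sum over the components.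 Put $X(h)=\sum_{k\le h'}X_{k,h'}(h^{k,h'})$, where $X_{k,h'}(\mathbf 1_{[0,t]})=X_{k,h'}(t)$ (extended linearly). Let $\mathscr S$ be the set of random variables $F=g(X(h_1),\dots,X(h_m))$ with $g\in C_c^\infty(\mathbb R^m)$ and $h_1,\dots,h_m$ vectors of step functions, with $DF=\sum_j\partial_jg(X(h_1),\dots,X(h_m))\,h_j$. A process $u=(u^{k,h'})_{k\le h'}$ with $u\in L^1(\Omega;L^\beta[0,T])$ is in $\mathrm{Dom}^*\delta$ if there are $p>1$ and $C$ with $|\mathbb E\langle DF,u\rangle|\le C\|F\|_{L^p(\Omega)}$ for all $F\in\mathscr S$. Then $\delta(u)$ denotes a random variable in some $L^q(\Omega)$, $q>1$, measurable up to a null set with respect to $\sigma(X_{k,h'}(s):1\le k\le h'\le n,\ 0\le s\le T)$, such that $\mathbb E[F\,\delta(u)]=\mathbb E\langle DF,u\rangle$ for all $F\in\mathscr S$. Write $\sum_{k\le h'}\int_0^tu^{k,h'}(s)\,\delta X_{k,h'}(s):=\delta(u\mathbf 1_{[0,t]})$. **Lemma.** A regular set $G$ exists. Let $G$ be any regular set,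 let $T>0$, $t\in[0,T]$, $\alpha>1$ such that (1) holds, and let $f\in C^2(\mathbb R)$ have bounded $f'$ and $f''$. Then the process with components $$u^{k,h}(s)=\sum_{i=1}^nf'(\Phi_i(Y(s)))\,\mathbf 1_G(Y(s))\,\frac{\partial\Phi_i}{\partial y_{k,h}}(Y(s)),\qquad k\le h,$$ satisfies $u\mathbf 1_{[0,t]}\in\mathrm{Dom}^*\delta$ and $\delta(u\mathbf 1_{[0,t]})$ exists; almost surely the two integrals over $s\in[0,t]$ of the form $ds$ below converge absolutely; and for every version of $\delta(u\mathbf 1_{[0,t]})$, almost surely, $$\begin{aligned}\langle\mu_t,f\rangle=\langle\mu_0,f\rangle&+\frac1{2n^2}\sum_{i=1}^n\int_0^tf''(\Phi_i(Y(s)))\frac{d}{ds}R(s,s)\,ds\\&+\frac1{n^{3/2}}\sum_{k\le h}\int_0^t\sum_{i=1}^nf'(\Phi_i(Y(s)))\mathbf 1_G(Y(s))\frac{\partial\Phi_i}{\partial y_{k,h}}(Y(s))\,\delta X_{k,h}(s)\\&+\frac12\int_0^t\int_{\mathbb R^2}\frac{f'(x)-f'(y)}{x-y}\,\frac{d}{ds}R(s,s)\,\mu_s(dx)\mu_s(dy)\,ds,\end{aligned}$$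 where $\frac{f'(x)-f'(y)}{x-y}$ means $f''(x)$ when $x=y$. No assumption is made on collisions of the eigenvalues. If $R(0,0)=0$, then $\mu_0$ is almost surely the spectral distribution of $A$. -/

import Mathlib

open MeasureTheory ProbabilityTheory Set Filter
open scoped NNReal

noncomputable section

/-! ### Test functions and the divided difference of `f'` -/

/-- `f ∈ C_b^r(ℝ)`: `f` is `C^r` and its derivatives of orders `1, …, r` are bounded
(`f` itself need not be bounded). -/
def MemCb (r : ℕ) (f : ℝ → ℝ) : Prop :=
  ContDiff ℝ r f ∧ ∀ i, 1 ≤ i → i ≤ r → ∃ C : ℝ, ∀ x, |iteratedDeriv i f x| ≤ C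

/-- `(f'(x) - f'(y)) / (x - y)`, understood as `f''(x)` for `x = y`. -/
def derivQuotient (f : ℝ → ℝ) (x y : ℝ) : ℝ :=
  open Classical in
  if x = y then deriv (deriv f) x else (deriv f x - deriv f y) / (x - y)

/-! ### Assumptions on the covariance function -/

/-- `sup_{0 ≤ t ≤ T} ∫_0^T |∂R/∂s (s,t)|^α ds < ∞`. -/
def PartialDerivBound (R : ℝ → ℝ → ℝ) (T α : ℝ) : Prop :=
  ∃ C : ℝ≥0, ∀ t ∈ Icc (0 : ℝ) T,
    ∫⁻ s in Icc (0 : ℝ) T, ENNReal.ofReal (|deriv (fun r => R r t) s| ^ α) ≤ C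

/-- Condition (H1). The exponent `α` may depend on the horizon `T`. -/
structure CovarianceH1 (R : ℝ → ℝ → ℝ) : Prop where
  contDiffOn_diag : ContDiffOn ℝ 1 (fun s => R s s) (Ioi 0)
  continuous_zero : ContinuousWithinAt (fun s => R s s) (Ici 0) 0
  finite_zeros : ∀ T : ℝ, 0 < T → {s ∈ Ioc (0 : ℝ) T | deriv (fun r => R r r) s = 0}.Finite
  absolutelyContinuous : ∀ T : ℝ, 0 < T → ∀ t ∈ Icc (0 : ℝ) T,
    AbsolutelyContinuousOnInterval (fun s => R s t) 0 T
  exists_exponent : ∀ T : ℝ, 0 < T → ∃ α : ℝ, 1 < α ∧ PartialDerivBound R T α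

/-- Condition (H2). -/
def CovarianceH2 (R : ℝ → ℝ → ℝ) : Prop :=
  ∃ κ γ : ℝ, 0 < κ ∧ 0 < γ ∧ ∀ s t : ℝ, 0 < s → 0 < t →
    R s s - 2 * R s t + R t t ≤ κ * |t - s| ^ γ

/-- `X i j`, for `i j : ℕ`, are independent centered Gaussian processes on `[0, ∞)` with
almost surely continuous paths and common covariance function `R`. -/
structure IsGaussianFamily {Ω : Type*} [MeasurableSpace Ω] (P : Measure Ω)
    (X : ℕ → ℕ → ℝ → Ω → ℝ) (R : ℝ → ℝ → ℝ) : Prop where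
  measurable : ∀ i j t, 0 ≤ t → Measurable (X i j t)
  continuous : ∀ i j, ∀ᵐ ω ∂P, ContinuousOn (fun t => X i j t ω) (Ici 0)
  gaussian : ∀ i j, IsGaussianProcess (fun (t : ℝ≥0) ω => X i j t ω) P
  indep : iIndepFun (fun (q : ℕ × ℕ) ω (t : ℝ≥0) => X q.1 q.2 t ω) P
  centered : ∀ i j t, 0 ≤ t → ∫ ω, X i j t ω ∂P = 0
  covariance : ∀ i j s t, 0 ≤ s → 0 ≤ t → ∫ ω, X i j s ω * X i j t ω ∂P = R s t

/-! ### The extended divergence of a `d`-dimensional Gaussian process on `[0, T]`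

The components of the process `W` are indexed by a finite type `ι` with `d` elements.
The step function `∑_j c_j 1_{[0,t_j]}` on `[0, T]` is encoded by the finitely supported
function `t_j ↦ c_j`; the functions `1_{[0,t]}`, `0 ≤ t ≤ T`, are linearly independent, so this
is a one-to-one encoding of their span. -/

/-- `𝓔`: step functions on `[0, T]`. -/
abbrev StepFun (T : ℝ) : Type := Icc (0 : ℝ) T →₀ ℝ

section Malliavin

variable {Ω ι : Type*} [Fintype ι]

/-- `W(h) = ∑_i W^i(h_i)` for `h ∈ 𝓔^d`, where `W^i(1_{[0,t]}) = W^i_t`. -/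
def gaussianInt (W : ι → ℝ → Ω → ℝ) {T : ℝ} (h : ι → StepFun T) (ω : Ω) : ℝ :=
  ∑ i, (h i).sum fun t c => c * W i t ω

/-- `⟨ψ, φ⟩ = ∑_j c_j ∫_0^T φ(s) ∂R/∂s(s, t_j) ds` for `ψ = ∑_j c_j 1_{[0,t_j]}`. -/
def extInner (R : ℝ → ℝ → ℝ) {T : ℝ} (ψ : StepFun T) (φ : ℝ → ℝ) : ℝ :=
  ψ.sum fun t c => c * ∫ s in (0 : ℝ)..T, φ s * deriv (fun r => R r (t : ℝ)) s

/-- A presentation of a smooth cylindrical random variable `g(W(h_1), …, W(h_m))`, with `g`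
smooth and compactly supported and `h_1, …, h_m ∈ 𝓔^d`. -/
structure Cylinder (ι : Type*) (T : ℝ) where
  m : ℕ
  g : (Fin m → ℝ) → ℝ
  smooth : ContDiff ℝ (⊤ : ℕ∞) g
  compact : HasCompactSupport g
  h : Fin m → ι → StepFun T

namespace Cylinder

/-- The random variable `F = g(W(h_1), …, W(h_m))`. -/
def eval {T : ℝ} (F : Cylinder ι T) (W : ι → ℝ → Ω → ℝ) (ω : Ω) : ℝ :=
  F.g fun j => gaussianInt W (F.h j) ω

/-- `⟨DF, u⟩`, where `DF = ∑_j ∂_j g(W(h_1), …, W(h_m)) h_j` is the Malliavin derivative. -/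
def derivInner {T : ℝ} (F : Cylinder ι T) (R : ℝ → ℝ → ℝ) (W : ι → ℝ → Ω → ℝ)
    (u : ι → ℝ → Ω → ℝ) (ω : Ω) : ℝ :=
  ∑ j, fderiv ℝ F.g (fun l => gaussianInt W (F.h l) ω) (Pi.single j 1) *
    ∑ i, extInner R (F.h j i) fun s => u i s ω

end Cylinder

/-- The `σ`-algebra generated by `W_s`, `0 ≤ s ≤ T`. -/
abbrev pathSigma (W : ι → ℝ → Ω → ℝ) (T : ℝ) : MeasurableSpace Ω :=
  ⨆ i, ⨆ s : Icc (0 : ℝ) T, MeasurableSpace.comap (W i s) inferInstance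

variable [MeasurableSpace Ω]

/-- `u ∈ L^1(Ω; L^β([0,T]; ℝ^d))`. -/
def MemL1Lbeta (P : Measure Ω) (T β : ℝ) (u : ι → ℝ → Ω → ℝ) : Prop :=
  ∀ i, AEStronglyMeasurable (fun z : Ω × ℝ => u i z.2 z.1)
      (P.prod (volume.restrict (Icc 0 T))) ∧
    ∫⁻ ω, eLpNorm (fun s => u i s ω) (ENNReal.ofReal β) (volume.restrict (Icc 0 T)) ∂P < ⊤

/-- `u` belongs to the extended domain `Dom* δ` of the divergence. -/
def InExtDom (P : Measure Ω) (R : ℝ → ℝ → ℝ) (W : ι → ℝ → Ω → ℝ) (T β : ℝ)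
    (u : ι → ℝ → Ω → ℝ) : Prop :=
  MemL1Lbeta P T β u ∧
  ∃ p : ℝ, 1 < p ∧ ∃ C : ℝ, ∀ F : Cylinder ι T,
    |∫ ω, F.derivInner R W u ω ∂P| ≤ C * (eLpNorm (F.eval W) (ENNReal.ofReal p) P).toReal

/-- `u ∈ Dom* δ` and `Z = δ(u)`: `Z` is the random variable in some `L^q`, `q > 1`, measurable
with respect to `W` on `[0, T]`, with `E[F Z] = E⟨DF, u⟩` for all smooth cylindrical `F`. -/
structure IsExtDivergence (P : Measure Ω) (R : ℝ → ℝ → ℝ) (W : ι → ℝ → Ω → ℝ) (T β : ℝ)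
    (u : ι → ℝ → Ω → ℝ) (Z : Ω → ℝ) : Prop where
  mem_dom : InExtDom P R W T β u
  measurable : AEStronglyMeasurable[pathSigma W T] Z P
  memLp : ∃ q : ℝ, 1 < q ∧ MemLp Z (ENNReal.ofReal q) P
  duality : ∀ F : Cylinder ι T,
    ∫ ω, F.eval W ω * Z ω ∂P = ∫ ω, F.derivInner R W u ω ∂P

/-- `Z = ∑_i ∫_0^t u^i_s δW^i_s := δ(u 1_{[0,t]})`. -/
def IsSkorokhodIntegral (P : Measure Ω) (R : ℝ → ℝ → ℝ) (W : ι → ℝ → Ω → ℝ) (T β t : ℝ)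
    (u : ι → ℝ → Ω → ℝ) (Z : Ω → ℝ) : Prop :=
  IsExtDivergence P R W T β (fun i s ω => (Icc (0 : ℝ) t).indicator (fun r => u i r ω) s) Z

end Malliavin

/-! ### Symmetric matrices and their eigenvalues -/

/-- The pairs `(k, h)` with `k ≤ h`; there are `n (n + 1) / 2` of them. -/
abbrev UpperPair (n : ℕ) : Type := {q : Fin n × Fin n // q.1 ≤ q.2}

/-- The eigenvalues `λ_1 ≥ ⋯ ≥ λ_n` of a real symmetric matrix (`0` if `M` is not symmetric). -/
def orderedEig {n : ℕ} (M : Matrix (Fin n) (Fin n) ℝ) (i : Fin n) : ℝ :=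
  open Classical in
  if hM : M.IsHermitian then hM.eigenvalues₀ (Fin.cast (Fintype.card_fin n).symm i) else 0

/-- The spectral empirical distribution `(1/n) ∑_j δ_{λ_j}`. -/
def spectralMeasure {n : ℕ} (M : Matrix (Fin n) (Fin n) ℝ) : Measure ℝ :=
  (n : ENNReal)⁻¹ • ∑ j, Measure.dirac (orderedEig M j)

/-- The symmetric matrix with entries `y_{k,h}` above and `√2 y_{k,k}` on the diagonal. -/
def symMatrix {n : ℕ} (y : UpperPair n → ℝ) : Matrix (Fin n) (Fin n) ℝ :=
  Matrix.of fun i j =>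
    if hij : i < j then y ⟨(i, j), hij.le⟩
    else if hji : j < i then y ⟨(j, i), hji.le⟩
    else √2 * y ⟨(i, i), le_rfl⟩

/-- The coordinates `y_{k,h}`, `k ≤ h`, of a symmetric matrix: the inverse of `symMatrix`. -/
def symCoord {n : ℕ} (M : Matrix (Fin n) (Fin n) ℝ) (q : UpperPair n) : ℝ :=
  if q.1.1 = q.1.2 then M q.1.1 q.1.1 / √2 else M q.1.1 q.1.2

theorem symMatrix_symCoord {n : ℕ} {M : Matrix (Fin n) (Fin n) ℝ} (hM : M.IsSymm) :
    symMatrix (symCoord M) = M := by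
  ext i j
  have h2 : √(2 : ℝ) ≠ 0 := by positivity
  simp only [symMatrix, symCoord, Matrix.of_apply]
  rcases lt_trichotomy i j with h | h | h
  · simp [h, h.ne]
  · subst h
    simp
    field_simp
  · simp [h, h.ne, h.not_gt, hM.apply]

/-- `Φ_i^n : ℝ^{n(n+1)/2} → ℝ`, the `i`-th eigenvalue as a function of the coordinates. -/
def eigFun (n : ℕ) (i : Fin n) (y : UpperPair n → ℝ) : ℝ :=
  orderedEig (symMatrix y) i

/-- `∂Φ_i^n / ∂y_{k,h}`, at points where `Φ_i^n` is differentiable. -/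
def eigFunPartial (n : ℕ) (i : Fin n) (q : UpperPair n) (y : UpperPair n → ℝ) : ℝ :=
  fderiv ℝ (eigFun n i) y (Pi.single q 1)

/-- `G ⊆ ℝ^{n(n+1)/2}` is open with Lebesgue-null complement and every `Φ_i^n` is infinitely
differentiable in `G`. -/
structure IsRegularSet (n : ℕ) (G : Set (UpperPair n → ℝ)) : Prop where
  isOpen : IsOpen G
  volume_compl : volume Gᶜ = 0
  smooth : ∀ i, ContDiffOn ℝ (⊤ : ℕ∞) (eigFun n i) G

/-! ### The matrix-valued process -/

section MatrixValued

variable {Ω : Type*}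

/-- `Y^{(n)}(t)`: the symmetric matrix with entries `n^{-1/2} X_{i,j}(t) + A_{i,j}` for `i < j`
and `√2 n^{-1/2} X_{i,i}(t) + A_{i,i}` on the diagonal. -/
def matrixProcess {n : ℕ} (X : ℕ → ℕ → ℝ → Ω → ℝ) (A : Matrix (Fin n) (Fin n) ℝ)
    (t : ℝ) (ω : Ω) : Matrix (Fin n) (Fin n) ℝ :=
  Matrix.of fun i j =>
    if i < j then 1 / √n * X i j t ω + A i j
    else if j < i then 1 / √n * X j i t ω + A j i
    else √2 / √n * X i i t ω + A i i

theorem matrixProcess_isSymm {n : ℕ} (X : ℕ → ℕ → ℝ → Ω → ℝ) (A : Matrix (Fin n) (Fin n) ℝ)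
    (t : ℝ) (ω : Ω) : (matrixProcess X A t ω).IsSymm := by
  ext i j
  simp only [matrixProcess, Matrix.transpose_apply, Matrix.of_apply]
  rcases lt_trichotomy i j with h | h | h
  · simp [h, h.not_gt]
  · subst h; rfl
  · simp [h, h.not_gt]

/-- `Φ_i^n(Y^{(n)}(t)) = λ_i^{(n)}(t)`. -/
theorem eigFun_matrixProcess {n : ℕ} (X : ℕ → ℕ → ℝ → Ω → ℝ) (A : Matrix (Fin n) (Fin n) ℝ)
    (t : ℝ) (ω : Ω) (i : Fin n) :
    eigFun n i (symCoord (matrixProcess X A t ω)) = orderedEig (matrixProcess X A t ω) i := by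
  rw [eigFun, symMatrix_symCoord (matrixProcess_isSymm X A t ω)]

/-- The `n (n + 1) / 2`-dimensional process `(X_{k,h})_{k ≤ h}`. -/
def upperProcess (n : ℕ) (X : ℕ → ℕ → ℝ → Ω → ℝ) : UpperPair n → ℝ → Ω → ℝ :=
  fun q t ω => X q.1.1 q.1.2 t ω

/-- The integrand with components
`∑_i f'(Φ_i^n(Y(s))) 1_G(Y(s)) ∂Φ_i^n/∂y_{k,h}(Y(s))`, `k ≤ h`. -/
def eigIntegrand {n : ℕ} (X : ℕ → ℕ → ℝ → Ω → ℝ) (A : Matrix (Fin n) (Fin n) ℝ)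
    (f : ℝ → ℝ) (G : Set (UpperPair n → ℝ)) : UpperPair n → ℝ → Ω → ℝ :=
  fun q s ω =>
    let y := symCoord (matrixProcess X A s ω)
    ∑ i, deriv f (eigFun n i y) * G.indicator 1 y * eigFunPartial n i q y

end MatrixValued

end

/-!
Write `W = (X_{k,h})_{k ≤ h}`, `κ = n^{-1/2}` and let `a` be the coordinates of `A`, so that `Y(s)`
has coordinates `κ W_s + a`, and let `H(y) = ∑_i f(Φ_i(y))`. The assertion is the Itô formula
`H(Y_t) = H(Y_0) + κ δ(∇H(Y) 1_{[0,t]}) + (κ²/2) ∫_0^t ΔH(Y_s) dR(s,s)` in which the Laplacian is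
`ΔH = ∑_i f''(Φ_i) + ∑_{i,j} (f'(Φ_i) - f'(Φ_j)) / (Φ_i - Φ_j)`. The proof defines a random variable
`Z` by solving this identity for the divergence and verifies the duality `E[F Z] = E⟨DF, u⟩` for
all cylindrical `F`; then `Z` is a divergence, and any other one agrees with it almost surely.

*Duality for smooth functions.* The characteristic function of `(W(h_1), …, W(h_m), W_s)` is the
exponential of a quadratic form whose coefficients are the functions `R(s,t_j)` and `R(s,s)`. These
are absolutely continuous in `s` (`R(s,s)` because it is monotone near `0`), so the characteristic
function satisfies an evolution equation in integrated form
(`IndepGaussianProcesses.charFun_evolution`). Fourier inversion turns it into the Itô formula for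
`g(Y)`, `g ∈ C_c^∞`, tested against `F`: `integral_mul_evolution`.

*Approximation.* For a polynomial `p` the function `y ↦ ∑_i p(Φ_i(y))` is the trace of `p(M)`, which
is itself a polynomial in the entries, and its Laplacian is computed without any reference to
eigenvectors (`laplacian_tracePoly`); the result involves only the eigenvalues and divided
differences of `p'`. Approximating `f` in `C²` by polynomials on growing intervals and cutting off,
one obtains smooth functions with bounded gradients and Laplacians that converge to `H`, to `∇H`
on `G`, and to the above expression for `ΔH` everywhere (`exists_smooth_approximation`). So neither
second derivatives of the eigenvalues nor estimates near collisions are needed. As `R(s,s) > 0` for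
almost every `s`, the law of `Y_s` has a density and `Y_s ∈ G` almost surely, and dominated
convergence gives the duality for `H`: `integral_cylinder_mul_statistic`.

*Regular sets.* The set where the eigenvalues are distinct is regular. It is the set where the
Hankel determinant of the moments `Tr M^{a+b}` does not vanish, which meets every line in a
suitable direction in a cofinite set; smoothness is the inverse function theorem for the power sums
(`exists_isRegularSet`).

*Uniqueness.* Two divergences differ by an integrable random variable that is measurable with
respect to the paths and orthogonal to all cylindrical random variables, hence by zero
(`ae_eq_zero_of_forall_cylinder`).
-/

noncomputable section

/-! ### Perturbation of ordered eigenvalues -/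

section Weyl

variable {E : Type*} [NormedAddCommGroup E] [InnerProductSpace ℝ E] [FiniteDimensional ℝ E]

theorem LinearMap.IsSymmetric.inner_apply_eq_sum {S : E →ₗ[ℝ] E} (hS : S.IsSymmetric) {n : ℕ}
    (hn : Module.finrank ℝ E = n) (x : E) :
    inner ℝ (S x) x =
      ∑ j, hS.eigenvalues hn j * (inner ℝ (hS.eigenvectorBasis hn j) x) ^ 2 := by
  rw [← OrthonormalBasis.sum_inner_mul_inner (hS.eigenvectorBasis hn)]
  refine Finset.sum_congr rfl fun j _ => ?_
  rw [hS, hS.apply_eigenvectorBasis hn j, inner_smul_right, real_inner_comm]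
  rw [RCLike.ofReal_real_eq_id, id_eq]
  ring

/-- Weyl's monotonicity principle. The eigenvectors of `S` with index at most `i` span a space of
dimension `i + 1`, those of `S'` with index at least `i` one of codimension `i`; a common nonzero
vector gives the bound. -/
theorem LinearMap.IsSymmetric.eigenvalues_le_add {S S' : E →ₗ[ℝ] E} (hS : S.IsSymmetric)
    (hS' : S'.IsSymmetric) {n : ℕ} (hn : Module.finrank ℝ E = n) {ε : ℝ}
    (h : ∀ x, inner ℝ (S x) x ≤ inner ℝ (S' x) x + ε * ‖x‖ ^ 2) (i : Fin n) :
    hS.eigenvalues hn i ≤ hS'.eigenvalues hn i + ε := by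
  let u := hS.eigenvectorBasis hn
  let v := hS'.eigenvectorBasis hn
  let L : E →ₗ[ℝ] ({j : Fin n // j ≠ i} → ℝ) :=
    LinearMap.pi fun j => if i < j.1 then (innerₛₗ ℝ (u j.1)) else (innerₛₗ ℝ (v j.1))
  have hdim : Module.finrank ℝ ({j : Fin n // j ≠ i} → ℝ) < Module.finrank ℝ E := by
    have hi := i.isLt
    rw [Module.finrank_fintype_fun_eq_card, hn, Fintype.card_subtype_compl]
    simp
    omega
  obtain ⟨x, hx, hx0⟩ := Submodule.exists_mem_ne_zero_of_ne_bot
    (LinearMap.ker_ne_bot_of_finrank_lt (f := L) hdim)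
  have hxu : ∀ j, i < j → inner ℝ (u j) x = 0 := fun j hj => by
    have := congrFun (LinearMap.mem_ker.1 hx) ⟨j, hj.ne'⟩
    simpa [L, hj] using this
  have hxv : ∀ j, j < i → inner ℝ (v j) x = 0 := fun j hj => by
    have := congrFun (LinearMap.mem_ker.1 hx) ⟨j, hj.ne⟩
    simpa [L, hj, hj.not_gt] using this
  have hpos : 0 < ‖x‖ ^ 2 := by positivity
  have h1 : hS.eigenvalues hn i * ‖x‖ ^ 2 ≤ inner ℝ (S x) x := by
    rw [hS.inner_apply_eq_sum hn, ← u.sum_sq_norm_inner_right x, Finset.mul_sum]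
    refine Finset.sum_le_sum fun j _ => ?_
    rcases lt_or_ge i j with hj | hj
    · simp [u, hxu j hj]
    · rw [Real.norm_eq_abs, sq_abs]
      exact mul_le_mul_of_nonneg_right (hS.eigenvalues_antitone hn hj) (sq_nonneg _)
  have h2 : inner ℝ (S' x) x ≤ hS'.eigenvalues hn i * ‖x‖ ^ 2 := by
    rw [hS'.inner_apply_eq_sum hn, ← v.sum_sq_norm_inner_right x, Finset.mul_sum]
    refine Finset.sum_le_sum fun j _ => ?_
    rcases lt_or_ge j i with hj | hj
    · simp [v, hxv j hj]
    · rw [Real.norm_eq_abs, sq_abs]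
      exact mul_le_mul_of_nonneg_right (hS'.eigenvalues_antitone hn hj) (sq_nonneg _)
  have h3 := h x
  have : hS.eigenvalues hn i * ‖x‖ ^ 2 ≤ (hS'.eigenvalues hn i + ε) * ‖x‖ ^ 2 := by linarith
  exact le_of_mul_le_mul_right this hpos

end Weyl

section EigenvaluesOfMatrices

variable {n : ℕ}

theorem symMatrix_isHermitian (y : UpperPair n → ℝ) : (symMatrix y).IsHermitian := by
  ext i j
  simp only [symMatrix, Matrix.conjTranspose_apply, Matrix.of_apply, star_trivial]
  rcases lt_trichotomy i j with h | h | h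
  · simp [h, h.not_gt]
  · subst h; rfl
  · simp [h, h.not_gt]

theorem symMatrix_apply (y : UpperPair n → ℝ) (i j : Fin n) :
    symMatrix y i j = (if i = j then √2 else 1) * y ⟨(min i j, max i j), min_le_max⟩ := by
  simp only [symMatrix, Matrix.of_apply]
  rcases lt_trichotomy i j with h | h | h
  · simp [h, h.ne, h.le]
  · subst h; simp
  · simp [h, h.ne', h.not_gt, h.le]

theorem symMatrix_add (y z : UpperPair n → ℝ) : symMatrix (y + z) = symMatrix y + symMatrix z := by
  ext i j; simp only [symMatrix_apply, Matrix.add_apply, Pi.add_apply]; ring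

theorem symMatrix_smul (c : ℝ) (y : UpperPair n → ℝ) : symMatrix (c • y) = c • symMatrix y := by
  ext i j; simp only [symMatrix_apply, Matrix.smul_apply, Pi.smul_apply, smul_eq_mul]; ring

/-- `symMatrix` as a linear map. -/
def symMatrixLin (n : ℕ) : (UpperPair n → ℝ) →ₗ[ℝ] Matrix (Fin n) (Fin n) ℝ where
  toFun := symMatrix
  map_add' := symMatrix_add
  map_smul' := symMatrix_smul

theorem symMatrix_sub (y z : UpperPair n → ℝ) : symMatrix (y - z) = symMatrix y - symMatrix z :=
  (symMatrixLin n).map_sub y z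

theorem abs_symMatrix_apply_le (y : UpperPair n → ℝ) (i j : Fin n) :
    |symMatrix y i j| ≤ 2 * ‖y‖ := by
  rw [symMatrix_apply, abs_mul]
  have h1 : |if i = j then √2 else (1 : ℝ)| ≤ 2 := by
    split_ifs
    · rw [abs_of_nonneg (by positivity)]
      exact Real.sqrt_le_sqrt (by norm_num : (2 : ℝ) ≤ 4) |>.trans (by
        rw [show (4 : ℝ) = 2 ^ 2 by norm_num]; simp)
    · norm_num
  exact mul_le_mul h1 (norm_le_pi_norm y _) (abs_nonneg _) (by norm_num)

theorem inner_toEuclideanLin (M : Matrix (Fin n) (Fin n) ℝ) (x : EuclideanSpace ℝ (Fin n)) :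
    inner ℝ (Matrix.toEuclideanLin M x) x = ∑ i, ∑ j, M i j * x i * x j := by
  simp only [PiLp.inner_apply, Matrix.ofLp_toLpLin, Matrix.toLin'_apply, Matrix.mulVec,
    dotProduct, RCLike.inner_apply, conj_trivial, Finset.mul_sum]
  exact Finset.sum_congr rfl fun i _ => Finset.sum_congr rfl fun j _ => by ring

theorem orderedEig_eq {M : Matrix (Fin n) (Fin n) ℝ} (hM : M.IsHermitian) (i : Fin n) :
    orderedEig M i = hM.eigenvalues₀ (Fin.cast (Fintype.card_fin n).symm i) := by
  rw [orderedEig, dif_pos hM]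

theorem orderedEig_le_add {M N : Matrix (Fin n) (Fin n) ℝ} (hM : M.IsHermitian)
    (hN : N.IsHermitian) {ε : ℝ} (h : ∀ i j, |M i j - N i j| ≤ ε) (i : Fin n) :
    orderedEig M i ≤ orderedEig N i + n * ε := by
  rw [orderedEig_eq hM, orderedEig_eq hN]
  refine LinearMap.IsSymmetric.eigenvalues_le_add _ _ _ (fun x => ?_) _
  rw [inner_toEuclideanLin, inner_toEuclideanLin, ← sub_le_iff_le_add', ← Finset.sum_sub_distrib]
  have hε : 0 ≤ ε := (abs_nonneg _).trans (h i i)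
  calc ∑ i, (∑ j, M i j * x i * x j - ∑ j, N i j * x i * x j)
      = ∑ i, ∑ j, (M i j - N i j) * x i * x j := by
        simp only [← Finset.sum_sub_distrib]
        exact Finset.sum_congr rfl fun i _ => Finset.sum_congr rfl fun j _ => by ring
    _ ≤ ∑ i, ∑ j, ε * ((x i ^ 2 + x j ^ 2) / 2) := by
        refine Finset.sum_le_sum fun i _ => Finset.sum_le_sum fun j _ => ?_
        refine (le_abs_self _).trans ?_
        rw [mul_assoc, abs_mul]
        refine mul_le_mul (h i j) ?_ (abs_nonneg _) hε
        rw [abs_le]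
        constructor <;> nlinarith [sq_nonneg (x i + x j), sq_nonneg (x i - x j)]
    _ = n * ε * ‖x‖ ^ 2 := by
        rw [EuclideanSpace.norm_sq_eq]
        simp only [← Finset.mul_sum, ← Finset.sum_div, Finset.sum_add_distrib, Finset.sum_const,
          Finset.card_univ, Fintype.card_fin, nsmul_eq_mul, Real.norm_eq_abs, sq_abs]
        ring

theorem eigFun_lipschitz (n : ℕ) (i : Fin n) : LipschitzWith (2 * n) (eigFun n i) := by
  have key : ∀ y z : UpperPair n → ℝ, eigFun n i y ≤ eigFun n i z + 2 * n * dist y z := by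
    intro y z
    have := orderedEig_le_add (symMatrix_isHermitian y) (symMatrix_isHermitian z)
      (ε := 2 * dist y z) (fun i j => by
        rw [dist_eq_norm, ← Matrix.sub_apply, ← symMatrix_sub]
        exact abs_symMatrix_apply_le _ _ _) i
    simp only [eigFun]
    linarith
  refine LipschitzWith.of_dist_le_mul fun y z => ?_
  rw [Real.dist_eq, abs_le]
  have h1 := key y z
  have h2 := key z y
  rw [dist_comm z y] at h2
  push_cast
  constructor <;> linarith

theorem abs_eigFunPartial_le (i : Fin n) (q : UpperPair n) (y : UpperPair n → ℝ) :
    |eigFunPartial n i q y| ≤ 2 * n := by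
  refine ((fderiv ℝ (eigFun n i) y).le_opNorm _).trans ?_
  have h := norm_fderiv_le_of_lipschitz ℝ (eigFun_lipschitz n i) (x₀ := y)
  have h1 : ‖(Pi.single q 1 : UpperPair n → ℝ)‖ ≤ 1 := by simp [Pi.norm_single]
  push_cast at h
  calc _ ≤ (2 * n : ℝ) * 1 := by gcongr
    _ = _ := by ring

theorem sum_comp_orderedEig {M : Matrix (Fin n) (Fin n) ℝ} (hM : M.IsHermitian) (g : ℝ → ℝ) :
    ∑ i, g (orderedEig M i) = ∑ i, g (hM.eigenvalues i) := by
  simp only [orderedEig_eq hM, Matrix.IsHermitian.eigenvalues]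
  rw [Equiv.sum_comp (Fintype.equivOfCardEq (Fintype.card_fin _)).symm
    (fun j => g (hM.eigenvalues₀ j))]
  exact (finCongr (Fintype.card_fin n).symm).sum_comp (fun j => g (hM.eigenvalues₀ j))

theorem trace_aeval_eq_sum {M : Matrix (Fin n) (Fin n) ℝ} (hM : M.IsHermitian)
    (p : Polynomial ℝ) :
    (Polynomial.aeval M p).trace = ∑ i, p.eval (orderedEig M i) := by
  rw [sum_comp_orderedEig hM (fun x => p.eval x)]
  conv_lhs => rw [hM.spectral_theorem, Polynomial.aeval_algHom_apply]
  rw [Unitary.conjStarAlgAut_apply, Matrix.trace_mul_cycle, Unitary.coe_star_mul_self, one_mul]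
  have : Polynomial.aeval (Matrix.diagonal (RCLike.ofReal ∘ hM.eigenvalues : Fin n → ℝ)) p
      = Matrix.diagonal (fun i => p.eval (hM.eigenvalues i)) := by
    have h := Polynomial.aeval_algHom_apply (Matrix.diagonalAlgHom (n := Fin n) (α := ℝ) ℝ)
      hM.eigenvalues p
    have h2 : Polynomial.aeval hM.eigenvalues p = fun i => p.eval (hM.eigenvalues i) := by
      ext i
      rw [Polynomial.aeval_fn_apply]; simp
    rw [h2] at h
    exact h
  rw [this, Matrix.trace_diagonal]

theorem trace_pow_eq_sum {M : Matrix (Fin n) (Fin n) ℝ} (hM : M.IsHermitian) (k : ℕ) :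
    (M ^ k).trace = ∑ i, orderedEig M i ^ k := by
  simpa using trace_aeval_eq_sum hM (Polynomial.X ^ k)

end EigenvaluesOfMatrices

/-! ### Traces of polynomials of a symmetric matrix -/

section TracePolynomials

variable {n : ℕ}

theorem fderiv_apply_pow_mul {V 𝔸 : Type*} [NormedAddCommGroup V] [NormedSpace ℝ V]
    [NormedRing 𝔸] [NormedAlgebra ℝ 𝔸] (L : V →L[ℝ] 𝔸) (τ : 𝔸 →L[ℝ] ℝ) (k : ℕ) (B : 𝔸)
    (y h : V) :
    fderiv ℝ (fun y => τ (L y ^ k * B)) y h =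
      ∑ i ∈ Finset.range k, τ (L y ^ (k - 1 - i) * L h * L y ^ i * B) := by
  have h2 := (L.hasFDerivAt.pow' k).mul_const' B (x := y)
  have h3 := τ.hasFDerivAt.comp y h2
  have h4 : fderiv ℝ (fun y => τ (L y ^ k * B)) y = _ := h3.fderiv
  rw [h4]
  simp [Finset.sum_mul]

/-- The map `y ↦ Tr p(M)`, `M` being the symmetric matrix with coordinates `y`. -/
def tracePoly (n : ℕ) (p : Polynomial ℝ) (y : UpperPair n → ℝ) : ℝ :=
  (Polynomial.aeval (symMatrix y) p).trace

theorem tracePoly_eq_sum (p : Polynomial ℝ) (y : UpperPair n → ℝ) :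
    tracePoly n p y = ∑ i, p.eval (eigFun n i y) :=
  trace_aeval_eq_sum (symMatrix_isHermitian y) p

section

attribute [local instance] Matrix.linftyOpNormedAddCommGroup Matrix.linftyOpNormedSpace
  Matrix.linftyOpNormedRing Matrix.linftyOpNormedAlgebra

theorem contDiff_trace_pow_mul (k : ℕ) (B : Matrix (Fin n) (Fin n) ℝ) :
    ContDiff ℝ (⊤ : ℕ∞) fun y : UpperPair n → ℝ => (symMatrix y ^ k * B).trace := by
  have h1 : ContDiff ℝ (⊤ : ℕ∞) fun y : UpperPair n → ℝ => symMatrix y :=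
    (LinearMap.toContinuousLinearMap (symMatrixLin n)).contDiff
  have h2 : ContDiff ℝ (⊤ : ℕ∞) fun y : UpperPair n → ℝ => symMatrix y ^ k * B :=
    (h1.pow k).mul contDiff_const
  exact (LinearMap.toContinuousLinearMap (Matrix.traceLinearMap (Fin n) ℝ ℝ)).contDiff.comp h2

theorem fderiv_trace_pow_mul (k : ℕ) (B : Matrix (Fin n) (Fin n) ℝ) (y h : UpperPair n → ℝ) :
    fderiv ℝ (fun y : UpperPair n → ℝ => (symMatrix y ^ k * B).trace) y h =
      ∑ i ∈ Finset.range k,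
        (symMatrix y ^ (k - 1 - i) * symMatrix h * symMatrix y ^ i * B).trace := by
  exact fderiv_apply_pow_mul (LinearMap.toContinuousLinearMap (symMatrixLin n))
    (LinearMap.toContinuousLinearMap (Matrix.traceLinearMap (Fin n) ℝ ℝ)) k B y h

end

theorem fderiv_trace_pow (k : ℕ) (y h : UpperPair n → ℝ) :
    fderiv ℝ (fun y : UpperPair n → ℝ => (symMatrix y ^ k).trace) y h =
      k * (symMatrix y ^ (k - 1) * symMatrix h).trace := by
  have h0 := fderiv_trace_pow_mul k 1 y h
  simp only [mul_one] at h0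
  rw [h0, Finset.sum_congr rfl (g := fun _ => (symMatrix y ^ (k - 1) * symMatrix h).trace)]
  · simp
  · intro i hi
    rw [Finset.mem_range] at hi
    rw [Matrix.trace_mul_comm, ← mul_assoc, ← pow_add]
    congr 3
    omega

theorem tracePoly_add (p r : Polynomial ℝ) :
    tracePoly n (p + r) = fun y => tracePoly n p y + tracePoly n r y := by
  ext y; simp [tracePoly]

theorem tracePoly_monomial (k : ℕ) (a : ℝ) :
    tracePoly n (Polynomial.monomial k a) = fun y => a * (symMatrix y ^ k).trace := by
  ext y
  simp [tracePoly, Polynomial.aeval_monomial, Algebra.algebraMap_eq_smul_one]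

theorem contDiff_tracePoly (p : Polynomial ℝ) : ContDiff ℝ (⊤ : ℕ∞) (tracePoly n p) := by
  induction p using Polynomial.induction_on' with
  | add p r hp hr => rw [tracePoly_add]; exact hp.add hr
  | monomial k a =>
    rw [tracePoly_monomial]
    simpa using contDiff_const.mul (contDiff_trace_pow_mul k 1)

/-- The symmetric matrices with coordinate vectors the unit vectors satisfy the Gaussian
orthogonal ensemble contraction rule; this is what the factor `√2` on the diagonal is for. -/
theorem sum_symMatrix_single_mul (i j k l : Fin n) :
    ∑ q : UpperPair n, symMatrix (Pi.single q 1) i j * symMatrix (Pi.single q 1) k l =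
      (if i = k ∧ j = l then 1 else 0) + (if i = l ∧ j = k then (1 : ℝ) else 0) := by
  have h : ∀ q : UpperPair n, symMatrix (Pi.single q (1 : ℝ)) i j *
      symMatrix (Pi.single q 1) k l = if q = ⟨(min i j, max i j), min_le_max⟩ then
        (if i = j then √2 else 1) * (if k = l then √2 else 1) *
        (if min i j = min k l ∧ max i j = max k l then 1 else 0) else 0 := by
    intro q
    rw [symMatrix_apply, symMatrix_apply]
    by_cases hq : q = ⟨(min i j, max i j), min_le_max⟩
    · subst hq
      simp only [Pi.single_apply, if_true, mul_one, Subtype.mk.injEq, Prod.mk.injEq]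
      by_cases h2 : min i j = min k l ∧ max i j = max k l
      · simp [h2]
      · have h3 : ¬ (min k l = min i j ∧ max k l = max i j) :=
          fun h => h2 ⟨h.1.symm, h.2.symm⟩
        simp [h2, h3]
    · rw [if_neg hq, Pi.single_apply, if_neg (Ne.symm hq)]
      simp
  simp only [h, Finset.sum_ite_eq', Finset.mem_univ, if_true]
  have hs : √2 * √2 = (2 : ℝ) := Real.mul_self_sqrt (by norm_num)
  by_cases hij : i = j
  · subst hij
    by_cases hkl : k = l
    · subst hkl
      by_cases hik : i = k
      · simp [hik, hs]; norm_num
      · simp [hik]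
    · have : ¬ (i = min k l ∧ i = max k l) := by
        rintro ⟨h1, h2⟩
        exact hkl (inf_eq_sup.1 (h1.symm.trans h2))
      have h3 : ¬ (i = k ∧ i = l) := fun h => hkl (h.1.symm.trans h.2)
      have h4 : ¬ (i = l ∧ i = k) := fun h => hkl (h.2.symm.trans h.1)
      simp [this, h3, h4]
  · by_cases hkl : k = l
    · subst hkl
      have : ¬ (min i j = k ∧ max i j = k) := by
        rintro ⟨h1, h2⟩
        exact hij (inf_eq_sup.1 (h1.trans h2.symm))
      have h3 : ¬ (i = k ∧ j = k) := fun h => hij (h.1.trans h.2.symm)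
      simp [this, h3]
    · have key : (min i j = min k l ∧ max i j = max k l) ↔ (i = k ∧ j = l) ∨ (i = l ∧ j = k) := by
        grind
      simp only [key, hij, hkl, if_false, one_mul]
      by_cases h1 : i = k ∧ j = l
      · have h2 : ¬ (i = l ∧ j = k) := fun h => hkl (h1.1.symm.trans h.1)
        simp [h1, hkl, Ne.symm hkl]
      · simp [h1]

theorem sum_trace_mul_single (B D : Matrix (Fin n) (Fin n) ℝ) :
    ∑ q : UpperPair n, (B * symMatrix (Pi.single q 1) * D * symMatrix (Pi.single q 1)).trace =
      (B * D.transpose).trace + B.trace * D.trace := by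
  have h : ∀ q : UpperPair n,
      (B * symMatrix (Pi.single q 1) * D * symMatrix (Pi.single q (1 : ℝ))).trace =
      ∑ i, ∑ l, ∑ k, ∑ j, B i j * D k l *
        (symMatrix (Pi.single q 1) j k * symMatrix (Pi.single q 1) l i) := by
    intro q
    simp only [Matrix.trace, Matrix.diag_apply, Matrix.mul_apply, Finset.sum_mul]
    refine Finset.sum_congr rfl fun i _ => Finset.sum_congr rfl fun l _ =>
      Finset.sum_congr rfl fun k _ => Finset.sum_congr rfl fun j _ => by ring
  simp only [h]
  rw [Finset.sum_comm]
  simp only [Finset.sum_comm (s := (Finset.univ : Finset (UpperPair n))), ← Finset.mul_sum,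
    sum_symMatrix_single_mul, mul_add, Finset.sum_add_distrib]
  congr 1
  · simp only [Matrix.trace, Matrix.diag_apply, Matrix.mul_apply, Matrix.transpose_apply, ite_and,
      mul_ite, mul_one, mul_zero, Finset.sum_ite_eq', Finset.mem_univ, if_true]
  · simp only [Matrix.trace, Matrix.diag_apply, ite_and, mul_ite, mul_one, mul_zero,
      Finset.sum_ite_eq', Finset.mem_univ, if_true, Finset.sum_mul_sum]

theorem derivQuotient_eval (p : Polynomial ℝ) (x y : ℝ) :
    derivQuotient (fun x => p.eval x) x y * (x - y) =
      p.derivative.eval x - p.derivative.eval y := by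
  have hd : deriv (fun x => p.eval x) = fun x => p.derivative.eval x := by
    ext x; exact p.deriv
  by_cases h : x = y
  · subst h; simp
  · rw [derivQuotient, if_neg h, hd, div_mul_cancel₀ _ (sub_ne_zero.2 h)]

theorem derivQuotient_eval_self (p : Polynomial ℝ) (x : ℝ) :
    derivQuotient (fun x => p.eval x) x x = p.derivative.derivative.eval x := by
  have hd : deriv (fun x => p.eval x) = fun x => p.derivative.eval x := by
    ext x; exact p.deriv
  rw [derivQuotient, if_pos rfl, hd]
  exact p.derivative.deriv

theorem derivQuotient_eval_add (p r : Polynomial ℝ) (x y : ℝ) :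
    derivQuotient (fun x => (p + r).eval x) x y =
      derivQuotient (fun x => p.eval x) x y + derivQuotient (fun x => r.eval x) x y := by
  by_cases h : x = y
  · subst h; simp only [derivQuotient_eval_self]; simp
  · refine mul_right_cancel₀ (sub_ne_zero.2 h) ?_
    rw [add_mul]
    simp only [derivQuotient_eval]
    simp; ring

theorem derivQuotient_eval_monomial (k : ℕ) (a x y : ℝ) :
    derivQuotient (fun x => (Polynomial.monomial k a).eval x) x y =
      a * k * ∑ i ∈ Finset.range (k - 1), x ^ i * y ^ (k - 1 - 1 - i) := by
  by_cases h : x = y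
  · subst h
    rw [derivQuotient_eval_self, Finset.sum_congr rfl (g := fun _ => x ^ (k - 1 - 1))]
    · simp [Polynomial.derivative_monomial]; ring
    · intro i hi
      rw [Finset.mem_range] at hi
      rw [← pow_add]; congr 1; omega
  · refine mul_right_cancel₀ (sub_ne_zero.2 h) ?_
    rw [derivQuotient_eval, mul_assoc, geom_sum₂_mul]
    simp [Polynomial.derivative_monomial]; ring

theorem fderiv_tracePoly_add (p r : Polynomial ℝ) (y h : UpperPair n → ℝ) :
    fderiv ℝ (tracePoly n (p + r)) y h =
      fderiv ℝ (tracePoly n p) y h + fderiv ℝ (tracePoly n r) y h := by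
  rw [tracePoly_add, fderiv_fun_add]
  · rfl
  · exact (contDiff_tracePoly p).differentiable (by simp) y
  · exact (contDiff_tracePoly r).differentiable (by simp) y

theorem contDiff_fderiv_apply {E : Type*} [NormedAddCommGroup E] [NormedSpace ℝ E] {G : E → ℝ}
    (hG : ContDiff ℝ (⊤ : ℕ∞) G) (e : E) : ContDiff ℝ (⊤ : ℕ∞) fun y => fderiv ℝ G y e :=
  (hG.fderiv_right (m := (⊤ : ℕ∞)) (by simp)).clm_apply contDiff_const

/-- The Laplacian of a linear spectral statistic in the coordinates `y`. -/
theorem laplacian_tracePoly (p : Polynomial ℝ) (y : UpperPair n → ℝ) :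
    ∑ q : UpperPair n, fderiv ℝ (fun z => fderiv ℝ (tracePoly n p) z (Pi.single q 1)) y
        (Pi.single q 1) =
      ∑ i, p.derivative.derivative.eval (eigFun n i y) +
        ∑ i, ∑ j, derivQuotient (fun x => p.eval x) (eigFun n i y) (eigFun n j y) := by
  induction p using Polynomial.induction_on' with
  | add p r hp hr =>
    have : ∀ q : UpperPair n,
        fderiv ℝ (fun z => fderiv ℝ (tracePoly n (p + r)) z (Pi.single q 1)) y (Pi.single q 1) =
        fderiv ℝ (fun z => fderiv ℝ (tracePoly n p) z (Pi.single q 1)) y (Pi.single q 1) +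
        fderiv ℝ (fun z => fderiv ℝ (tracePoly n r) z (Pi.single q 1)) y (Pi.single q 1) := by
      intro q
      simp only [fderiv_tracePoly_add]
      rw [fderiv_fun_add]
      · rfl
      · exact (contDiff_fderiv_apply (contDiff_tracePoly p) _).differentiable (by simp) y
      · exact (contDiff_fderiv_apply (contDiff_tracePoly r) _).differentiable (by simp) y
    simp only [this, Finset.sum_add_distrib, hp, hr, derivQuotient_eval_add,
      Polynomial.derivative_add]
    simp only [Polynomial.eval_add, Finset.sum_add_distrib]
    ring
  | monomial k a =>
    have h1 : ∀ (z h : UpperPair n → ℝ), fderiv ℝ (tracePoly n (Polynomial.monomial k a)) z h =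
        a * k * (symMatrix z ^ (k - 1) * symMatrix h).trace := by
      intro z h
      rw [tracePoly_monomial, fderiv_const_mul]
      · rw [smul_apply, fderiv_trace_pow, smul_eq_mul, mul_assoc]
      · have := (contDiff_trace_pow_mul (n := n) k 1).differentiable (by simp) z
        simpa using this
    have h2 : ∀ q : UpperPair n,
        fderiv ℝ (fun z => fderiv ℝ (tracePoly n (Polynomial.monomial k a)) z (Pi.single q 1)) y
          (Pi.single q 1) = a * k * ∑ i ∈ Finset.range (k - 1),
          (symMatrix y ^ (k - 1 - 1 - i) * symMatrix (Pi.single q 1) * symMatrix y ^ i *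
            symMatrix (Pi.single q 1)).trace := by
      intro q
      simp only [h1]
      rw [fderiv_const_mul]
      · rw [smul_apply, fderiv_trace_pow_mul, smul_eq_mul]
      · exact (contDiff_trace_pow_mul (n := n) _ _).differentiable (by simp) y
    simp only [h2]
    rw [← Finset.mul_sum, Finset.sum_comm]
    simp only [sum_trace_mul_single, derivQuotient_eval_monomial]
    have hT : ∀ i, (symMatrix y ^ i).transpose = symMatrix y ^ i := fun i => by
      rw [Matrix.transpose_pow]
      congr 1
      exact symMatrix_isHermitian y
    simp only [hT, trace_pow_eq_sum (symMatrix_isHermitian y), ← pow_add]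
    rw [Finset.sum_add_distrib, mul_add]
    congr 1
    · rw [Finset.sum_congr rfl (g := fun _ => ∑ j, orderedEig (symMatrix y) j ^ (k - 1 - 1))]
      · simp only [Polynomial.derivative_monomial, Polynomial.eval_monomial, eigFun,
          ← Finset.mul_sum, Finset.sum_const, Finset.card_range, nsmul_eq_mul]
        ring
      · intro i hi
        rw [Finset.mem_range] at hi
        rw [show k - 1 - 1 - i + i = k - 1 - 1 by omega]
    · simp only [← Finset.mul_sum, eigFun]
      congr 1
      simp only [Finset.sum_comm (t := Finset.range (k - 1))]
      refine Finset.sum_congr rfl fun x _ => ?_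
      rw [mul_comm, Finset.sum_mul_sum]

end TracePolynomials

/-! ### Existence of a regular set -/

section RegularSet

variable {n : ℕ}

/-- The determinant of the Hankel matrix of the moments `Tr M^(a+b)`, `a, b < n`. For symmetric `M`
it is the discriminant of the characteristic polynomial. -/
def momentDet (M : Matrix (Fin n) (Fin n) ℝ) : ℝ :=
  (Matrix.of fun a b : Fin n => (M ^ (a + b : ℕ)).trace).det

theorem momentDet_eq_sq {M : Matrix (Fin n) (Fin n) ℝ} {v : Fin n → ℝ}
    (h : ∀ k : ℕ, (M ^ k).trace = ∑ i, v i ^ k) :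
    momentDet M = (Matrix.vandermonde v).det ^ 2 := by
  have : (Matrix.of fun a b : Fin n => (M ^ (a + b : ℕ)).trace) =
      (Matrix.vandermonde v).transpose * Matrix.vandermonde v := by
    ext a b
    rw [Matrix.vandermonde_transpose_mul_vandermonde, Matrix.of_apply, h]
  rw [momentDet, this, Matrix.det_mul, Matrix.det_transpose, sq]

theorem momentDet_ne_zero_iff {M : Matrix (Fin n) (Fin n) ℝ} {v : Fin n → ℝ}
    (h : ∀ k : ℕ, (M ^ k).trace = ∑ i, v i ^ k) :
    momentDet M ≠ 0 ↔ Function.Injective v := by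
  rw [momentDet_eq_sq h, pow_ne_zero_iff two_ne_zero, Matrix.det_vandermonde_ne_zero_iff]

theorem momentDet_smul (t : ℝ) (M : Matrix (Fin n) (Fin n) ℝ) :
    momentDet (t • M) = (∏ a : Fin n, t ^ (a : ℕ)) * ((∏ a : Fin n, t ^ (a : ℕ)) * momentDet M) := by
  rw [momentDet, momentDet, ← Matrix.det_mul_row, ← Matrix.det_mul_column]
  congr 1
  ext a b
  simp only [Matrix.of_apply, smul_pow, Matrix.trace_smul, smul_eq_mul]
  rw [pow_add t]
  ring

/-- On a line, `momentDet` is a polynomial function of the parameter. -/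
theorem exists_polynomial_momentDet (M N : Matrix (Fin n) (Fin n) ℝ) :
    ∃ p : Polynomial ℝ, ∀ t : ℝ, p.eval t = momentDet (M + t • N) := by
  let Q : Matrix (Fin n) (Fin n) (Polynomial ℝ) :=
    M.map Polynomial.C + (Polynomial.X : Polynomial ℝ) • N.map Polynomial.C
  refine ⟨(Matrix.of fun a b : Fin n => (Q ^ (a + b : ℕ)).trace).det, fun t => ?_⟩
  have hQ : Q.map (Polynomial.evalRingHom t) = M + t • N := by
    ext i j
    simp only [Q, Matrix.map_apply, Matrix.add_apply, Matrix.smul_apply, smul_eq_mul,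
      Polynomial.coe_evalRingHom, Polynomial.eval_add, Polynomial.eval_mul, Polynomial.eval_C,
      Polynomial.eval_X]
  rw [← Polynomial.coe_evalRingHom, RingHom.map_det, momentDet]
  congr 1
  ext a b
  rw [RingHom.mapMatrix_apply, Matrix.map_apply, Matrix.of_apply, Matrix.of_apply,
    AddMonoidHom.map_trace, Matrix.map_pow, hQ]

theorem exists_momentDet_add_smul_ne_zero (M N : Matrix (Fin n) (Fin n) ℝ)
    (hN : momentDet N ≠ 0) : ∃ t : ℝ, momentDet (M + t • N) ≠ 0 := by
  obtain ⟨p, hp⟩ := exists_polynomial_momentDet N M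
  have hp0 : p ≠ 0 := by
    rintro rfl
    have := hp 0
    simp at this
    exact hN this.symm
  -- a small multiple of `M` does not affect `momentDet N ≠ 0`, and `momentDet` is homogeneous
  obtain ⟨ε, hε⟩ := Set.Infinite.exists_notMem_finset (Set.Ioi_infinite (0 : ℝ)) p.roots.toFinset
  obtain ⟨hε0, hε⟩ := hε
  have hε1 : momentDet (N + ε • M) ≠ 0 := by
    rw [← hp]
    simpa [hp0] using hε
  refine ⟨ε⁻¹, fun h0 => hε1 ?_⟩
  have : N + ε • M = ε • (M + ε⁻¹ • N) := by
    rw [smul_add, smul_smul, mul_inv_cancel₀ (ne_of_gt hε0), one_smul, add_comm]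
  rw [this, momentDet_smul, h0]
  simp

theorem finite_momentDet_eq_zero (M N : Matrix (Fin n) (Fin n) ℝ) (hN : momentDet N ≠ 0) :
    {t : ℝ | momentDet (M + t • N) = 0}.Finite := by
  obtain ⟨p, hp⟩ := exists_polynomial_momentDet M N
  obtain ⟨t, ht⟩ := exists_momentDet_add_smul_ne_zero M N hN
  have hp0 : p ≠ 0 := by
    rintro rfl
    exact ht (by rw [← hp]; simp)
  refine p.roots.toFinset.finite_toSet.subset fun t ht => ?_
  simpa [hp0, hp] using ht

theorem exists_momentDet_symMatrix_ne_zero (n : ℕ) :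
    ∃ y : UpperPair n → ℝ, momentDet (symMatrix y) ≠ 0 := by
  refine ⟨symCoord (Matrix.diagonal fun i : Fin n => (i : ℝ)), ?_⟩
  rw [symMatrix_symCoord (Matrix.isSymm_diagonal _)]
  refine (momentDet_ne_zero_iff (v := fun i : Fin n => (i : ℝ)) fun k => ?_).2 ?_
  · rw [Matrix.diagonal_pow, Matrix.trace_diagonal]; rfl
  · intro i j hij
    have h : ((i : ℕ) : ℝ) = (j : ℕ) := hij
    exact Fin.ext (by exact_mod_cast h)

theorem momentDet_symMatrix_ne_zero_iff (y : UpperPair n → ℝ) :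
    momentDet (symMatrix y) ≠ 0 ↔ Function.Injective fun i => eigFun n i y :=
  momentDet_ne_zero_iff fun k => trace_pow_eq_sum (symMatrix_isHermitian y) k

/-- Simple eigenvalues depend smoothly on the matrix: near a point with distinct eigenvalues, the
power sums are local coordinates for the tuple of eigenvalues, and as functions of the matrix they
are the polynomials `Tr M^k`. -/
theorem contDiffAt_eigFun {y : UpperPair n → ℝ} (hy : Function.Injective fun i => eigFun n i y)
    (i : Fin n) : ContDiffAt ℝ (⊤ : ℕ∞) (eigFun n i) y := by
  let S : (Fin n → ℝ) → Fin n → ℝ := fun v k => ∑ j, v j ^ (k + 1 : ℕ)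
  let v₀ : Fin n → ℝ := fun j => eigFun n j y
  have hS : ContDiff ℝ (⊤ : ℕ∞) S := by
    refine contDiff_pi.2 fun k => ContDiff.sum fun j _ => ?_
    exact (contDiff_apply ℝ ℝ j).pow _
  let L : (Fin n → ℝ) →ₗ[ℝ] (Fin n → ℝ) :=
    LinearMap.pi fun k => ∑ j, ((k + 1 : ℕ) * v₀ j ^ (k : ℕ)) • LinearMap.proj j
  have hL : Function.Injective L := by
    rw [← LinearMap.ker_eq_bot, LinearMap.ker_eq_bot']
    intro h hh
    refine Matrix.eq_zero_of_forall_pow_sum_mul_pow_eq_zero hy fun k => ?_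
    have := congrFun hh k
    simp only [L, LinearMap.pi_apply, LinearMap.sum_apply, LinearMap.smul_apply,
      LinearMap.proj_apply, smul_eq_mul, Pi.zero_apply, mul_assoc] at this
    rw [← Finset.mul_sum] at this
    rcases mul_eq_zero.1 this with h0 | h0
    · exact absurd h0 (by positivity)
    · rw [← h0]
      exact Finset.sum_congr rfl fun j _ => mul_comm _ _
  let e : (Fin n → ℝ) ≃L[ℝ] (Fin n → ℝ) :=
    (LinearEquiv.ofInjectiveEndo L hL).toContinuousLinearEquiv
  have he : HasFDerivAt S (e : (Fin n → ℝ) →L[ℝ] (Fin n → ℝ)) v₀ := by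
    refine hasFDerivAt_pi'.2 fun k => ?_
    have h1 : HasFDerivAt (fun v : Fin n → ℝ => ∑ j, v j ^ (k + 1 : ℕ))
        (∑ j, ((k + 1 : ℕ) * v₀ j ^ (k : ℕ)) •
          (ContinuousLinearMap.proj j : (Fin n → ℝ) →L[ℝ] ℝ)) v₀ := by
      refine HasFDerivAt.fun_sum fun j _ => ?_
      have := (hasFDerivAt_apply (𝕜 := ℝ) j v₀).pow (k + 1 : ℕ)
      simpa using this
    refine h1.congr_fderiv ?_
    ext h
    simp [e, L]
  have hinv := hS.contDiffAt.to_localInverse he (by simp)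
  have hleft := (hS.contDiffAt.hasStrictFDerivAt' he (by simp)).eventually_left_inverse
  have hcont : ContinuousAt (fun z : UpperPair n → ℝ => fun j => eigFun n j z) y :=
    continuousAt_pi.2 fun j => (eigFun_lipschitz n j).continuous.continuousAt
  let W : (UpperPair n → ℝ) → Fin n → ℝ := fun z k => (symMatrix z ^ (k + 1 : ℕ)).trace
  have hW : ContDiff ℝ (⊤ : ℕ∞) W :=
    contDiff_pi.2 fun k => by simpa using contDiff_trace_pow_mul (n := n) (k + 1 : ℕ) 1
  have hWS : ∀ z, W z = S fun j => eigFun n j z := fun z => by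
    ext k
    exact trace_pow_eq_sum (symMatrix_isHermitian z) _
  have hinv' : ContDiffAt ℝ (⊤ : ℕ∞) (hS.contDiffAt.localInverse he (by simp)) (W y) := by
    rw [hWS]; exact hinv
  have hcomp := hinv'.comp y hW.contDiffAt
  have hall : ContDiffAt ℝ (⊤ : ℕ∞) (fun z : UpperPair n → ℝ => fun j => eigFun n j z) y := by
    refine hcomp.congr_of_eventuallyEq ?_
    filter_upwards [hcont.eventually hleft] with z hz
    rw [Function.comp_apply, hWS]
    exact hz.symm
  exact contDiffAt_pi.1 hall i

theorem exists_isRegularSet (n : ℕ) : ∃ G : Set (UpperPair n → ℝ), IsRegularSet n G := by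
  obtain ⟨z, hz⟩ := exists_momentDet_symMatrix_ne_zero n
  have hopen : IsOpen {y : UpperPair n → ℝ | Function.Injective fun i => eigFun n i y} := by
    have : {y : UpperPair n → ℝ | Function.Injective fun i => eigFun n i y} =
        ⋂ i, ⋂ j, ⋂ (_ : i ≠ j), {y | eigFun n i y ≠ eigFun n j y} := by
      ext y
      simp only [mem_ofPred_eq, mem_iInter, Function.Injective]
      exact ⟨fun h i j hij h' => hij (h h'),
        fun h i j h' => not_imp_comm.1 (h i j) (by simpa using h')⟩
    rw [this]
    refine isOpen_iInter_of_finite fun i => isOpen_iInter_of_finite fun j =>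
      isOpen_iInter_of_finite fun _ => ?_
    exact isOpen_ne_fun (eigFun_lipschitz n i).continuous (eigFun_lipschitz n j).continuous
  refine ⟨_, hopen, ?_, fun i y hy => (contDiffAt_eigFun hy i).contDiffWithinAt⟩
  have := ae_mem_of_ae_add_linearMap_mem (LinearMap.toSpanSingleton ℝ (UpperPair n → ℝ) z)
    (volume : Measure ℝ) (volume : Measure (UpperPair n → ℝ)) hopen.measurableSet (fun y => by
      have hfin := finite_momentDet_eq_zero (symMatrix y) (symMatrix z) hz
      have hnull : volume {t : ℝ | momentDet (symMatrix y + t • symMatrix z) = 0} = 0 :=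
        hfin.measure_zero _
      filter_upwards [measure_eq_zero_iff_ae_notMem.1 hnull] with t ht
      rw [← momentDet_symMatrix_ne_zero_iff, LinearMap.toSpanSingleton_apply,
        symMatrix_add, symMatrix_smul]
      exact ht)
  exact mem_ae_iff.1 this

end RegularSet

/-! ### Cutoffs and polynomial approximation -/

section Approximation

theorem Polynomial.exists_derivative_eq (q : Polynomial ℝ) :
    ∃ p : Polynomial ℝ, Polynomial.derivative p = q := by
  induction q using Polynomial.induction_on' with
  | add p r hp hr =>
    obtain ⟨p', rfl⟩ := hp
    obtain ⟨r', rfl⟩ := hr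
    exact ⟨p' + r', Polynomial.derivative_add⟩
  | monomial k a =>
    refine ⟨Polynomial.monomial (k + 1) (a / (k + 1)), ?_⟩
    rw [Polynomial.derivative_monomial]
    congr 1
    push_cast
    field_simp

theorem abs_sub_le_of_abs_deriv_le {h h' : ℝ → ℝ} (hh : ∀ x, HasDerivAt h (h' x) x) {K ε : ℝ}
    (hε : ∀ x, |x| ≤ K → |h' x| ≤ ε) {x y : ℝ} (hx : |x| ≤ K) (hy : |y| ≤ K) :
    |h x - h y| ≤ ε * |x - y| := by
  refine Convex.norm_image_sub_le_of_norm_hasDerivWithin_le (f' := h') (s := Icc (-K) K)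
    (fun z _ => (hh z).hasDerivWithinAt) (fun z hz => hε z (abs_le.2 hz)) (convex_Icc _ _)
    (abs_le.1 hy) (abs_le.1 hx)

theorem MemCb.contDiff {f : ℝ → ℝ} (hf : MemCb 2 f) : ContDiff ℝ 2 f := hf.1

theorem MemCb.hasDerivAt {f : ℝ → ℝ} (hf : MemCb 2 f) (x : ℝ) : HasDerivAt f (deriv f x) x :=
  (hf.contDiff.differentiable (by simp) x).hasDerivAt

theorem MemCb.contDiff_deriv {f : ℝ → ℝ} (hf : MemCb 2 f) : ContDiff ℝ 1 (deriv f) := by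
  have h : ContDiff ℝ (1 + 1) f := by simpa [one_add_one_eq_two] using hf.contDiff
  exact (contDiff_succ_iff_deriv.1 h).2.2

theorem MemCb.hasDerivAt_deriv {f : ℝ → ℝ} (hf : MemCb 2 f) (x : ℝ) :
    HasDerivAt (deriv f) (deriv (deriv f) x) x :=
  (hf.contDiff_deriv.differentiable (by simp) x).hasDerivAt

theorem MemCb.continuous_deriv_deriv {f : ℝ → ℝ} (hf : MemCb 2 f) :
    Continuous (deriv (deriv f)) :=
  hf.contDiff_deriv.continuous_deriv le_rfl

theorem MemCb.exists_bound {f : ℝ → ℝ} (hf : MemCb 2 f) :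
    ∃ C : ℝ, 0 ≤ C ∧ (∀ x, |deriv f x| ≤ C) ∧ ∀ x, |deriv (deriv f) x| ≤ C := by
  obtain ⟨C₁, h₁⟩ := hf.2 1 le_rfl (by norm_num)
  obtain ⟨C₂, h₂⟩ := hf.2 2 (by norm_num) le_rfl
  rw [iteratedDeriv_one] at h₁
  rw [show (2 : ℕ) = 1 + 1 from rfl, iteratedDeriv_succ, iteratedDeriv_one] at h₂
  exact ⟨max C₁ C₂, (abs_nonneg _).trans ((h₁ 0).trans (le_max_left _ _)),
    fun x => (h₁ x).trans (le_max_left _ _), fun x => (h₂ x).trans (le_max_right _ _)⟩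

theorem Polynomial.exists_near_of_memCb {f : ℝ → ℝ} (hf : MemCb 2 f) {K ε : ℝ} (hK : 0 ≤ K)
    (hε : 0 < ε) : ∃ p : Polynomial ℝ, ∀ x, |x| ≤ K →
      |p.eval x - f x| ≤ ε ∧ |p.derivative.eval x - deriv f x| ≤ ε ∧
      |p.derivative.derivative.eval x - deriv (deriv f) x| ≤ ε := by
  have hδ : 0 < ε / (1 + K) ^ 2 := by positivity
  obtain ⟨q, hq⟩ := exists_polynomial_near_of_continuousOn (-K) K (deriv (deriv f))
    hf.continuous_deriv_deriv.continuousOn _ hδ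
  obtain ⟨q₁, hq₁⟩ := Polynomial.exists_derivative_eq q
  let r := q₁ + Polynomial.C (deriv f 0 - q₁.eval 0)
  have hr : Polynomial.derivative r = q := by simp [r, hq₁]
  have hr0 : r.eval 0 = deriv f 0 := by simp [r]
  obtain ⟨r₁, hr₁⟩ := Polynomial.exists_derivative_eq r
  let p := r₁ + Polynomial.C (f 0 - r₁.eval 0)
  have hp : Polynomial.derivative p = r := by simp [p, hr₁]
  have hp0 : p.eval 0 = f 0 := by simp [p]
  set δ := ε / (1 + K) ^ 2 with hδdef
  have hδε : δ * (1 + K) ^ 2 = ε := by rw [hδdef]; field_simp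
  have e0 : ∀ x, |x| ≤ K → |q.eval x - deriv (deriv f) x| ≤ δ := fun x hx =>
    (hq x (abs_le.1 hx)).le
  have e1 : ∀ x, |x| ≤ K → |r.eval x - deriv f x| ≤ δ * K := fun x hx => by
    have h := abs_sub_le_of_abs_deriv_le (h := fun x => r.eval x - deriv f x)
      (h' := fun x => q.eval x - deriv (deriv f) x)
      (fun x => by rw [← hr]; exact (r.hasDerivAt x).sub (hf.hasDerivAt_deriv x)) e0 hx
      (y := 0) (by simpa using hK)
    simp only [hr0, sub_self, sub_zero] at h
    exact h.trans (mul_le_mul_of_nonneg_left hx hδ.le)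
  have e2 : ∀ x, |x| ≤ K → |p.eval x - f x| ≤ δ * K * K := fun x hx => by
    have h := abs_sub_le_of_abs_deriv_le (h := fun x => p.eval x - f x)
      (h' := fun x => r.eval x - deriv f x)
      (fun x => by rw [← hp]; exact (p.hasDerivAt x).sub (hf.hasDerivAt x)) e1 hx
      (y := 0) (by simpa using hK)
    simp only [hp0, sub_self, sub_zero] at h
    exact h.trans (mul_le_mul_of_nonneg_left hx (by positivity))
  refine ⟨p, fun x hx => ⟨(e2 x hx).trans ?_, ?_, ?_⟩⟩
  · nlinarith
  · rw [hp]; exact (e1 x hx).trans (by nlinarith)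
  · rw [hp, hr]; exact (e0 x hx).trans
      (by nlinarith [mul_nonneg hδ.le hK, mul_nonneg hδ.le (mul_nonneg hK hK)])

/-- The divided difference of `f'` differs from that of `p'` at most by the supremum of
`|p'' - f''|`. -/
theorem abs_derivQuotient_sub_le {f : ℝ → ℝ} (hf : MemCb 2 f) (p : Polynomial ℝ) {K ε : ℝ}
    (h : ∀ x, |x| ≤ K → |p.derivative.derivative.eval x - deriv (deriv f) x| ≤ ε) {x y : ℝ}
    (hx : |x| ≤ K) (hy : |y| ≤ K) :
    |derivQuotient (fun x => p.eval x) x y - derivQuotient f x y| ≤ ε := by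
  by_cases hxy : x = y
  · subst hxy
    rw [derivQuotient_eval_self, derivQuotient, if_pos rfl]
    exact h x hx
  · have hpos : 0 < |x - y| := abs_pos.2 (sub_ne_zero.2 hxy)
    refine le_of_mul_le_mul_right ?_ hpos
    rw [← abs_mul, sub_mul, derivQuotient_eval, derivQuotient, if_neg hxy,
      div_mul_cancel₀ _ (sub_ne_zero.2 hxy)]
    have := abs_sub_le_of_abs_deriv_le (h := fun x => p.derivative.eval x - deriv f x)
      (h' := fun x => p.derivative.derivative.eval x - deriv (deriv f) x)
      (fun x => (p.derivative.hasDerivAt x).sub (hf.hasDerivAt_deriv x)) h hx hy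
    rwa [sub_sub_sub_comm] at this

theorem abs_derivQuotient_le {f : ℝ → ℝ} (hf : MemCb 2 f) {C : ℝ}
    (hC : ∀ x, |deriv (deriv f) x| ≤ C) (x y : ℝ) : |derivQuotient f x y| ≤ C := by
  simpa [derivQuotient] using abs_derivQuotient_sub_le hf 0 (K := max |x| |y|) (ε := C)
    (fun x _ => by simpa using hC x) (le_max_left _ _) (le_max_right _ _) (x := x) (y := y)

/-- Smooth cutoffs at scale `N`, with derivatives of size `1 / N`. -/
theorem exists_cutoff (ι : Type*) [Fintype ι] [DecidableEq ι] :
    ∃ (χ : ℕ → (ι → ℝ) → ℝ) (B : ℝ), 0 ≤ B ∧ ∀ N,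
      ContDiff ℝ (⊤ : ℕ∞) (χ N) ∧ HasCompactSupport (χ N) ∧ (∀ y, |χ N y| ≤ 1) ∧
      (∀ y, 2 * (N + 1 : ℝ) < ‖y‖ → χ N =ᶠ[nhds y] fun _ => 0) ∧
      (∀ y, ‖y‖ < N + 1 → χ N =ᶠ[nhds y] fun _ => 1) ∧
      (∀ y q, |fderiv ℝ (χ N) y (Pi.single q 1)| * (N + 1) ≤ B) ∧
      ∀ y q, |fderiv ℝ (fun z => fderiv ℝ (χ N) z (Pi.single q 1)) y (Pi.single q 1)| * (N + 1)
        ≤ B := by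
  let b : ContDiffBump (0 : ι → ℝ) := ⟨1, 2, one_pos, one_lt_two⟩
  have hb : ContDiff ℝ (⊤ : ℕ∞) b := b.contDiff
  have hb1 : ∀ q : ι, ContDiff ℝ (⊤ : ℕ∞) fun z => fderiv ℝ b z (Pi.single q 1) := fun q =>
    contDiff_fderiv_apply hb _
  have hb2 : ∀ q : ι, ContDiff ℝ (⊤ : ℕ∞)
      fun y => fderiv ℝ (fun z => fderiv ℝ b z (Pi.single q 1)) y (Pi.single q 1) := fun q =>
    contDiff_fderiv_apply (hb1 q) _
  have hc : HasCompactSupport b := b.hasCompactSupport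
  have hc1 : ∀ q : ι, HasCompactSupport fun z => fderiv ℝ b z (Pi.single q 1) := fun q =>
    hc.fderiv_apply ℝ _
  have hc2 : ∀ q : ι, HasCompactSupport
      fun y => fderiv ℝ (fun z => fderiv ℝ b z (Pi.single q 1)) y (Pi.single q 1) := fun q =>
    (hc1 q).fderiv_apply ℝ _
  choose B₁ hB₁ using fun q => (hc1 q).exists_bound_of_continuous (hb1 q).continuous
  choose B₂ hB₂ using fun q => (hc2 q).exists_bound_of_continuous (hb2 q).continuous
  have hB₁0 : ∀ q, 0 ≤ B₁ q := fun q => (norm_nonneg _).trans (hB₁ q 0)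
  have hB₂0 : ∀ q, 0 ≤ B₂ q := fun q => (norm_nonneg _).trans (hB₂ q 0)
  refine ⟨fun N y => b ((N + 1 : ℝ)⁻¹ • y), ∑ q, (B₁ q + B₂ q),
    Finset.sum_nonneg fun q _ => add_nonneg (hB₁0 q) (hB₂0 q), fun N => ?_⟩
  have hN : (0 : ℝ) < N + 1 := by positivity
  have hN1 : (1 : ℝ) ≤ N + 1 := by linarith [Nat.cast_nonneg (α := ℝ) N]
  have hd : ∀ (g : (ι → ℝ) → ℝ), ContDiff ℝ (⊤ : ℕ∞) g → ∀ y e,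
      fderiv ℝ (fun z => g ((N + 1 : ℝ)⁻¹ • z)) y e =
        (N + 1 : ℝ)⁻¹ * fderiv ℝ g ((N + 1 : ℝ)⁻¹ • y) e := by
    intro g hg y e
    have h1 := ((hg.differentiable (by simp) ((N + 1 : ℝ)⁻¹ • y)).hasFDerivAt).comp y
      ((hasFDerivAt_id (𝕜 := ℝ) y).const_smul ((N + 1 : ℝ)⁻¹))
    have h2 : fderiv ℝ (fun z => g ((N + 1 : ℝ)⁻¹ • z)) y = _ := h1.fderiv
    rw [h2]
    simp
  have hle : ∀ q, B₁ q + B₂ q ≤ ∑ q, (B₁ q + B₂ q) := fun q =>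
    Finset.single_le_sum (f := fun q => B₁ q + B₂ q)
      (fun q _ => add_nonneg (hB₁0 q) (hB₂0 q)) (Finset.mem_univ q)
  have hnorm : ∀ y : ι → ℝ, ‖(N + 1 : ℝ)⁻¹ • y‖ = ‖y‖ / (N + 1) := fun y => by
    rw [norm_smul, norm_inv, Real.norm_of_nonneg hN.le]; ring
  refine ⟨hb.comp (contDiff_const_smul _), ?_, ?_, ?_, ?_, ?_, ?_⟩
  · refine HasCompactSupport.comp_homeomorph hc
      (Homeomorph.smulOfNeZero ((N + 1 : ℝ)⁻¹) (inv_ne_zero hN.ne'))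
  · intro y
    rw [abs_of_nonneg b.nonneg]
    exact b.le_one
  · intro y hy
    have : ∀ᶠ z in nhds y, 2 * (N + 1 : ℝ) < ‖z‖ :=
      continuous_norm.continuousAt.eventually_const_lt hy
    filter_upwards [this] with z hz
    refine b.zero_of_le_dist ?_
    rw [dist_zero_right, hnorm, le_div_iff₀ hN]
    exact hz.le
  · intro y hy
    have : ∀ᶠ z in nhds y, ‖z‖ < N + 1 := continuous_norm.continuousAt.eventually_lt_const hy
    filter_upwards [this] with z hz
    refine b.one_of_mem_closedBall ?_
    rw [mem_closedBall_zero_iff, hnorm, div_le_iff₀ hN, show b.rIn = 1 from rfl, one_mul]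
    exact hz.le
  · intro y q
    rw [hd b hb, abs_mul, abs_of_pos (inv_pos.2 hN)]
    have := hB₁ q ((N + 1 : ℝ)⁻¹ • y)
    rw [Real.norm_eq_abs] at this
    calc _ = |fderiv ℝ b ((N + 1 : ℝ)⁻¹ • y) (Pi.single q 1)| := by field_simp
      _ ≤ _ := by linarith [hle q, hB₂0 q]
  · intro y q
    simp only [hd b hb]
    rw [fderiv_const_mul, smul_apply, hd _ (hb1 q), smul_eq_mul, abs_mul, abs_mul,
      abs_of_pos (inv_pos.2 hN)]
    · have := hB₂ q ((N + 1 : ℝ)⁻¹ • y)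
      rw [Real.norm_eq_abs] at this
      calc _ = (N + 1 : ℝ)⁻¹ * |fderiv ℝ (fun z => fderiv ℝ b z (Pi.single q 1))
            ((N + 1 : ℝ)⁻¹ • y) (Pi.single q 1)| := by field_simp
        _ ≤ 1 * B₂ q := by
          gcongr
          exact inv_le_one_of_one_le₀ hN1
        _ ≤ _ := by linarith [hle q, hB₁0 q]
    · exact ((hb1 q).comp (contDiff_const_smul _)).differentiable (by simp) y

end Approximation

/-! ### Approximation of linear spectral statistics -/

section SpectralApproximation

variable {n : ℕ}

/-- The gradient of `y ↦ ∑_i f(Φ_i(y))` at a point where the `Φ_i` are differentiable. -/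
def statGrad (n : ℕ) (f : ℝ → ℝ) (q : UpperPair n) (y : UpperPair n → ℝ) : ℝ :=
  ∑ i, deriv f (eigFun n i y) * eigFunPartial n i q y

/-- The Laplacian of `y ↦ ∑_i f(Φ_i(y))`, expressed through the eigenvalues. -/
def statLap (n : ℕ) (f : ℝ → ℝ) (y : UpperPair n → ℝ) : ℝ :=
  ∑ i, deriv (deriv f) (eigFun n i y) + ∑ i, ∑ j, derivQuotient f (eigFun n i y) (eigFun n j y)

theorem fderiv_tracePoly_of_mem {G : Set (UpperPair n → ℝ)} (hG : IsRegularSet n G)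
    {y : UpperPair n → ℝ} (hy : y ∈ G) (p : Polynomial ℝ) (q : UpperPair n) :
    fderiv ℝ (tracePoly n p) y (Pi.single q 1) =
      ∑ i, p.derivative.eval (eigFun n i y) * eigFunPartial n i q y := by
  have h1 : HasFDerivAt (fun y => ∑ i, p.eval (eigFun n i y))
      (∑ i, p.derivative.eval (eigFun n i y) • fderiv ℝ (eigFun n i) y) y := by
    refine HasFDerivAt.fun_sum fun i _ => ?_
    have hd : DifferentiableAt ℝ (eigFun n i) y :=
      ((hG.smooth i).contDiffAt (hG.isOpen.mem_nhds hy)).differentiableAt (by simp)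
    exact (p.hasDerivAt _).comp_hasFDerivAt y hd.hasFDerivAt
  have h2 : tracePoly n p = fun y => ∑ i, p.eval (eigFun n i y) := by
    ext y; exact tracePoly_eq_sum p y
  rw [h2, h1.fderiv]
  simp [eigFunPartial]

theorem abs_eigFun_le (y : UpperPair n → ℝ) (i : Fin n) :
    |eigFun n i y| ≤ ∑ j, |eigFun n j 0| + 2 * n * ‖y‖ := by
  have h := (eigFun_lipschitz n i).dist_le_mul y 0
  rw [Real.dist_eq, dist_zero_right] at h
  push_cast at h
  have h1 : |eigFun n i 0| ≤ ∑ j, |eigFun n j 0| :=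
    Finset.single_le_sum (f := fun j => |eigFun n j 0|) (fun j _ => abs_nonneg _)
      (Finset.mem_univ i)
  have h2 := abs_add_le (eigFun n i y - eigFun n i 0) (eigFun n i 0)
  rw [sub_add_cancel] at h2
  linarith

theorem MemCb.abs_le {f : ℝ → ℝ} (hf : MemCb 2 f) {C : ℝ} (hC : ∀ x, |deriv f x| ≤ C) (x : ℝ) :
    |f x| ≤ |f 0| + C * |x| := by
  have h := abs_sub_le_of_abs_deriv_le (K := |x|) hf.hasDerivAt (fun x _ => hC x) le_rfl
    (y := 0) (by simp)
  rw [sub_zero] at h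
  have := abs_add_le (f x - f 0) (f 0)
  rw [sub_add_cancel] at this
  linarith

theorem abs_statGrad_le {f : ℝ → ℝ} {C : ℝ} (hC : ∀ x, |deriv f x| ≤ C)
    (q : UpperPair n) (y : UpperPair n → ℝ) : |statGrad n f q y| ≤ n * (C * (2 * n)) := by
  have hC0 : 0 ≤ C := (abs_nonneg _).trans (hC 0)
  refine (Finset.abs_sum_le_sum_abs _ _).trans ((Finset.sum_le_card_nsmul _ _ (C * (2 * n))
    fun i _ => ?_).trans_eq (by simp))
  rw [abs_mul]
  exact mul_le_mul (hC _) (abs_eigFunPartial_le i q y) (abs_nonneg _) hC0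

theorem abs_statLap_le {f : ℝ → ℝ} (hf : MemCb 2 f) {C : ℝ}
    (hC : ∀ x, |deriv (deriv f) x| ≤ C) (y : UpperPair n → ℝ) :
    |statLap n f y| ≤ n * C + n * (n * C) := by
  refine (abs_add_le _ _).trans (add_le_add ?_ ?_)
  · exact (Finset.abs_sum_le_sum_abs _ _).trans ((Finset.sum_le_card_nsmul _ _ C
      fun i _ => hC _).trans_eq (by simp))
  · refine (Finset.abs_sum_le_sum_abs _ _).trans ((Finset.sum_le_card_nsmul _ _ (n * C)
      fun i _ => ?_).trans_eq (by simp))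
    exact (Finset.abs_sum_le_sum_abs _ _).trans ((Finset.sum_le_card_nsmul _ _ C
      fun j _ => abs_derivQuotient_le hf hC _ _).trans_eq (by simp))

theorem exists_polynomial_statistics_near {f : ℝ → ℝ} (hf : MemCb 2 f)
    {G : Set (UpperPair n → ℝ)} (hG : IsRegularSet n G) {r ε : ℝ} (hr : 0 ≤ r) (hε : 0 < ε) :
    ∃ p : Polynomial ℝ, ∀ y : UpperPair n → ℝ, ‖y‖ ≤ r →
      |tracePoly n p y - ∑ i, f (eigFun n i y)| ≤ ε ∧
      (y ∈ G → ∀ q, |fderiv ℝ (tracePoly n p) y (Pi.single q 1) - statGrad n f q y| ≤ ε) ∧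
      |∑ q, fderiv ℝ (fun z => fderiv ℝ (tracePoly n p) z (Pi.single q 1)) y (Pi.single q 1)
        - statLap n f y| ≤ ε := by
  let K : ℝ := ∑ j, |eigFun n j 0| + 2 * n * r
  have hK : 0 ≤ K := add_nonneg (Finset.sum_nonneg fun _ _ => abs_nonneg _) (by positivity)
  let D : ℝ := (n + 1) * (2 * n + 1)
  have hD : 0 < D := by positivity
  have hδ : 0 < ε / D := by positivity
  set δ := ε / D with hδdef
  have hδD : δ * D = ε := by rw [hδdef]; field_simp
  have hn0 : (0 : ℝ) ≤ n := Nat.cast_nonneg n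
  have hb1 : n * δ ≤ ε := by
    rw [← hδD]
    simp only [D]
    nlinarith [mul_nonneg hn0 hδ.le, mul_nonneg hn0 (mul_nonneg hn0 hδ.le)]
  have hb2 : n * (δ * (2 * n)) ≤ ε := by
    rw [← hδD]
    simp only [D]
    nlinarith [mul_nonneg hn0 hδ.le, mul_nonneg hn0 (mul_nonneg hn0 hδ.le)]
  have hb3 : n * δ + n * (n * δ) ≤ ε := by
    rw [← hδD]
    simp only [D]
    nlinarith [mul_nonneg hn0 hδ.le, mul_nonneg hn0 (mul_nonneg hn0 hδ.le)]
  obtain ⟨p, hp⟩ := Polynomial.exists_near_of_memCb hf hK hδ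
  refine ⟨p, fun y hy => ?_⟩
  have hyK : ∀ i, |eigFun n i y| ≤ K := fun i => (abs_eigFun_le y i).trans (by
    simp only [K]; gcongr)
  refine ⟨?_, fun hyG q => ?_, ?_⟩
  · rw [tracePoly_eq_sum, ← Finset.sum_sub_distrib]
    exact (Finset.abs_sum_le_sum_abs _ _).trans ((Finset.sum_le_card_nsmul _ _ δ
      fun i _ => (hp _ (hyK i)).1).trans (by simpa using hb1))
  · rw [fderiv_tracePoly_of_mem hG hyG, statGrad, ← Finset.sum_sub_distrib]
    refine (Finset.abs_sum_le_sum_abs _ _).trans ((Finset.sum_le_card_nsmul _ _ (δ * (2 * n))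
      fun i _ => ?_).trans (by simpa using hb2))
    rw [← sub_mul, abs_mul]
    exact mul_le_mul (hp _ (hyK i)).2.1 (abs_eigFunPartial_le i q y) (abs_nonneg _) hδ.le
  · rw [laplacian_tracePoly, statLap, add_sub_add_comm, ← Finset.sum_sub_distrib,
      ← Finset.sum_sub_distrib]
    refine (abs_add_le _ _).trans ((add_le_add ?_ ?_).trans hb3)
    · exact (Finset.abs_sum_le_sum_abs _ _).trans ((Finset.sum_le_card_nsmul _ _ δ
        fun i _ => (hp _ (hyK i)).2.2).trans_eq (by simp))
    · refine (Finset.abs_sum_le_sum_abs _ _).trans ((Finset.sum_le_card_nsmul _ _ (n * δ)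
        fun i _ => ?_).trans_eq (by simp))
      rw [← Finset.sum_sub_distrib]
      exact (Finset.abs_sum_le_sum_abs _ _).trans ((Finset.sum_le_card_nsmul _ _ δ
        fun j _ => abs_derivQuotient_sub_le hf p (fun x hx => (hp x hx).2.2)
          (hyK i) (hyK j)).trans_eq (by simp))

/-- `f` being merely `C^2`, the statistic `y ↦ ∑_i f(Φ_i(y))` is a limit, with uniform control of
gradient and Laplacian, of smooth compactly supported functions. -/
theorem exists_smooth_approximation {f : ℝ → ℝ} (hf : MemCb 2 f)
    {G : Set (UpperPair n → ℝ)} (hG : IsRegularSet n G) :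
    ∃ (g : ℕ → (UpperPair n → ℝ) → ℝ) (C : ℝ), 0 ≤ C ∧
      (∀ N, ContDiff ℝ (⊤ : ℕ∞) (g N)) ∧ (∀ N, HasCompactSupport (g N)) ∧
      (∀ N y, |g N y| ≤ C * (1 + ‖y‖)) ∧
      (∀ y, Tendsto (fun N => g N y) atTop (nhds (∑ i, f (eigFun n i y)))) ∧
      (∀ N, ∀ y ∈ G, ∀ q, |fderiv ℝ (g N) y (Pi.single q 1)| ≤ C) ∧
      (∀ y ∈ G, ∀ q, Tendsto (fun N => fderiv ℝ (g N) y (Pi.single q 1)) atTop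
        (nhds (statGrad n f q y))) ∧
      (∀ N, ∀ y ∈ G, |∑ q, fderiv ℝ (fun z => fderiv ℝ (g N) z (Pi.single q 1)) y
        (Pi.single q 1)| ≤ C) ∧
      (∀ y, Tendsto (fun N => ∑ q, fderiv ℝ (fun z => fderiv ℝ (g N) z (Pi.single q 1)) y
        (Pi.single q 1)) atTop (nhds (statLap n f y))) := by
  obtain ⟨C₀, hC₀, hf1, hf2⟩ := hf.exists_bound
  obtain ⟨χ, B, hB, hχ⟩ := exists_cutoff (UpperPair n)
  choose p hp using fun N : ℕ => exists_polynomial_statistics_near hf hG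
    (r := 2 * (N + 1 : ℝ)) (ε := 1 / (N + 1 : ℝ)) (by positivity) (by positivity)
  have hε1 : ∀ N : ℕ, 1 / (N + 1 : ℝ) ≤ 1 := fun N => by
    rw [div_le_one (by positivity)]; linarith [Nat.cast_nonneg (α := ℝ) N]
  have hεlim : Tendsto (fun N : ℕ => 1 / (N + 1 : ℝ)) atTop (nhds 0) :=
    tendsto_one_div_add_atTop_nhds_zero_nat
  have hn0 : (0 : ℝ) ≤ n := Nat.cast_nonneg n
  -- linear growth of the statistic
  let C₁ : ℝ := n * (|f 0| + C₀ * (∑ j, |eigFun n j 0| + 2 * n)) + 1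
  have hC₁ : 0 ≤ C₁ := by
    have : 0 ≤ ∑ j, |eigFun n j 0| := Finset.sum_nonneg fun _ _ => abs_nonneg _
    positivity
  have hstat : ∀ y : UpperPair n → ℝ, |∑ i, f (eigFun n i y)| + 1 ≤ C₁ * (1 + ‖y‖) := by
    intro y
    have hS : 0 ≤ ∑ j, |eigFun n j 0| := Finset.sum_nonneg fun _ _ => abs_nonneg _
    have h1 : |∑ i, f (eigFun n i y)| ≤
        n * (|f 0| + C₀ * (∑ j, |eigFun n j 0| + 2 * n * ‖y‖)) := by
      refine (Finset.abs_sum_le_sum_abs _ _).trans ((Finset.sum_le_card_nsmul _ _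
        (|f 0| + C₀ * (∑ j, |eigFun n j 0| + 2 * n * ‖y‖)) fun i _ => ?_).trans_eq
          (by simp [mul_add]))
      refine (hf.abs_le hf1 _).trans ?_
      gcongr
      exact abs_eigFun_le y i
    have h2 : n * (|f 0| + C₀ * (∑ j, |eigFun n j 0| + 2 * n * ‖y‖)) ≤
        n * (|f 0| + C₀ * (∑ j, |eigFun n j 0| + 2 * n)) * (1 + ‖y‖) := by
      rw [mul_assoc (n : ℝ)]
      refine mul_le_mul_of_nonneg_left ?_ hn0
      have e1 := mul_nonneg (abs_nonneg (f 0)) (norm_nonneg y)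
      have e2 := mul_nonneg (mul_nonneg hC₀ hS) (norm_nonneg y)
      have e3 := mul_nonneg hC₀ hn0
      nlinarith
    have h3 := norm_nonneg y
    simp only [C₁]
    linarith
  have hgle : ∀ (N : ℕ) (y : UpperPair n → ℝ), ‖y‖ ≤ 2 * (N + 1 : ℝ) →
      |tracePoly n (p N) y| ≤ C₁ * (1 + ‖y‖) := fun N y hy => by
    have h1 := ((hp N y hy).1).trans (hε1 N)
    have h2 := abs_add_le (tracePoly n (p N) y - ∑ i, f (eigFun n i y)) (∑ i, f (eigFun n i y))
    rw [sub_add_cancel] at h2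
    linarith [hstat y]
  have hgle' : ∀ (N : ℕ) (y : UpperPair n → ℝ), ‖y‖ ≤ 2 * (N + 1 : ℝ) →
      |tracePoly n (p N) y| ≤ C₁ * 3 * (N + 1) := fun N y hy => by
    refine (hgle N y hy).trans ?_
    rw [mul_assoc]
    refine mul_le_mul_of_nonneg_left ?_ hC₁
    linarith [Nat.cast_nonneg (α := ℝ) N]
  let C₂ : ℝ := n * (C₀ * (2 * n)) + 1
  have hC₂ : 0 ≤ C₂ := by positivity
  have hgrad : ∀ (N : ℕ) (y : UpperPair n → ℝ), ‖y‖ ≤ 2 * (N + 1 : ℝ) → y ∈ G → ∀ q,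
      |fderiv ℝ (tracePoly n (p N)) y (Pi.single q 1)| ≤ C₂ := fun N y hy hyG q => by
    have h1 := ((hp N y hy).2.1 hyG q).trans (hε1 N)
    have h2 := abs_add_le (fderiv ℝ (tracePoly n (p N)) y (Pi.single q 1) - statGrad n f q y)
      (statGrad n f q y)
    rw [sub_add_cancel] at h2
    have h3 := abs_statGrad_le hf1 q y
    simp only [C₂]
    linarith
  let C₃ : ℝ := n * C₀ + n * (n * C₀) + 1
  have hC₃ : 0 ≤ C₃ := by positivity
  have hlap : ∀ (N : ℕ) (y : UpperPair n → ℝ), ‖y‖ ≤ 2 * (N + 1 : ℝ) →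
      |∑ q, fderiv ℝ (fun z => fderiv ℝ (tracePoly n (p N)) z (Pi.single q 1)) y (Pi.single q 1)|
        ≤ C₃ := fun N y hy => by
    have h1 := ((hp N y hy).2.2).trans (hε1 N)
    have h2 := abs_add_le (∑ q, fderiv ℝ (fun z => fderiv ℝ (tracePoly n (p N)) z
      (Pi.single q 1)) y (Pi.single q 1) - statLap n f y) (statLap n f y)
    rw [sub_add_cancel] at h2
    have h3 := abs_statLap_le hf hf2 y
    simp only [C₃]
    linarith
  have hsm : ∀ N, ContDiff ℝ (⊤ : ℕ∞) fun y => χ N y * tracePoly n (p N) y := fun N =>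
    (hχ N).1.mul (contDiff_tracePoly (p N))
  have hdiff : ∀ {h : (UpperPair n → ℝ) → ℝ}, ContDiff ℝ (⊤ : ℕ∞) h → ∀ y,
      DifferentiableAt ℝ h y := fun hh y => hh.differentiable (by simp) y
  have hd1 : ∀ N y q, fderiv ℝ (fun y => χ N y * tracePoly n (p N) y) y (Pi.single q 1) =
      χ N y * fderiv ℝ (tracePoly n (p N)) y (Pi.single q 1) +
        tracePoly n (p N) y * fderiv ℝ (χ N) y (Pi.single q 1) := fun N y q => by
    rw [fderiv_fun_mul (hdiff (hχ N).1 y) (hdiff (contDiff_tracePoly (p N)) y)]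
    simp
  have hd2 : ∀ N y q, fderiv ℝ (fun z => fderiv ℝ (fun y => χ N y * tracePoly n (p N) y) z
      (Pi.single q 1)) y (Pi.single q 1) =
      χ N y * fderiv ℝ (fun z => fderiv ℝ (tracePoly n (p N)) z (Pi.single q 1)) y
        (Pi.single q 1) +
      2 * (fderiv ℝ (χ N) y (Pi.single q 1) *
        fderiv ℝ (tracePoly n (p N)) y (Pi.single q 1)) +
      tracePoly n (p N) y * fderiv ℝ (fun z => fderiv ℝ (χ N) z (Pi.single q 1)) y
        (Pi.single q 1) := fun N y q => by
    have a1 := hdiff (hχ N).1 y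
    have a2 := hdiff (contDiff_tracePoly (p N)) y
    have a3 := hdiff (contDiff_fderiv_apply (hχ N).1 (Pi.single q 1)) y
    have a4 := hdiff (contDiff_fderiv_apply (contDiff_tracePoly (p N)) (Pi.single q 1)) y
    simp only [hd1]
    rw [fderiv_fun_add (a1.fun_mul a4) (a2.fun_mul a3), fderiv_fun_mul a1 a4,
      fderiv_fun_mul a2 a3]
    simp only [add_apply, smul_apply, smul_eq_mul]
    ring
  have hfar : ∀ (N : ℕ) (y : UpperPair n → ℝ), 2 * (N + 1 : ℝ) < ‖y‖ →
      (fun y => χ N y * tracePoly n (p N) y) =ᶠ[nhds y] fun _ => 0 := fun N y hy => by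
    filter_upwards [(hχ N).2.2.2.1 y hy] with z hz
    rw [hz, zero_mul]
  have hnear : ∀ (N : ℕ) (y : UpperPair n → ℝ), ‖y‖ < N + 1 →
      (fun y => χ N y * tracePoly n (p N) y) =ᶠ[nhds y] tracePoly n (p N) := fun N y hy => by
    filter_upwards [(hχ N).2.2.2.2.1 y hy] with z hz
    rw [hz, one_mul]
  have hev : ∀ y : UpperPair n → ℝ, ∀ᶠ N : ℕ in atTop, ‖y‖ < N + 1 := fun y => by
    filter_upwards [(tendsto_natCast_atTop_atTop (R := ℝ)).eventually_gt_atTop ‖y‖] with N hN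
    linarith
  have hin : ∀ {N : ℕ} {y : UpperPair n → ℝ}, ‖y‖ < N + 1 → ‖y‖ ≤ 2 * (N + 1 : ℝ) :=
    fun {N y} h => by linarith [Nat.cast_nonneg (α := ℝ) N]
  have h2nd : ∀ (h : (UpperPair n → ℝ) → ℝ) (g : (UpperPair n → ℝ) → ℝ) (y : UpperPair n → ℝ) q,
      h =ᶠ[nhds y] g → fderiv ℝ (fun z => fderiv ℝ h z (Pi.single q 1)) y (Pi.single q 1) =
        fderiv ℝ (fun z => fderiv ℝ g z (Pi.single q 1)) y (Pi.single q 1) := by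
    intro h g y q hhg
    have : (fun z => fderiv ℝ h z (Pi.single q 1)) =ᶠ[nhds y]
        fun z => fderiv ℝ g z (Pi.single q 1) := by
      filter_upwards [hhg.fderiv (𝕜 := ℝ)] with z hz
      rw [hz]
    rw [this.fderiv_eq]
  -- the loss of a factor `N` in the bound on the statistic is compensated by the cutoff
  have hcut : ∀ (N : ℕ) (a b : ℝ), |a| ≤ C₁ * 3 * (N + 1) → |b| * (N + 1) ≤ B →
      |a * b| ≤ C₁ * 3 * B := fun N a b ha hb => by
    rw [abs_mul]
    calc |a| * |b| ≤ C₁ * 3 * (N + 1) * |b| := by gcongr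
      _ = C₁ * 3 * (|b| * (N + 1)) := by ring
      _ ≤ C₁ * 3 * B := by gcongr
  have hle1 : ∀ (N : ℕ) (b : ℝ), |b| * (N + 1) ≤ B → |b| ≤ B := fun N b hb => by
    refine le_trans ?_ hb
    exact le_mul_of_one_le_right (abs_nonneg b) (by linarith [Nat.cast_nonneg (α := ℝ) N])
  let D : ℝ := Fintype.card (UpperPair n)
  have hD : 0 ≤ D := Nat.cast_nonneg _
  have hE1 : 0 ≤ C₁ * 3 * B := by positivity
  have hE2 : 0 ≤ D * (2 * (B * C₂) + C₁ * 3 * B) := by positivity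
  let C : ℝ := C₁ + (C₂ + C₁ * 3 * B) + (C₃ + D * (2 * (B * C₂) + C₁ * 3 * B))
  have hCle1 : C₁ ≤ C := by simp only [C]; linarith
  have hCle2 : C₂ + C₁ * 3 * B ≤ C := by simp only [C]; linarith
  have hCle3 : C₃ + D * (2 * (B * C₂) + C₁ * 3 * B) ≤ C := by simp only [C]; linarith
  have hC : 0 ≤ C := hC₁.trans hCle1
  refine ⟨fun N y => χ N y * tracePoly n (p N) y, C, hC, hsm, fun N => (hχ N).2.1.mul_right,
    fun N y => ?_, fun y => ?_, fun N y hyG q => ?_, fun y hyG q => ?_, fun N y hyG => ?_,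
    fun y => ?_⟩
  · dsimp only
    rcases le_or_gt ‖y‖ (2 * (N + 1 : ℝ)) with hy | hy
    · rw [abs_mul]
      calc |χ N y| * |tracePoly n (p N) y| ≤ 1 * (C₁ * (1 + ‖y‖)) :=
            mul_le_mul ((hχ N).2.2.1 y) (hgle N y hy) (abs_nonneg _) zero_le_one
        _ ≤ C * (1 + ‖y‖) := by rw [one_mul]; gcongr
    · rw [show χ N y * tracePoly n (p N) y = 0 from (hfar N y hy).self_of_nhds, abs_zero]
      positivity
  · rw [tendsto_iff_dist_tendsto_zero]
    refine squeeze_zero' (Eventually.of_forall fun _ => dist_nonneg) ?_ hεlim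
    filter_upwards [hev y] with N hN
    rw [show χ N y * tracePoly n (p N) y = _ from (hnear N y hN).self_of_nhds, Real.dist_eq]
    exact (hp N y (hin hN)).1
  · rcases le_or_gt ‖y‖ (2 * (N + 1 : ℝ)) with hy | hy
    · rw [hd1]
      refine (abs_add_le _ _).trans ((add_le_add ?_ ?_).trans hCle2)
      · rw [abs_mul]
        exact (mul_le_mul ((hχ N).2.2.1 y) (hgrad N y hy hyG q) (abs_nonneg _) zero_le_one).trans
          (one_mul _).le
      · exact hcut N _ _ (hgle' N y hy) ((hχ N).2.2.2.2.2.1 y q)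
    · rw [(hfar N y hy).fderiv_eq]
      simpa using hC
  · rw [tendsto_iff_dist_tendsto_zero]
    refine squeeze_zero' (Eventually.of_forall fun _ => dist_nonneg) ?_ hεlim
    filter_upwards [hev y] with N hN
    rw [(hnear N y hN).fderiv_eq, Real.dist_eq]
    exact (hp N y (hin hN)).2.1 hyG q
  · rcases le_or_gt ‖y‖ (2 * (N + 1 : ℝ)) with hy | hy
    · simp only [hd2, add_assoc]
      rw [Finset.sum_add_distrib, ← Finset.mul_sum]
      refine (abs_add_le _ _).trans ((add_le_add ?_ ?_).trans hCle3)
      · rw [abs_mul]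
        exact (mul_le_mul ((hχ N).2.2.1 y) (hlap N y hy) (abs_nonneg _) zero_le_one).trans
          (one_mul _).le
      · refine (Finset.abs_sum_le_sum_abs _ _).trans ((Finset.sum_le_card_nsmul _ _
          (2 * (B * C₂) + C₁ * 3 * B) fun q _ => ?_).trans_eq (by simp [D, mul_add]))
        refine (abs_add_le _ _).trans (add_le_add ?_ ?_)
        · rw [abs_mul, abs_two, abs_mul]
          gcongr
          · exact hle1 N _ ((hχ N).2.2.2.2.2.1 y q)
          · exact hgrad N y hy hyG q
        · exact hcut N _ _ (hgle' N y hy) ((hχ N).2.2.2.2.2.2 y q)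
    · rw [Finset.sum_eq_zero fun q _ => ?_]
      · simpa using hC
      · rw [h2nd _ _ y q (hfar N y hy)]
        simp
  · rw [tendsto_iff_dist_tendsto_zero]
    refine squeeze_zero' (Eventually.of_forall fun _ => dist_nonneg) ?_ hεlim
    filter_upwards [hev y] with N hN
    rw [Finset.sum_congr rfl fun q _ => h2nd _ _ y q (hnear N y hN), Real.dist_eq]
    exact (hp N y (hin hN)).2.2

end SpectralApproximation

/-! ### Absolute continuity and the variance function -/

section AbsoluteContinuity

theorem AbsolutelyContinuousOnInterval.of_dist_le {f g : ℝ → ℝ} {a b K : ℝ}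
    (hf : AbsolutelyContinuousOnInterval f a b)
    (hfg : ∀ x ∈ uIcc a b, ∀ y ∈ uIcc a b, dist (g x) (g y) ≤ K * dist (f x) (f y)) :
    AbsolutelyContinuousOnInterval g a b := by
  unfold AbsolutelyContinuousOnInterval at hf ⊢
  refine squeeze_zero' (Eventually.of_forall fun _ => Finset.sum_nonneg fun _ _ => dist_nonneg) ?_
    (by simpa using hf.const_mul K)
  rw [eventually_inf_principal]
  filter_upwards with E hE
  rw [Finset.mul_sum]
  exact Finset.sum_le_sum fun i hi => hfg _ (hE.1 i hi).1 _ (hE.1 i hi).2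

theorem AbsolutelyContinuousOnInterval.exp {f : ℝ → ℝ} {a b : ℝ}
    (hf : AbsolutelyContinuousOnInterval f a b) :
    AbsolutelyContinuousOnInterval (fun s => Real.exp (f s)) a b := by
  obtain ⟨C, hC⟩ := hf.exists_bound
  refine hf.of_dist_le (K := Real.exp C) fun x hx y hy => ?_
  refine Convex.norm_image_sub_le_of_norm_hasDerivWithin_le (f' := Real.exp) (s := Icc (-C) C)
    (fun z _ => (Real.hasDerivAt_exp z).hasDerivWithinAt) (fun z hz => ?_) (convex_Icc _ _)
    (abs_le.1 (hC y hy)) (abs_le.1 (hC x hx))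
  rw [Real.norm_of_nonneg (Real.exp_pos z).le]
  exact Real.exp_le_exp.2 hz.2

theorem AbsolutelyContinuousOnInterval.sum {ι : Type*} (s : Finset ι) {f : ι → ℝ → ℝ} {a b : ℝ}
    (hf : ∀ i ∈ s, AbsolutelyContinuousOnInterval (f i) a b) :
    AbsolutelyContinuousOnInterval (fun x => ∑ i ∈ s, f i x) a b := by
  classical
  induction s using Finset.induction_on with
  | empty =>
    simp only [Finset.sum_empty]
    exact contDiffOn_const.absolutelyContinuousOnInterval
  | insert i s hi ih =>
    simp only [Finset.sum_insert hi]
    exact (hf i (Finset.mem_insert_self i s)).fun_add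
      (ih fun j hj => hf j (Finset.mem_insert_of_mem hj))

theorem integral_deriv_mul_exp {f f' : ℝ → ℝ} {a b : ℝ}
    (hf : AbsolutelyContinuousOnInterval f a b)
    (hf' : ∀ᵐ s, s ∈ uIcc a b → HasDerivAt f (f' s) s) :
    ∫ s in a..b, f' s * Real.exp (f s) = Real.exp (f b) - Real.exp (f a) := by
  rw [← hf.exp.integral_deriv_eq_sub]
  refine intervalIntegral.integral_congr_ae ?_
  filter_upwards [hf'] with s hs hsm
  rw [((hs (uIoc_subset_uIcc hsm)).exp).deriv, mul_comm]

end AbsoluteContinuity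

section Variance

variable {R : ℝ → ℝ → ℝ}

theorem CovarianceH1.continuousOn_diag (hR : CovarianceH1 R) :
    ContinuousOn (fun s => R s s) (Ici 0) := by
  intro s hs
  rcases (mem_Ici.1 hs).eq_or_lt with rfl | h
  · exact hR.continuous_zero
  · exact ((hR.contDiffOn_diag.continuousOn).continuousAt (Ioi_mem_nhds h)).continuousWithinAt

theorem CovarianceH1.hasDerivAt_diag (hR : CovarianceH1 R) {s : ℝ} (hs : 0 < s) :
    HasDerivAt (fun s => R s s) (deriv (fun s => R s s) s) s :=
  ((hR.contDiffOn_diag.contDiffAt (Ioi_mem_nhds hs)).differentiableAt (by simp)).hasDerivAt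

theorem CovarianceH1.continuousOn_deriv_diag (hR : CovarianceH1 R) :
    ContinuousOn (deriv fun s => R s s) (Ioi 0) :=
  hR.contDiffOn_diag.continuousOn_deriv_of_isOpen isOpen_Ioi le_rfl

/-- As `d/ds R(s,s)` has no zeros near `0`, the variance is monotone there; hence its derivative
is integrable up to `0`. -/
theorem CovarianceH1.intervalIntegrable_deriv_diag (hR : CovarianceH1 R) {T : ℝ} (hT : 0 < T) :
    IntervalIntegrable (deriv fun s => R s s) volume 0 T := by
  have hfin := hR.finite_zeros T hT
  have hnhds : {s ∈ Ioc (0 : ℝ) T | deriv (fun r => R r r) s = 0}ᶜ ∈ nhds (0 : ℝ) :=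
    hfin.isClosed.isOpen_compl.mem_nhds (by simp)
  obtain ⟨ε₀, hε₀, hball⟩ := Metric.mem_nhds_iff.1 hnhds
  let ε := min ε₀ T
  have hε : 0 < ε := lt_min hε₀ hT
  have hεT : ε ≤ T := min_le_right _ _
  have hne : ∀ s ∈ Ioo 0 ε, deriv (fun r => R r r) s ≠ 0 := by
    intro s hs h0
    refine hball (show s ∈ Metric.ball 0 ε₀ from ?_) ⟨⟨hs.1, hs.2.le.trans hεT⟩, h0⟩
    rw [Metric.mem_ball, Real.dist_eq, sub_zero, abs_of_pos hs.1]
    exact hs.2.trans_le (min_le_left _ _)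
  have hcont : ContinuousOn (deriv fun s => R s s) (Ioo 0 ε) :=
    hR.continuousOn_deriv_diag.mono fun s hs => hs.1
  have hsign : (∀ s ∈ Ioo 0 ε, 0 ≤ deriv (fun r => R r r) s) ∨
      ∀ s ∈ Ioo 0 ε, deriv (fun r => R r r) s ≤ 0 := by
    by_contra! h
    obtain ⟨⟨a, ha, ha'⟩, b, hb, hb'⟩ := h
    obtain ⟨c, hc, hc'⟩ := isPreconnected_Ioo.intermediate_value ha hb hcont ⟨ha'.le, hb'.le⟩
    exact hne c hc hc'
  have hcontIcc : ContinuousOn (fun s => R s s) (Icc 0 ε) :=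
    hR.continuousOn_diag.mono fun s hs => hs.1
  have hdiff : DifferentiableOn ℝ (fun s => R s s) (interior (Icc 0 ε)) := by
    rw [interior_Icc]
    exact fun s hs => (hR.hasDerivAt_diag hs.1).differentiableAt.differentiableWithinAt
  have h1 : IntervalIntegrable (deriv fun s => R s s) volume 0 ε := by
    rcases hsign with h | h
    · refine MonotoneOn.intervalIntegrable_deriv ?_
      rw [uIcc_of_le hε.le]
      exact monotoneOn_of_deriv_nonneg (convex_Icc _ _) hcontIcc hdiff (by rwa [interior_Icc])
    · have : IntervalIntegrable (deriv fun s => -R s s) volume 0 ε := by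
        refine MonotoneOn.intervalIntegrable_deriv ?_
        rw [uIcc_of_le hε.le]
        exact (antitoneOn_of_deriv_nonpos (convex_Icc _ _) hcontIcc hdiff
          (by rwa [interior_Icc])).neg
      have h' := this.neg
      simpa [Pi.neg_def] using h'
  have h2 : IntervalIntegrable (deriv fun s => R s s) volume ε T := by
    refine ContinuousOn.intervalIntegrable ?_
    rw [uIcc_of_le hεT]
    exact hR.continuousOn_deriv_diag.mono fun s hs => hε.trans_le hs.1
  exact h1.trans h2

theorem CovarianceH1.absolutelyContinuous_diag (hR : CovarianceH1 R) {T : ℝ} (hT : 0 < T) :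
    AbsolutelyContinuousOnInterval (fun s => R s s) 0 T := by
  have hint := hR.intervalIntegrable_deriv_diag hT
  have heq : ∀ s ∈ uIcc 0 T, ∫ v in (0 : ℝ)..s, deriv (fun r => R r r) v = R s s - R 0 0 := by
    intro s hs
    rw [uIcc_of_le hT.le] at hs
    refine intervalIntegral.integral_eq_sub_of_hasDerivAt_of_le hs.1
      (hR.continuousOn_diag.mono fun r hr => hr.1) (fun r hr => hR.hasDerivAt_diag hr.1) ?_
    refine hint.mono_set ?_
    rw [uIcc_of_le hs.1, uIcc_of_le hT.le]
    exact Icc_subset_Icc_right hs.2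
  refine (hint.absolutelyContinuousOnInterval_intervalIntegral (c := 0) (by simp)).of_dist_le
    (K := 1) fun x hx y hy => ?_
  rw [heq x hx, heq y hy, one_mul, dist_sub_right]

theorem CovarianceH1.ae_pos_diag (hR : CovarianceH1 R) (h0 : ∀ s, 0 ≤ s → 0 ≤ R s s) {T : ℝ}
    (hT : 0 < T) : ∀ᵐ s, s ∈ Icc 0 T → 0 < R s s := by
  have hfin : ({0} ∪ {s ∈ Ioc (0 : ℝ) T | deriv (fun r => R r r) s = 0}).Finite :=
    (finite_singleton _).union (hR.finite_zeros T hT)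
  filter_upwards [measure_eq_zero_iff_ae_notMem.1 (hfin.measure_zero volume)] with s hs hsT
  refine lt_of_le_of_ne (h0 s hsT.1) fun hzero => hs ?_
  rcases hsT.1.eq_or_lt with rfl | hpos
  · exact Or.inl rfl
  refine Or.inr ⟨⟨hpos, hsT.2⟩, IsLocalMin.deriv_eq_zero ?_⟩
  filter_upwards [Ioi_mem_nhds hpos] with r hr
  rw [← hzero]
  exact h0 r (le_of_lt hr)

end Variance

/-! ### A Fourier-analytic evolution formula -/

section Fourier

variable {Ω : Type*} [MeasurableSpace Ω] {P : Measure Ω} [IsProbabilityMeasure P]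
variable {E₁ E₂ : Type*} [NormedAddCommGroup E₁] [InnerProductSpace ℝ E₁]
  [NormedAddCommGroup E₂] [InnerProductSpace ℝ E₂]

/-- The joint characteristic function of `(U, V)`, in the normalization of the Fourier transform. -/
def jointCharFun (P : Measure Ω) (U : Ω → E₁) (V : Ω → E₂) (z : E₁ × E₂) : ℂ :=
  ∫ ω, Complex.exp (↑(2 * Real.pi * (inner ℝ z.1 (U ω) + inner ℝ z.2 (V ω))) * Complex.I) ∂P

theorem norm_jointCharFun_le (U : Ω → E₁) (V : Ω → E₂) (z : E₁ × E₂) :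
    ‖jointCharFun P U V z‖ ≤ 1 := by
  refine (norm_integral_le_integral_norm _).trans ?_
  simp only [Complex.norm_exp_ofReal_mul_I]
  simp

variable [FiniteDimensional ℝ E₁] [MeasurableSpace E₁] [BorelSpace E₁]
  [FiniteDimensional ℝ E₂] [MeasurableSpace E₂] [BorelSpace E₂]

theorem SchwartzMap.apply_eq_integral (φ : SchwartzMap E₁ ℂ) (x : E₁) :
    φ x = ∫ η, Complex.exp (↑(2 * Real.pi * inner ℝ η x) * Complex.I) *
      (FourierTransform.fourier φ : SchwartzMap E₁ ℂ) η := by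
  have h : FourierTransformInv.fourierInv (FourierTransform.fourier φ) = φ :=
    FourierTransform.fourierInv_fourier_eq φ
  conv_lhs => rw [← h]
  rw [SchwartzMap.fourierInv_coe, Real.fourierInv_eq']
  simp only [smul_eq_mul]

theorem integral_schwartz_mul_schwartz {U : Ω → E₁} {V : Ω → E₂} (hU : Measurable U)
    (hV : Measurable V) (φ : SchwartzMap E₁ ℂ) (γ : SchwartzMap E₂ ℂ) :
    ∫ ω, φ (U ω) * γ (V ω) ∂P =
      ∫ z : E₁ × E₂, ((FourierTransform.fourier φ : SchwartzMap E₁ ℂ) z.1 *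
        (FourierTransform.fourier γ : SchwartzMap E₂ ℂ) z.2) * jointCharFun P U V z := by
  set φ' : SchwartzMap E₁ ℂ := FourierTransform.fourier φ with hφ'
  set γ' : SchwartzMap E₂ ℂ := FourierTransform.fourier γ with hγ'
  have hA : Integrable (fun z : E₁ × E₂ => φ' z.1 * γ' z.2) :=
    φ'.integrable.mul_prod γ'.integrable
  have h1 : ∀ ω, φ (U ω) * γ (V ω) = ∫ z : E₁ × E₂, (φ' z.1 * γ' z.2) *
      Complex.exp (↑(2 * Real.pi * (inner ℝ z.1 (U ω) + inner ℝ z.2 (V ω))) * Complex.I) := by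
    intro ω
    rw [φ.apply_eq_integral, γ.apply_eq_integral, ← integral_prod_mul]
    refine integral_congr_ae (Eventually.of_forall fun z => ?_)
    dsimp only
    rw [mul_add (2 * Real.pi), Complex.ofReal_add, add_mul, Complex.exp_add]
    ring
  simp only [h1]
  rw [integral_integral_swap]
  · simp only [jointCharFun, ← integral_const_mul]
  · refine Integrable.mul_bdd (c := 1) ?_ ?_ (Eventually.of_forall fun z => ?_)
    · exact hA.comp_snd P
    · refine Measurable.aestronglyMeasurable ?_
      have h1 : Measurable fun v : Ω × (E₁ × E₂) => U v.1 := hU.comp measurable_fst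
      have h2 : Measurable fun v : Ω × (E₁ × E₂) => V v.1 := hV.comp measurable_fst
      fun_prop
    · exact (Complex.norm_exp_ofReal_mul_I _).le

theorem measurable_jointCharFun {U : Ω → E₁} {V : ℝ → Ω → E₂} (hU : Measurable U)
    (hV : Measurable fun w : Ω × ℝ => V w.2 w.1) :
    Measurable fun w : ℝ × (E₁ × E₂) => jointCharFun P U (V w.1) w.2 := by
  refine StronglyMeasurable.measurable ?_
  refine StronglyMeasurable.integral_prod_right' (ν := P)
    (f := fun v : (ℝ × (E₁ × E₂)) × Ω => Complex.exp (↑(2 * Real.pi *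
      (inner ℝ v.1.2.1 (U v.2) + inner ℝ v.1.2.2 (V v.1.1 v.2))) * Complex.I)) ?_
  refine Measurable.stronglyMeasurable ?_
  have h1 : Measurable fun v : (ℝ × (E₁ × E₂)) × Ω => U v.2 := hU.comp measurable_snd
  have h2 : Measurable fun v : (ℝ × (E₁ × E₂)) × Ω => V v.1.1 v.2 :=
    hV.comp (measurable_snd.prodMk (measurable_fst.comp measurable_fst))
  have h3 : Measurable fun v : (ℝ × (E₁ × E₂)) × Ω => v.1.2.1 := by fun_prop
  have h4 : Measurable fun v : (ℝ × (E₁ × E₂)) × Ω => v.1.2.2 := by fun_prop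
  exact Complex.measurable_exp.comp ((Complex.measurable_ofReal.comp
    (((h3.inner h1).add (h4.inner h2)).const_mul _)).mul_const _)

/-- If the joint characteristic function of `(U, V_s)` solves a linear evolution equation in
integrated form, then the expectations `E[φ(U) γ(V_s)]` solve the equation in which the symbols of
its coefficients are replaced by the operators they represent. -/
theorem integral_schwartz_evolution {K : Type*} [Fintype K] {U : Ω → E₁} {V : ℝ → Ω → E₂}
    (hU : Measurable U) (hV : Measurable fun w : Ω × ℝ => V w.2 w.1) {t : ℝ}
    (φ : SchwartzMap E₁ ℂ) (γ : SchwartzMap E₂ ℂ) (c : K → ℝ → ℝ) (m : K → E₁ × E₂ → ℂ)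
    (φ' : K → SchwartzMap E₁ ℂ) (γ' : K → SchwartzMap E₂ ℂ)
    (hc : ∀ k, IntervalIntegrable (c k) volume 0 t)
    (hm : ∀ k z, (FourierTransform.fourier (φ' k) : SchwartzMap E₁ ℂ) z.1 *
        (FourierTransform.fourier (γ' k) : SchwartzMap E₂ ℂ) z.2 =
      ((FourierTransform.fourier φ : SchwartzMap E₁ ℂ) z.1 *
        (FourierTransform.fourier γ : SchwartzMap E₂ ℂ) z.2) * m k z)
    (hcf : ∀ z, jointCharFun P U (V t) z - jointCharFun P U (V 0) z =
      ∫ s in (0 : ℝ)..t, ∑ k, m k z * ((c k s : ℂ) * jointCharFun P U (V s) z)) :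
    (∫ ω, φ (U ω) * γ (V t ω) ∂P) - ∫ ω, φ (U ω) * γ (V 0 ω) ∂P =
      ∫ s in (0 : ℝ)..t, ∑ k, (c k s : ℂ) * ∫ ω, φ' k (U ω) * γ' k (V s ω) ∂P := by
  have hVs : ∀ s, Measurable (V s) := fun s => hV.comp (measurable_id.prodMk measurable_const)
  have hcfm := measurable_jointCharFun (P := P) hU hV
  have hcfm' : ∀ s, Measurable (jointCharFun P U (V s)) := fun s =>
    hcfm.comp (measurable_const.prodMk measurable_id)
  have hcfm'' : ∀ z, Measurable (fun s => jointCharFun P U (V s) z) := fun z =>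
    hcfm.comp (measurable_id.prodMk measurable_const)
  have hint : ∀ (φ : SchwartzMap E₁ ℂ) (γ : SchwartzMap E₂ ℂ),
      Integrable (fun z : E₁ × E₂ => (FourierTransform.fourier φ : SchwartzMap E₁ ℂ) z.1 *
        (FourierTransform.fourier γ : SchwartzMap E₂ ℂ) z.2) := fun φ γ =>
    (FourierTransform.fourier φ : SchwartzMap E₁ ℂ).integrable.mul_prod
      (FourierTransform.fourier γ : SchwartzMap E₂ ℂ).integrable
  have hcC : ∀ k, IntervalIntegrable (fun s => (c k s : ℂ)) volume 0 t := fun k => by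
    have h := hc k
    rw [intervalIntegrable_iff] at h ⊢
    exact h.ofReal
  have hprod : ∀ k, Integrable (fun w : ℝ × (E₁ × E₂) => ((c k w.1 : ℂ) *
      ((FourierTransform.fourier (φ' k) : SchwartzMap E₁ ℂ) w.2.1 *
        (FourierTransform.fourier (γ' k) : SchwartzMap E₂ ℂ) w.2.2)) *
        jointCharFun P U (V w.1) w.2) ((volume.restrict (uIoc 0 t)).prod volume) := fun k =>
    Integrable.mul_bdd (c := 1) ((intervalIntegrable_iff.1 (hcC k)).mul_prod (hint _ _))
      hcfm.aestronglyMeasurable (Eventually.of_forall fun w => norm_jointCharFun_le _ _ _)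
  have hswap : ∀ k, ∫ s in (0 : ℝ)..t, (c k s : ℂ) * ∫ ω, φ' k (U ω) * γ' k (V s ω) ∂P =
      ∫ z : E₁ × E₂, ∫ s in (0 : ℝ)..t, ((FourierTransform.fourier φ : SchwartzMap E₁ ℂ) z.1 *
        (FourierTransform.fourier γ : SchwartzMap E₂ ℂ) z.2) *
          (m k z * ((c k s : ℂ) * jointCharFun P U (V s) z)) := fun k => by
    simp only [fun s => integral_schwartz_mul_schwartz (P := P) hU (hVs s) (φ' k) (γ' k),
      intervalIntegral.intervalIntegral_eq_integral_uIoc, ← integral_const_mul, integral_smul]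
    congr 1
    rw [integral_integral_swap]
    · refine integral_congr_ae (Eventually.of_forall fun z => ?_)
      refine integral_congr_ae (Eventually.of_forall fun s => ?_)
      simp only [hm]
      ring
    · refine (hprod k).congr (Eventually.of_forall fun w => ?_)
      simp only [Function.uncurry]
      ring
  have hswapint : ∀ k, Integrable fun z : E₁ × E₂ => ∫ s in (0 : ℝ)..t,
      ((FourierTransform.fourier φ : SchwartzMap E₁ ℂ) z.1 *
        (FourierTransform.fourier γ : SchwartzMap E₂ ℂ) z.2) *
          (m k z * ((c k s : ℂ) * jointCharFun P U (V s) z)) := fun k => by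
    simp only [intervalIntegral.intervalIntegral_eq_integral_uIoc]
    refine Integrable.smul _ ?_
    refine (hprod k).integral_prod_right.congr (Eventually.of_forall fun z => ?_)
    refine integral_congr_ae (Eventually.of_forall fun s => ?_)
    simp only [hm]
    ring
  have hsint : ∀ k, IntervalIntegrable (fun s => (c k s : ℂ) *
      ∫ ω, φ' k (U ω) * γ' k (V s ω) ∂P) volume 0 t := fun k => by
    rw [intervalIntegrable_iff]
    refine (hprod k).integral_prod_left.congr (Eventually.of_forall fun s => ?_)
    simp only [integral_schwartz_mul_schwartz (P := P) hU (hVs s), ← integral_const_mul, mul_assoc]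
  have hzint : ∀ k z, IntervalIntegrable (fun s =>
      ((FourierTransform.fourier φ : SchwartzMap E₁ ℂ) z.1 *
        (FourierTransform.fourier γ : SchwartzMap E₂ ℂ) z.2) *
          (m k z * ((c k s : ℂ) * jointCharFun P U (V s) z))) volume 0 t := fun k z => by
    rw [intervalIntegrable_iff]
    refine Integrable.const_mul (Integrable.const_mul ?_ _) _
    exact Integrable.mul_bdd (c := 1) (intervalIntegrable_iff.1 (hcC k))
      (hcfm'' z).aestronglyMeasurable (Eventually.of_forall fun w => norm_jointCharFun_le _ _ _)
  have hLint : ∀ s, Integrable (fun z : E₁ × E₂ =>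
      ((FourierTransform.fourier φ : SchwartzMap E₁ ℂ) z.1 *
        (FourierTransform.fourier γ : SchwartzMap E₂ ℂ) z.2) * jointCharFun P U (V s) z) :=
    fun s => Integrable.mul_bdd (c := 1) (hint φ γ) (hcfm' s).aestronglyMeasurable
      (Eventually.of_forall fun w => norm_jointCharFun_le _ _ _)
  rw [integral_schwartz_mul_schwartz hU (hVs t), integral_schwartz_mul_schwartz hU (hVs 0),
    ← integral_sub (hLint t) (hLint 0), intervalIntegral.integral_finsetSum fun k _ => hsint k]
  simp only [hswap]
  rw [← integral_finsetSum _ fun k _ => hswapint k]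
  refine integral_congr_ae (Eventually.of_forall fun z => ?_)
  simp only
  rw [← intervalIntegral.integral_finsetSum fun k _ => hzint k z, ← mul_sub, hcf,
    ← intervalIntegral.integral_const_mul]
  simp only [Finset.mul_sum]

end Fourier

section RealEvolution

variable {J ι : Type*} [Fintype J] [Fintype ι]

/-- A smooth compactly supported real function on `ℝ^J`, as a complex Schwartz function on the
Euclidean space. -/
def schwartzOfReal (F : (J → ℝ) → ℝ) (hF : ContDiff ℝ (⊤ : ℕ∞) F) (hc : HasCompactSupport F) :
    SchwartzMap (EuclideanSpace ℝ J) ℂ :=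
  HasCompactSupport.toSchwartzMap
    (f := fun x : EuclideanSpace ℝ J => ((F (WithLp.ofLp x) : ℝ) : ℂ))
    ((hc.comp_homeomorph (PiLp.continuousLinearEquiv 2 ℝ fun _ : J => ℝ).toHomeomorph).comp_left
      (g := ((↑) : ℝ → ℂ)) Complex.ofReal_zero)
    (Complex.ofRealCLM.contDiff.comp
      (hF.comp (PiLp.continuousLinearEquiv 2 ℝ fun _ : J => ℝ).contDiff))

theorem schwartzOfReal_apply (F : (J → ℝ) → ℝ) (hF : ContDiff ℝ (⊤ : ℕ∞) F)
    (hc : HasCompactSupport F) (x : EuclideanSpace ℝ J) :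
    schwartzOfReal F hF hc x = ((F (WithLp.ofLp x) : ℝ) : ℂ) := rfl

variable [DecidableEq J] [DecidableEq ι]

theorem lineDerivOp_schwartzOfReal (F : (J → ℝ) → ℝ) (hF : ContDiff ℝ (⊤ : ℕ∞) F)
    (hc : HasCompactSupport F) (j : J) :
    LineDeriv.lineDerivOp (EuclideanSpace.single j (1 : ℝ)) (schwartzOfReal F hF hc) =
      schwartzOfReal (fun y => fderiv ℝ F y (Pi.single j 1)) (contDiff_fderiv_apply hF _)
        (hc.fderiv_apply ℝ _) := by
  ext x
  rw [SchwartzMap.lineDerivOp_apply_eq_fderiv, schwartzOfReal_apply]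
  have h1 := Complex.ofRealCLM.hasFDerivAt.comp x
    (((hF.differentiable (by simp) (WithLp.ofLp x)).hasFDerivAt).comp x
      (PiLp.continuousLinearEquiv 2 ℝ fun _ : J => ℝ).toContinuousLinearMap.hasFDerivAt)
  have h2 : fderiv ℝ (schwartzOfReal F hF hc : EuclideanSpace ℝ J → ℂ) x = _ := h1.fderiv
  rw [h2]
  rfl

theorem fourier_lineDerivOp_single_apply (φ : SchwartzMap (EuclideanSpace ℝ J) ℂ) (j : J)
    (η : EuclideanSpace ℝ J) :
    (FourierTransform.fourier (LineDeriv.lineDerivOp (EuclideanSpace.single j (1 : ℝ)) φ) :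
      SchwartzMap (EuclideanSpace ℝ J) ℂ) η =
    2 * Real.pi * Complex.I * (η j : ℂ) *
      (FourierTransform.fourier φ : SchwartzMap (EuclideanSpace ℝ J) ℂ) η := by
  rw [SchwartzMap.fourier_lineDerivOp_eq]
  simp only [smul_apply, smul_eq_mul]
  rw [SchwartzMap.smulLeftCLM_apply_apply (by fun_prop), EuclideanSpace.inner_single_right]
  simp
  ring

variable {Ω : Type*} [MeasurableSpace Ω] {P : Measure Ω} [IsProbabilityMeasure P]

/-- The Itô formula for smooth compactly supported functions, tested against smooth functions of
`U`. The hypothesis on the characteristic functions says that, at the level of covariances,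
`d⟨U_j, V^q⟩ = c_jq ds` and `d Var(V^q) = r ds`. -/
theorem integral_mul_evolution {U : Ω → J → ℝ} {V : ℝ → Ω → ι → ℝ}
    (hU : Measurable U) (hV : Measurable fun w : Ω × ℝ => V w.2 w.1) {t : ℝ}
    (c : J → ι → ℝ → ℝ) (r : ℝ → ℝ) (hc : ∀ j q, IntervalIntegrable (c j q) volume 0 t)
    (hr : IntervalIntegrable r volume 0 t)
    (hcf : ∀ (η : J → ℝ) (ξ : ι → ℝ),
      ((∫ ω, Complex.exp (↑(∑ j, η j * U ω j + ∑ q, ξ q * V t ω q) * Complex.I) ∂P) -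
        ∫ ω, Complex.exp (↑(∑ j, η j * U ω j + ∑ q, ξ q * V 0 ω q) * Complex.I) ∂P) =
      ∫ s in (0 : ℝ)..t, ((-(∑ j, ∑ q, c j q s * (η j * ξ q) + r s / 2 * ∑ q, ξ q ^ 2) : ℝ) : ℂ) *
        ∫ ω, Complex.exp (↑(∑ j, η j * U ω j + ∑ q, ξ q * V s ω q) * Complex.I) ∂P)
    (F : (J → ℝ) → ℝ) (hF : ContDiff ℝ (⊤ : ℕ∞) F) (hFc : HasCompactSupport F)
    (G : (ι → ℝ) → ℝ) (hG : ContDiff ℝ (⊤ : ℕ∞) G) (hGc : HasCompactSupport G) :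
    (∫ ω, F (U ω) * G (V t ω) ∂P) - ∫ ω, F (U ω) * G (V 0 ω) ∂P =
      ∫ s in (0 : ℝ)..t, (∑ j, ∑ q, c j q s *
        ∫ ω, fderiv ℝ F (U ω) (Pi.single j 1) * fderiv ℝ G (V s ω) (Pi.single q 1) ∂P) +
        ∑ q, r s / 2 * ∫ ω, F (U ω) *
          fderiv ℝ (fun z => fderiv ℝ G z (Pi.single q 1)) (V s ω) (Pi.single q 1) ∂P := by
  let U' : Ω → EuclideanSpace ℝ J := fun ω => WithLp.toLp 2 (U ω)
  let V' : ℝ → Ω → EuclideanSpace ℝ ι := fun s ω => WithLp.toLp 2 (V s ω)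
  have hU' : Measurable U' := by
    exact (PiLp.continuousLinearEquiv 2 ℝ fun _ : J => ℝ).symm.continuous.measurable.comp hU
  have hV' : Measurable fun w : Ω × ℝ => V' w.2 w.1 := by
    exact (PiLp.continuousLinearEquiv 2 ℝ fun _ : ι => ℝ).symm.continuous.measurable.comp hV
  have hcfeq : ∀ s (z : EuclideanSpace ℝ J × EuclideanSpace ℝ ι),
      jointCharFun P U' (V' s) z = ∫ ω, Complex.exp (↑(∑ j, (2 * Real.pi * z.1 j) * U ω j +
        ∑ q, (2 * Real.pi * z.2 q) * V s ω q) * Complex.I) ∂P := by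
    intro s z
    refine integral_congr_ae (Eventually.of_forall fun ω => ?_)
    have : 2 * Real.pi * (inner ℝ z.1 (U' ω) + inner ℝ z.2 (V' s ω)) =
        ∑ j, (2 * Real.pi * z.1 j) * U ω j + ∑ q, (2 * Real.pi * z.2 q) * V s ω q := by
      simp only [PiLp.inner_apply, RCLike.inner_apply, conj_trivial, mul_add, Finset.mul_sum, U',
        V', mul_assoc, mul_comm (z.1 _), mul_comm (z.2 _)]
    simp only [this]
  have key := integral_schwartz_evolution (P := P) (K := (J × ι) ⊕ ι) hU' hV' (t := t)
    (schwartzOfReal F hF hFc) (schwartzOfReal G hG hGc)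
    (Sum.elim (fun k => c k.1 k.2) (fun _ s => r s / 2))
    (Sum.elim (fun k z => (2 * Real.pi * Complex.I * (z.1 k.1 : ℂ)) *
        (2 * Real.pi * Complex.I * (z.2 k.2 : ℂ)))
      (fun q z => (2 * Real.pi * Complex.I * (z.2 q : ℂ)) *
        (2 * Real.pi * Complex.I * (z.2 q : ℂ))))
    (Sum.elim (fun k => LineDeriv.lineDerivOp (EuclideanSpace.single k.1 (1 : ℝ))
      (schwartzOfReal F hF hFc)) (fun _ => schwartzOfReal F hF hFc))
    (Sum.elim (fun k => LineDeriv.lineDerivOp (EuclideanSpace.single k.2 (1 : ℝ))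
      (schwartzOfReal G hG hGc)) (fun q => LineDeriv.lineDerivOp
        (EuclideanSpace.single q (1 : ℝ)) (LineDeriv.lineDerivOp
          (EuclideanSpace.single q (1 : ℝ)) (schwartzOfReal G hG hGc)))) ?_ ?_ ?_
  · have hreal : ∀ (f : Ω → ℝ) (g : Ω → ℝ), ∫ ω, ((f ω : ℝ) : ℂ) * ((g ω : ℝ) : ℂ) ∂P =
        ((∫ ω, f ω * g ω ∂P : ℝ) : ℂ) := fun f g => by
      rw [← integral_complex_ofReal]
      simp only [Complex.ofReal_mul]
    simp only [Fintype.sum_sum_type, Sum.elim_inl, Sum.elim_inr, lineDerivOp_schwartzOfReal,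
      schwartzOfReal_apply, hreal, U', V', Fintype.sum_prod_type] at key
    have h2 : ∀ s, ((∑ j, ∑ q, (c j q s : ℂ) * ((∫ ω, fderiv ℝ F (U ω) (Pi.single j 1) *
        fderiv ℝ G (V s ω) (Pi.single q 1) ∂P : ℝ) : ℂ)) +
        ∑ q, ((r s / 2 : ℝ) : ℂ) * ((∫ ω, F (U ω) * fderiv ℝ (fun z => fderiv ℝ G z
          (Pi.single q 1)) (V s ω) (Pi.single q 1) ∂P : ℝ) : ℂ)) =
        (((∑ j, ∑ q, c j q s *
        ∫ ω, fderiv ℝ F (U ω) (Pi.single j 1) * fderiv ℝ G (V s ω) (Pi.single q 1) ∂P) +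
        ∑ q, r s / 2 * ∫ ω, F (U ω) * fderiv ℝ (fun z => fderiv ℝ G z (Pi.single q 1)) (V s ω)
          (Pi.single q 1) ∂P : ℝ) : ℂ) := fun s => by push_cast; rfl
    simp only [h2, intervalIntegral.integral_ofReal] at key
    exact_mod_cast key
  · rintro (k | q)
    · exact hc k.1 k.2
    · exact hr.div_const 2
  · rintro (k | q) z
    · simp only [Sum.elim_inl, fourier_lineDerivOp_single_apply]
      ring
    · simp only [Sum.elim_inr, fourier_lineDerivOp_single_apply]
      ring
  · intro z
    rw [hcfeq, hcfeq, hcf]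
    refine intervalIntegral.integral_congr fun s _ => ?_
    simp only [Fintype.sum_sum_type, Sum.elim_inl, Sum.elim_inr, Fintype.sum_prod_type, hcfeq]
    generalize (∫ ω, Complex.exp (↑(∑ j, (2 * Real.pi * z.1 j) * U ω j +
      ∑ q, (2 * Real.pi * z.2 q) * V s ω q) * Complex.I) ∂P) = E
    have hI : Complex.I * Complex.I = -1 := Complex.I_mul_I
    have h1 : ∑ j, ∑ q, (2 * Real.pi * Complex.I * (z.1 j : ℂ)) *
        (2 * Real.pi * Complex.I * (z.2 q : ℂ)) * ((c j q s : ℂ) * E) =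
        -(∑ j, ∑ q, (c j q s : ℂ) * ((2 * Real.pi * z.1 j) * (2 * Real.pi * z.2 q))) * E := by
      rw [neg_mul, Finset.sum_mul, ← Finset.sum_neg_distrib]
      refine Finset.sum_congr rfl fun j _ => ?_
      rw [Finset.sum_mul, ← Finset.sum_neg_distrib]
      refine Finset.sum_congr rfl fun q _ => ?_
      linear_combination ((c j q s : ℂ) * (2 * Real.pi * z.1 j) * (2 * Real.pi * z.2 q) * E) * hI
    have h2 : ∑ q, (2 * Real.pi * Complex.I * (z.2 q : ℂ)) *
        (2 * Real.pi * Complex.I * (z.2 q : ℂ)) * (((r s / 2 : ℝ) : ℂ) * E) =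
        -((r s / 2 : ℝ) * ∑ q, (2 * Real.pi * (z.2 q : ℂ)) ^ 2) * E := by
      rw [neg_mul, Finset.mul_sum, Finset.sum_mul, ← Finset.sum_neg_distrib]
      refine Finset.sum_congr rfl fun q _ => ?_
      linear_combination (((r s / 2 : ℝ) : ℂ) * (2 * Real.pi * z.2 q) ^ 2 * E) * hI
    rw [Complex.ofReal_neg, Complex.ofReal_add, Complex.ofReal_mul]
    push_cast at h1 h2 ⊢
    simp only [mul_assoc] at h1 h2 ⊢
    rw [h1, h2]
    ring

end RealEvolution

/-! ### Finite families of independent Gaussian processes -/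

section AbsolutelyContinuousPi

open Measure in
theorem MeasureTheory.Measure.AbsolutelyContinuous.tprod {δ : Type*} {X : δ → Type*}
    [∀ i, MeasurableSpace (X i)] {μ ν : ∀ i, Measure (X i)} [∀ i, SigmaFinite (μ i)]
    [∀ i, SigmaFinite (ν i)] (h : ∀ i, μ i ≪ ν i) (l : List δ) :
    Measure.tprod l μ ≪ Measure.tprod l ν := by
  induction l with
  | nil => exact AbsolutelyContinuous.rfl
  | cons i l ih =>
    rw [Measure.tprod_cons, Measure.tprod_cons]
    exact (h i).prod ih

theorem MeasureTheory.Measure.AbsolutelyContinuous.pi {ι : Type*} [Fintype ι] {X : ι → Type*}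
    [∀ i, MeasurableSpace (X i)] {μ ν : ∀ i, Measure (X i)} [∀ i, SigmaFinite (μ i)]
    [∀ i, SigmaFinite (ν i)] (h : ∀ i, μ i ≪ ν i) : Measure.pi μ ≪ Measure.pi ν := by
  classical
  have := Fintype.toEncodable ι
  rw [← Measure.pi'_eq_pi, ← Measure.pi'_eq_pi]
  exact (MeasureTheory.Measure.AbsolutelyContinuous.tprod h _).map
    (measurable_tProd_elim' _)

end AbsolutelyContinuousPi

section GaussianProcesses

variable {Ω ι : Type*} [MeasurableSpace Ω] {P : Measure Ω}

/-- The `W i`, for `i : ι`, are independent centered Gaussian processes on `[0, ∞)` with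
almost surely continuous paths and common covariance function `R`. -/
structure IndepGaussianProcesses (P : Measure Ω) (W : ι → ℝ → Ω → ℝ) (R : ℝ → ℝ → ℝ) : Prop where
  measurable : ∀ i t, 0 ≤ t → Measurable (W i t)
  continuous : ∀ i, ∀ᵐ ω ∂P, ContinuousOn (fun t => W i t ω) (Ici 0)
  gaussian : ∀ i, IsGaussianProcess (fun (t : ℝ≥0) ω => W i t ω) P
  indep : iIndepFun (fun i ω (t : ℝ≥0) => W i t ω) P
  centered : ∀ i t, 0 ≤ t → ∫ ω, W i t ω ∂P = 0
  covariance : ∀ i s t, 0 ≤ s → 0 ≤ t → ∫ ω, W i s ω * W i t ω ∂P = R s t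

theorem IsGaussianFamily.upperProcess {X : ℕ → ℕ → ℝ → Ω → ℝ} {R : ℝ → ℝ → ℝ}
    (hX : IsGaussianFamily P X R) (n : ℕ) :
    IndepGaussianProcesses P (upperProcess n X) R where
  measurable q := hX.measurable _ _
  continuous q := hX.continuous _ _
  gaussian q := hX.gaussian _ _
  indep := hX.indep.precomp (g := fun q : UpperPair n => ((q.1.1 : ℕ), (q.1.2 : ℕ))) <| by
    rintro ⟨⟨a, b⟩, h⟩ ⟨⟨c, d⟩, h'⟩ hq
    simpa [Fin.val_inj] using hq
  centered q := hX.centered _ _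
  covariance q := hX.covariance _ _

/-- A finite linear combination of values of a Gaussian process is Gaussian, also when times are
repeated. -/
theorem ProbabilityTheory.IsGaussianProcess.hasGaussianLaw_sum_mul {S K : Type*} [Fintype K]
    {X : S → Ω → ℝ} (hX : IsGaussianProcess X P) (τ : K → S) (a : K → ℝ) :
    HasGaussianLaw (fun ω => ∑ k, a k * X (τ k) ω) P := by
  classical
  let I : Finset S := Finset.univ.image τ
  have h := (hX.hasGaussianLaw I).map_fun
    (∑ k, a k • ContinuousLinearMap.proj (R := ℝ) (φ := fun _ : I => ℝ)
      ⟨τ k, Finset.mem_image_of_mem τ (Finset.mem_univ k)⟩)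
  refine h.congr (Eventually.of_forall fun ω => ?_)
  simp

namespace IndepGaussianProcesses

variable {W : ι → ℝ → Ω → ℝ} {R : ℝ → ℝ → ℝ}

theorem hasGaussianLaw_sum_mul (hW : IndepGaussianProcesses P W R) {K : Type*} [Fintype K] (i : ι)
    (τ : K → ℝ) (hτ : ∀ k, 0 ≤ τ k) (a : K → ℝ) :
    HasGaussianLaw (fun ω => ∑ k, a k * W i (τ k) ω) P :=
  (hW.gaussian i).hasGaussianLaw_sum_mul (fun k => (⟨τ k, hτ k⟩ : ℝ≥0)) a

theorem hasGaussianLaw (hW : IndepGaussianProcesses P W R) (i : ι) {t : ℝ} (ht : 0 ≤ t) :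
    HasGaussianLaw (W i t) P :=
  (hW.gaussian i).hasGaussianLaw_eval ⟨t, ht⟩

theorem memLp_two (hW : IndepGaussianProcesses P W R) (i : ι) {t : ℝ} (ht : 0 ≤ t) :
    MemLp (W i t) 2 P := (hW.hasGaussianLaw i ht).memLp_two

theorem integrable_mul (hW : IndepGaussianProcesses P W R) (i : ι) {s t : ℝ} (hs : 0 ≤ s)
    (ht : 0 ≤ t) : Integrable (fun ω => W i s ω * W i t ω) P :=
  (hW.memLp_two i hs).integrable_mul (hW.memLp_two i ht)

theorem covariance_comm [Nonempty ι] (hW : IndepGaussianProcesses P W R) {s t : ℝ} (hs : 0 ≤ s)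
    (ht : 0 ≤ t) : R s t = R t s := by
  obtain ⟨i⟩ := ‹Nonempty ι›
  rw [← hW.covariance i s t hs ht, ← hW.covariance i t s ht hs]
  simp only [mul_comm]

theorem covariance_self_nonneg [Nonempty ι] (hW : IndepGaussianProcesses P W R) {s : ℝ}
    (hs : 0 ≤ s) : 0 ≤ R s s := by
  obtain ⟨i⟩ := ‹Nonempty ι›
  rw [← hW.covariance i s s hs hs]
  exact integral_nonneg fun ω => mul_self_nonneg _

theorem ae_eq_zero (hW : IndepGaussianProcesses P W R) (i : ι) {t : ℝ} (ht : 0 ≤ t)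
    (h : R t t = 0) : W i t =ᵐ[P] 0 := by
  have h1 := hW.covariance i t t ht ht
  rw [h, integral_eq_zero_iff_of_nonneg (fun ω => mul_self_nonneg _)
    (hW.integrable_mul i ht ht)] at h1
  filter_upwards [h1] with ω hω
  simpa using hω

variable [Fintype ι]

/-- The characteristic function of a linear combination of the values of independent Gaussian
processes. -/
theorem integral_exp_sum_mul [IsProbabilityMeasure P] (hW : IndepGaussianProcesses P W R)
    {K : Type*} [Fintype K] (τ : K → ℝ) (hτ : ∀ k, 0 ≤ τ k) (a : ι → K → ℝ) :
    ∫ ω, Complex.exp (↑(∑ i, ∑ k, a i k * W i (τ k) ω) * Complex.I) ∂P =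
      Complex.exp (((-(1 / 2) * ∑ i, ∑ k, ∑ l, a i k * a i l * R (τ k) (τ l) : ℝ)) : ℂ) := by
  classical
  have hg : ∀ i, HasGaussianLaw (fun ω => ∑ k, a i k * W i (τ k) ω) P :=
    fun i => hW.hasGaussianLaw_sum_mul i τ hτ (a i)
  have hind : iIndepFun (fun i ω => ∑ k, a i k * W i (τ k) ω) P :=
    hW.indep.comp (fun i (x : ℝ≥0 → ℝ) => ∑ k, a i k * x ⟨τ k, hτ k⟩) fun i => by fun_prop
  have hmean : ∀ i, ∫ ω, ∑ k, a i k * W i (τ k) ω ∂P = 0 := fun i => by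
    rw [integral_finsetSum _ fun k _ => ((hW.hasGaussianLaw i (hτ k)).integrable.const_mul _)]
    exact Finset.sum_eq_zero fun k _ => by rw [integral_const_mul, hW.centered i _ (hτ k), mul_zero]
  have hvar : ∀ i, Var[fun ω => ∑ k, a i k * W i (τ k) ω; P] =
      ∑ k, ∑ l, a i k * a i l * R (τ k) (τ l) := fun i => by
    rw [variance_of_integral_eq_zero (hg i).aemeasurable (hmean i)]
    have : ∀ ω, (∑ k, a i k * W i (τ k) ω) ^ 2 =
        ∑ k, ∑ l, a i k * a i l * (W i (τ k) ω * W i (τ l) ω) := fun ω => by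
      rw [sq, Finset.sum_mul_sum]
      exact Finset.sum_congr rfl fun k _ => Finset.sum_congr rfl fun l _ => by ring
    simp only [this]
    rw [integral_finsetSum _ fun k _ => integrable_finsetSum _ fun l _ =>
      (hW.integrable_mul i (hτ k) (hτ l)).const_mul _]
    refine Finset.sum_congr rfl fun k _ => ?_
    rw [integral_finsetSum _ fun l _ => (hW.integrable_mul i (hτ k) (hτ l)).const_mul _]
    refine Finset.sum_congr rfl fun l _ => ?_
    rw [integral_const_mul, hW.covariance i _ _ (hτ k) (hτ l)]
  have hS : HasGaussianLaw (fun ω => ∑ i, ∑ k, a i k * W i (τ k) ω) P :=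
    iIndepFun.hasGaussianLaw_fun_sum hg hind
  have hSm : ∫ ω, ∑ i, ∑ k, a i k * W i (τ k) ω ∂P = 0 := by
    rw [integral_finsetSum _ fun i _ => (hg i).integrable]
    exact Finset.sum_eq_zero fun i _ => hmean i
  have hSv : Var[fun ω => ∑ i, ∑ k, a i k * W i (τ k) ω; P] =
      ∑ i, ∑ k, ∑ l, a i k * a i l * R (τ k) (τ l) := by
    have := IndepFun.variance_sum (μ := P) (s := Finset.univ)
      (X := fun i ω => ∑ k, a i k * W i (τ k) ω) (fun i _ => (hg i).memLp_two)
      (fun i _ j _ hij => hind.indepFun hij)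
    rw [← Finset.sum_congr rfl fun i _ => hvar i, ← this]
    congr 1
    ext ω
    simp
  have h1 := hS.map_eq_gaussianReal
  rw [hSm, hSv] at h1
  have h2 := charFun_gaussianReal (μ := 0)
    (v := (∑ i, ∑ k, ∑ l, a i k * a i l * R (τ k) (τ l)).toNNReal) 1
  rw [← h1, charFun_apply_real, integral_map hS.aemeasurable
    (by fun_prop)] at h2
  have h3 : 0 ≤ ∑ i, ∑ k, ∑ l, a i k * a i l * R (τ k) (τ l) := by
    rw [← hSv]; exact variance_nonneg _ _
  simp only [Complex.ofReal_one, one_mul, Complex.ofReal_zero, mul_zero, zero_mul, zero_sub,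
    one_pow, mul_one, Real.coe_toNNReal _ h3] at h2
  rw [h2]
  congr 1
  push_cast
  ring

/-- When the variance at time `s` is positive, the law of `W_s` has a density. -/
theorem map_absolutelyContinuous [IsProbabilityMeasure P] (hW : IndepGaussianProcesses P W R)
    {s : ℝ} (hs : 0 ≤ s) (h : 0 < R s s) :
    P.map (fun ω i => W i s ω) ≪ (volume : Measure (ι → ℝ)) := by
  have hind : iIndepFun (fun i => W i s) P :=
    hW.indep.comp (fun i (x : ℝ≥0 → ℝ) => x ⟨s, hs⟩) fun i => by fun_prop
  rw [iIndepFun_iff_map_fun_eq_pi_map fun i => (hW.measurable i s hs).aemeasurable] at hind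
  rw [hind, volume_pi]
  have : ∀ i, IsProbabilityMeasure (P.map (W i s)) := fun i =>
    Measure.isProbabilityMeasure_map (hW.measurable i s hs).aemeasurable
  refine MeasureTheory.Measure.AbsolutelyContinuous.pi fun i => ?_
  have hv : Var[W i s; P] = R s s := by
    rw [variance_of_integral_eq_zero (hW.measurable i s hs).aemeasurable (hW.centered i s hs),
      ← hW.covariance i s s hs hs]
    simp only [sq]
  rw [(hW.hasGaussianLaw i hs).map_eq_gaussianReal, hv]
  exact gaussianReal_absolutelyContinuous _ (by simpa using h)

end IndepGaussianProcesses

end GaussianProcesses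

section CharFunEvolution

variable {Ω ι J : Type*} [MeasurableSpace Ω] {P : Measure Ω} [Fintype ι] [Fintype J]
  {W : ι → ℝ → Ω → ℝ} {R : ℝ → ℝ → ℝ} {T : ℝ}

/-- A finite set of times carrying all the step functions `h j i`. -/
theorem exists_finset_support_subset (h : J → ι → StepFun T) :
    ∃ S : Finset (Icc (0 : ℝ) T), ∀ j i, (h j i).support ⊆ S := by
  classical
  refine ⟨Finset.univ.biUnion fun j => Finset.univ.biUnion fun i => (h j i).support,
    fun j i τ hτ => ?_⟩
  simp only [Finset.mem_biUnion, Finset.mem_univ, true_and]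
  exact ⟨j, i, hτ⟩

namespace IndepGaussianProcesses

/-- The joint characteristic function of `(W(h_j))_j` and `κ W_s + a`. In the exponent, the terms
that depend on `s` are separated from the quadratic form in the `h_j`. -/
theorem integral_exp_gaussianInt_add [IsProbabilityMeasure P] [Nonempty ι]
    (hW : IndepGaussianProcesses P W R)
    (h : J → ι → StepFun T) {S : Finset (Icc (0 : ℝ) T)} (hS : ∀ j i, (h j i).support ⊆ S)
    (κ : ℝ) (a : ι → ℝ) (η : J → ℝ) (ξ : ι → ℝ) {s : ℝ} (hs : 0 ≤ s) :
    ∫ ω, Complex.exp (↑(∑ j, η j * gaussianInt W (h j) ω + ∑ q, ξ q * (κ * W q s ω + a q)) *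
        Complex.I) ∂P =
      Complex.exp (↑(∑ q, ξ q * a q) * Complex.I) *
      Complex.exp ((-(1 / 2) * ((∑ q, (ξ q * κ) ^ 2) * R s s +
        ∑ τ : S, (2 * ∑ q, (ξ q * κ) * ∑ j, η j * h j q τ) * R s τ +
        ∑ q, ∑ τ : S, ∑ τ' : S, (∑ j, η j * h j q τ) * (∑ j, η j * h j q τ') * R τ τ' : ℝ)) : ℂ)
      := by
  have hg : ∀ ω j, gaussianInt W (h j) ω = ∑ q, ∑ τ : S, h j q τ * W q τ ω := fun ω j => by
    refine Finset.sum_congr rfl fun q _ => ?_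
    rw [Finsupp.sum_of_support_subset _ (hS j q) _ (by simp),
      ← Finset.sum_coe_sort S fun τ => h j q τ * W q τ ω]
  have key := hW.integral_exp_sum_mul (K := Option S) (fun k => k.elim s fun τ => (τ : ℝ))
    (fun k => by
      cases k with
      | none => exact hs
      | some τ => exact τ.1.2.1)
    (fun q k => k.elim (ξ q * κ) fun τ => ∑ j, η j * h j q τ)
  have hsum : ∀ ω, ∑ j, η j * gaussianInt W (h j) ω + ∑ q, ξ q * (κ * W q s ω + a q) =
      ∑ q, ξ q * a q + ∑ q, (ξ q * κ * W q s ω + ∑ τ : S, (∑ j, η j * h j q τ) * W q τ ω) := by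
    intro ω
    simp only [hg, Finset.mul_sum, Finset.sum_mul, mul_add, Finset.sum_add_distrib]
    rw [Finset.sum_comm]
    have : ∀ q, ∑ j, ∑ τ : S, η j * (h j q τ * W q τ ω) =
        ∑ τ : S, ∑ j, η j * h j q τ * W q τ ω := fun q => by
      rw [Finset.sum_comm]
      simp only [mul_assoc]
    simp only [this, mul_assoc]
    ring
  simp only [Fintype.sum_option, Option.elim_none, Option.elim_some] at key
  simp only [hsum, Complex.ofReal_add (∑ q, ξ q * a q), add_mul, Complex.exp_add]
  rw [integral_const_mul, key]
  congr 3
  have hsymm : ∀ τ : S, R τ s = R s τ := fun τ => hW.covariance_comm τ.1.2.1 hs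
  obtain ⟨β, hβ⟩ : ∃ β : ι → S → ℝ, ∀ q (τ : S), ∑ j, η j * h j q τ = β q τ := ⟨_, fun _ _ => rfl⟩
  simp only [hsymm, hβ, Finset.sum_add_distrib]
  have h1 : ∑ τ, (2 * ∑ q, ξ q * κ * β q τ) * R s τ =
      ∑ q, ∑ τ, ξ q * κ * β q τ * R s τ + ∑ q, ∑ τ, β q τ * (ξ q * κ) * R s τ := by
    rw [Finset.sum_comm, Finset.sum_comm (f := fun q τ => β q τ * (ξ q * κ) * R s τ),
      ← Finset.sum_add_distrib]
    refine Finset.sum_congr rfl fun τ _ => ?_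
    rw [← Finset.sum_add_distrib, Finset.mul_sum, Finset.sum_mul]
    exact Finset.sum_congr rfl fun q _ => by ring
  rw [h1, Finset.sum_mul]
  simp only [sq]
  rw [Complex.ofReal_mul]
  congr 1
  · push_cast
    rfl
  · congr 1
    ring

/-- The evolution in `s` of the joint characteristic function of `(W(h_j))_j` and `κ W_s + a`. -/
theorem charFun_evolution [IsProbabilityMeasure P] [Nonempty ι]
    (hW : IndepGaussianProcesses P W R) (hR : CovarianceH1 R) (hT : 0 < T)
    (h : J → ι → StepFun T) (κ : ℝ) (a : ι → ℝ) {t : ℝ} (ht : t ∈ Icc 0 T)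
    (η : J → ℝ) (ξ : ι → ℝ) :
    ((∫ ω, Complex.exp (↑(∑ j, η j * gaussianInt W (h j) ω + ∑ q, ξ q * (κ * W q t ω + a q)) *
        Complex.I) ∂P) -
      ∫ ω, Complex.exp (↑(∑ j, η j * gaussianInt W (h j) ω + ∑ q, ξ q * (κ * W q 0 ω + a q)) *
        Complex.I) ∂P) =
    ∫ s in (0 : ℝ)..t, ((-(∑ j, ∑ q, (κ * (h j q).sum fun τ c =>
        c * deriv (fun r => R r (τ : ℝ)) s) * (η j * ξ q) +
        κ ^ 2 * deriv (fun r => R r r) s / 2 * ∑ q, ξ q ^ 2) : ℝ) : ℂ) *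
      ∫ ω, Complex.exp (↑(∑ j, η j * gaussianInt W (h j) ω + ∑ q, ξ q * (κ * W q s ω + a q)) *
        Complex.I) ∂P := by
  obtain ⟨S, hS⟩ := exists_finset_support_subset h
  let B : ℝ := ∑ q, (ξ q * κ) ^ 2
  let b : S → ℝ := fun τ => 2 * ∑ q, (ξ q * κ) * ∑ j, η j * h j q τ
  let A : ℝ := ∑ q, ∑ τ : S, ∑ τ' : S, (∑ j, η j * h j q τ) * (∑ j, η j * h j q τ') * R τ τ'
  let φ : ℝ → ℝ := fun s => -(1 / 2) * (B * R s s + ∑ τ : S, b τ * R s τ + A)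
  let φ' : ℝ → ℝ := fun s => -(1 / 2) * (B * deriv (fun r => R r r) s +
    ∑ τ : S, b τ * deriv (fun r => R r τ) s)
  let z : ℂ := Complex.exp (↑(∑ q, ξ q * a q) * Complex.I)
  have hE : ∀ s, 0 ≤ s → ∫ ω, Complex.exp (↑(∑ j, η j * gaussianInt W (h j) ω +
      ∑ q, ξ q * (κ * W q s ω + a q)) * Complex.I) ∂P = z * ((Real.exp (φ s) : ℝ) : ℂ) :=
    fun s hs => by
      rw [hW.integral_exp_gaussianInt_add h hS κ a η ξ hs, Complex.ofReal_exp]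
      simp only [z, φ, B, b, A]
      push_cast
      rfl
  have hsub : uIcc 0 t ⊆ uIcc 0 T := by
    rw [uIcc_of_le ht.1, uIcc_of_le hT.le]
    exact Icc_subset_Icc_right ht.2
  have hac : ∀ τ : S, AbsolutelyContinuousOnInterval (fun s => R s τ) 0 t := fun τ =>
    (hR.absolutelyContinuous T hT _ τ.1.2).mono hsub
  have hφ : AbsolutelyContinuousOnInterval φ 0 t := by
    refine AbsolutelyContinuousOnInterval.const_mul _ (AbsolutelyContinuousOnInterval.add
      (AbsolutelyContinuousOnInterval.add ?_ ?_) ?_)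
    · exact ((hR.absolutelyContinuous_diag hT).mono hsub).const_mul _
    · exact AbsolutelyContinuousOnInterval.sum _ fun τ _ => (hac τ).const_mul _
    -- a constant is absolutely continuous, as its increments are at most `0` times any others
    · exact ((hR.absolutelyContinuous_diag hT).mono hsub).of_dist_le (K := 0) (by simp)
  have hφ' : ∀ᵐ s, s ∈ uIcc 0 t → HasDerivAt φ (φ' s) s := by
    have h1 : ∀ᵐ s, ∀ τ : S, s ∈ uIcc 0 t → DifferentiableAt ℝ (fun s => R s τ) s :=
      ae_all_iff.2 fun τ => (hac τ).boundedVariationOn.ae_differentiableAt_of_mem_uIcc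
    have h2 : ∀ᵐ s : ℝ, s ≠ 0 := by simp [ae_iff]
    filter_upwards [h1, h2] with s hs hs0 hst
    have hpos : 0 < s := lt_of_le_of_ne (by rw [uIcc_of_le ht.1] at hst; exact hst.1) hs0.symm
    refine HasDerivAt.const_mul _ ?_
    have := ((hR.hasDerivAt_diag hpos).const_mul B).fun_add
      (HasDerivAt.fun_sum (u := Finset.univ) fun (τ : S) _ => ((hs τ hst).hasDerivAt).const_mul (b τ))
    simpa using this.add_const A
  have hint := integral_deriv_mul_exp hφ hφ'
  rw [hE t ht.1, hE 0 le_rfl, ← mul_sub, ← Complex.ofReal_sub, ← hint,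
    ← intervalIntegral.integral_ofReal, ← intervalIntegral.integral_const_mul]
  refine intervalIntegral.integral_congr fun s hs => ?_
  rw [uIcc_of_le ht.1] at hs
  simp only [hE s hs.1]
  have h3 : φ' s = -(∑ j, ∑ q, (κ * (h j q).sum fun τ c =>
        c * deriv (fun r => R r (τ : ℝ)) s) * (η j * ξ q) +
        κ ^ 2 * deriv (fun r => R r r) s / 2 * ∑ q, ξ q ^ 2) := by
    have h4 : ∀ j q, ((h j q).sum fun τ c => c * deriv (fun r => R r (τ : ℝ)) s) =
        ∑ τ : S, h j q τ * deriv (fun r => R r τ) s := fun j q => by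
      rw [Finsupp.sum_of_support_subset _ (hS j q) _ (by simp),
        ← Finset.sum_coe_sort S fun τ => h j q τ * deriv (fun r => R r (τ : ℝ)) s]
    have h5 : ∑ j, ∑ q, (κ * ∑ τ : S, h j q τ * deriv (fun r => R r τ) s) * (η j * ξ q) =
        ∑ τ : S, (∑ q, ξ q * κ * ∑ j, η j * h j q τ) * deriv (fun r => R r τ) s := by
      simp only [Finset.mul_sum, Finset.sum_mul]
      rw [Finset.sum_comm, Finset.sum_comm (t := (Finset.univ : Finset ι))]
      refine Finset.sum_congr rfl fun q _ => ?_
      rw [Finset.sum_comm]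
      exact Finset.sum_congr rfl fun τ _ => Finset.sum_congr rfl fun j _ => by ring
    simp only [h4, h5, φ', B, b, mul_pow, ← Finset.sum_mul, mul_assoc (2 : ℝ), ← Finset.mul_sum]
    ring
  rw [← h3]
  push_cast
  ring

end IndepGaussianProcesses

end CharFunEvolution

/-! ### Jointly measurable versions -/

section MeasurableVersion

/-- A process whose paths are continuous on `[0, T]` outside a null set has a jointly measurable
version; it is a limit of step processes, so it is measurable for any `σ`-algebra that makes the
values at times in `[0, T]` measurable. -/
theorem exists_measurable_version {Ω : Type*} [MeasurableSpace Ω] {w : ℝ → Ω → ℝ} {T : ℝ}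
    (hT : 0 ≤ T) (hw : ∀ s ∈ Icc 0 T, Measurable (w s)) :
    ∃ v : ℝ → Ω → ℝ, Measurable (fun z : Ω × ℝ => v z.2 z.1) ∧
      ∀ ω, ContinuousOn (fun s => w s ω) (Icc 0 T) → ∀ s ∈ Icc 0 T, v s ω = w s ω := by
  obtain ⟨g, hg'⟩ : ∃ g : ℕ → ℤ → ℝ, ∀ N k, g N k = projIcc 0 T hT (k / (N + 1)) :=
    ⟨_, fun _ _ => rfl⟩
  have hg : ∀ N k, g N k ∈ Icc 0 T := fun N k => hg' N k ▸ (projIcc 0 T hT _).2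
  refine ⟨fun s ω => limsup (fun N : ℕ => w (g N ⌊s * (N + 1)⌋) ω) atTop, ?_, fun ω hω s hs => ?_⟩
  · refine Measurable.limsup (f := fun (N : ℕ) (z : Ω × ℝ) => w (g N ⌊z.2 * (N + 1)⌋) z.1)
      fun N => ?_
    have h1 : Measurable fun z : Ω × ℤ => w (g N z.2) z.1 :=
      measurable_from_prod_countable_left fun k => hw _ (hg N k)
    have h2 : Measurable fun z : Ω × ℝ => (z.1, ⌊z.2 * ((N : ℝ) + 1)⌋) :=
      measurable_fst.prodMk (Int.measurable_floor.comp (by fun_prop))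
    exact h1.comp h2
  · refine Tendsto.limsup_eq ?_
    have h1 : Tendsto (fun N : ℕ => ((⌊s * ((N : ℝ) + 1)⌋ : ℤ) : ℝ) / ((N : ℝ) + 1)) atTop
        (nhds s) := by
      have h2 : Tendsto (fun N : ℕ => (N : ℝ) + 1) atTop atTop :=
        tendsto_natCast_atTop_atTop.atTop_add tendsto_const_nhds
      refine tendsto_of_tendsto_of_tendsto_of_le_of_le (g := fun N : ℕ => s - 1 / ((N : ℝ) + 1))
        (h := fun _ => s) ?_ tendsto_const_nhds (fun N => ?_) fun N => ?_
      · simpa using tendsto_const_nhds.sub (tendsto_const_nhds (x := (1 : ℝ)).div_atTop h2)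
      · have hN : (0 : ℝ) < (N : ℝ) + 1 := by positivity
        change s - 1 / ((N : ℝ) + 1) ≤ _
        rw [le_div_iff₀ hN, sub_mul, one_div, inv_mul_cancel₀ hN.ne']
        exact (Int.sub_one_lt_floor _).le
      · have hN : (0 : ℝ) < (N : ℝ) + 1 := by positivity
        change _ / _ ≤ s
        rw [div_le_iff₀ hN]
        exact Int.floor_le _
    have h3 : Tendsto (fun N : ℕ => g N ⌊s * ((N : ℝ) + 1)⌋) atTop (nhdsWithin s (Icc 0 T)) := by
      refine tendsto_nhdsWithin_iff.2 ⟨?_, Eventually.of_forall fun N => hg _ _⟩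
      have h4 := ((continuous_subtype_val.comp (continuous_projIcc (h := hT))).tendsto s).comp h1
      simpa [projIcc_of_mem hT hs, Function.comp_def, hg'] using h4
    exact (hω s hs).tendsto.comp h3

theorem exists_measurable_affine_version {Ω ι : Type*} [MeasurableSpace Ω] [Finite ι]
    {w : ι → ℝ → Ω → ℝ} {T : ℝ} (hT : 0 ≤ T) (hw : ∀ i, ∀ s ∈ Icc 0 T, Measurable (w i s)) (κ : ℝ)
    (a : ι → ℝ) :
    ∃ v : ℝ → Ω → ι → ℝ, Measurable (fun z : Ω × ℝ => v z.2 z.1) ∧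
      ∀ ω, (∀ i, ContinuousOn (fun s => w i s ω) (Icc 0 T)) → ∀ s ∈ Icc 0 T,
        v s ω = fun i => κ * w i s ω + a i := by
  choose v hv hvw using fun i => exists_measurable_version hT (hw i)
  refine ⟨fun s ω i => κ * v i s ω + a i,
    measurable_pi_lambda _ fun i => ((hv i).const_mul κ).add_const _, fun ω hω s hs => ?_⟩
  funext i
  simp only [hvw i ω (hω i) s hs]

end MeasurableVersion

/-! ### Density of the cylindrical random variables -/

section Uniqueness

variable {Ω : Type*} [MeasurableSpace Ω] {P : Measure Ω} [IsProbabilityMeasure P]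

/-- The conditional expectation of `D` given `U` is `e(U)` for some function `e`, and `e` vanishes
almost everywhere for the law of `U`, having zero integral against all test functions. -/
theorem setIntegral_preimage_eq_zero {m : ℕ} {U : Ω → Fin m → ℝ} (hU : Measurable U) {D : Ω → ℝ}
    (hD : Integrable D P)
    (h : ∀ g : (Fin m → ℝ) → ℝ, ContDiff ℝ (⊤ : ℕ∞) g → HasCompactSupport g →
      ∫ ω, g (U ω) * D ω ∂P = 0) {B : Set (Fin m → ℝ)} (hB : MeasurableSet B) :
    ∫ ω in U ⁻¹' B, D ω ∂P = 0 := by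
  have hm : MeasurableSpace.comap U inferInstance ≤ (inferInstance : MeasurableSpace Ω) :=
    hU.comap_le
  obtain ⟨e, he, heq⟩ := (stronglyMeasurable_condExp (m := MeasurableSpace.comap U inferInstance)
    (μ := P) (f := D)).measurable.exists_eq_measurable_comp
  have hint : Integrable (e ∘ U) P := heq ▸ integrable_condExp
  have hint' : Integrable e (P.map U) :=
    (integrable_map_measure he.aestronglyMeasurable hU.aemeasurable).2 hint
  have h0 : ∀ᵐ x ∂(P.map U), e x = 0 := by
    refine ae_eq_zero_of_integral_contDiff_smul_eq_zero hint'.locallyIntegrable fun g hg hgc => ?_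
    rw [integral_map hU.aemeasurable
      (by exact hg.continuous.aestronglyMeasurable.smul he.aestronglyMeasurable), ← h g hg hgc,
      ← integral_condExp hm (f := fun ω => g (U ω) * D ω)]
    obtain ⟨C, hC⟩ := hg.continuous.bounded_above_of_compact_support hgc
    refine integral_congr_ae ?_
    have hgm : StronglyMeasurable[MeasurableSpace.comap U inferInstance] (fun ω => g (U ω)) :=
      (hg.continuous.measurable.comp (comap_measurable U)).stronglyMeasurable
    have hpull := condExp_stronglyMeasurable_mul_of_bound hm (μ := P) hgm hD C
      (Eventually.of_forall fun ω => hC (U ω))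
    filter_upwards [hpull] with ω hω
    have : (fun ω => g (U ω) * D ω) = (fun ω => g (U ω)) * D := rfl
    rw [this, hω, heq]
    rfl
  rw [← setIntegral_condExp hm hD ⟨B, hB, rfl⟩, heq]
  have h1 : ∀ᵐ ω ∂P, (e ∘ U) ω = 0 := ae_of_ae_map hU.aemeasurable h0
  rw [setIntegral_congr_ae (g := fun _ => (0 : ℝ)) (hU hB) (h1.mono fun ω hω _ => hω)]
  simp

/-- A random variable measurable with respect to the paths and orthogonal to all cylindrical
random variables vanishes. -/
theorem ae_eq_zero_of_forall_cylinder {ι : Type*} [Fintype ι] {W : ι → ℝ → Ω → ℝ} {T : ℝ}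
    (hW : ∀ i, ∀ s ∈ Icc 0 T, Measurable (W i s)) {D : Ω → ℝ} (hD : Integrable D P)
    (hDm : AEStronglyMeasurable[pathSigma W T] D P)
    (h : ∀ F : Cylinder ι T, ∫ ω, F.eval W ω * D ω ∂P = 0) : D =ᵐ[P] 0 := by
  classical
  have hle : pathSigma W T ≤ (inferInstance : MeasurableSpace Ω) :=
    iSup_le fun i => iSup_le fun s => (hW i s s.2).comap_le
  have hfin : ∀ (m : ℕ) (k : Fin m → ι × Icc (0 : ℝ) T) (B : Set (Fin m → ℝ)), MeasurableSet B →
      ∫ ω in (fun ω l => W (k l).1 (k l).2 ω) ⁻¹' B, D ω ∂P = 0 := by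
    intro m k B hB
    refine setIntegral_preimage_eq_zero (measurable_pi_lambda _ fun l => hW _ _ (k l).2.2) hD
      (fun g hg hgc => ?_) hB
    refine Eq.trans ?_
      (h ⟨m, g, hg, hgc, fun l i => if i = (k l).1 then Finsupp.single (k l).2 1 else 0⟩)
    refine integral_congr_ae (Eventually.of_forall fun ω => ?_)
    have : ∀ l, gaussianInt W (fun i => if i = (k l).1 then Finsupp.single (k l).2 1 else 0) ω =
        W (k l).1 (k l).2 ω := fun l => by
      rw [gaussianInt, Finset.sum_eq_single (k l).1]
      · simp
      · intro i _ hi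
        simp [hi]
      · simp
    simp only [Cylinder.eval, this]
  -- the events depending on finitely many times form a `π`-system generating the `σ`-algebra
  have hall : ∀ s, MeasurableSet[pathSigma W T] s → ∫ ω in s, D ω ∂P = 0 := by
    let m : ι × Icc (0 : ℝ) T → MeasurableSpace Ω := fun k =>
      MeasurableSpace.comap (W k.1 k.2) inferInstance
    have hgen : pathSigma W T =
        MeasurableSpace.generateFrom (piiUnionInter (fun k => {s | MeasurableSet[m k] s}) univ) := by
      rw [generateFrom_piiUnionInter_measurableSet m univ]
      simp only [mem_univ, iSup_pos, iSup_prod, m]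
    refine MeasurableSpace.induction_on_inter hgen (isPiSystem_piiUnionInter _
      (fun k => @MeasurableSpace.isPiSystem_measurableSet _ (m k)) _) ?_ ?_ ?_ ?_
    · simp
    · rintro s ⟨K, -, B, hB, rfl⟩
      choose! B' hB' hBB' using hB
      have := hfin K.card (fun l => (K.equivFin.symm l : ι × Icc (0 : ℝ) T))
        {x | ∀ l, x l ∈ B' (K.equivFin.symm l)} (by
          rw [Set.ofPred_forall]
          exact MeasurableSet.iInter fun l => measurable_pi_apply l
            (hB' _ (K.equivFin.symm l).2))
      convert this using 3
      ext ω
      simp only [mem_iInter, mem_preimage, mem_ofPred_eq]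
      constructor
      · intro hω l
        have := hω _ (K.equivFin.symm l).2
        rwa [← hBB' _ (K.equivFin.symm l).2] at this
      · intro hω k hk
        rw [← hBB' k hk]
        have := hω (K.equivFin ⟨k, hk⟩)
        simpa using this
    · intro s hs hs0
      have huniv : ∫ ω, D ω ∂P = 0 := by
        simpa using hfin 0 (fun l => l.elim0) univ MeasurableSet.univ
      have := integral_add_compl (hle s hs) hD
      rw [hs0, huniv] at this
      linarith
    · intro f hf hfm hf0
      rw [integral_iUnion (fun i => hle _ (hfm i)) hf hD.integrableOn]
      simp [hf0]
  have := ae_eq_condExp_of_forall_setIntegral_eq (μ := P) hle (integrable_zero Ω ℝ P) (g := D)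
    (fun s _ _ => hD.integrableOn) (fun s hs _ => by rw [hall s hs]; simp) hDm
  refine this.trans ?_
  rw [condExp_zero]

end Uniqueness

/-! ### Expectations of time integrals -/

section Measurability

variable {n : ℕ}

theorem measurable_derivQuotient {f : ℝ → ℝ} (hf : MemCb 2 f) :
    Measurable fun z : ℝ × ℝ => derivQuotient f z.1 z.2 := by
  have h1 : Measurable (deriv f) := hf.contDiff_deriv.continuous.measurable
  have h2 : Measurable (deriv (deriv f)) := hf.continuous_deriv_deriv.measurable
  unfold derivQuotient
  refine Measurable.ite (measurableSet_eq_fun measurable_fst measurable_snd) (by fun_prop) ?_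
  fun_prop

theorem continuous_eigFun (n : ℕ) (i : Fin n) : Continuous (eigFun n i) :=
  (eigFun_lipschitz n i).continuous

theorem measurable_eigFunPartial (n : ℕ) (i : Fin n) (q : UpperPair n) :
    Measurable (eigFunPartial n i q) :=
  measurable_fderiv_apply_const ℝ _ _

theorem measurable_statGrad {f : ℝ → ℝ} (hf : MemCb 2 f) (q : UpperPair n) :
    Measurable (statGrad n f q) := by
  unfold statGrad
  refine Finset.measurable_sum _ fun i _ => ?_
  exact (hf.contDiff_deriv.continuous.measurable.comp (continuous_eigFun n i).measurable).mul
    (measurable_eigFunPartial n i q)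

theorem measurable_statLap {f : ℝ → ℝ} (hf : MemCb 2 f) : Measurable (statLap n f) := by
  unfold statLap
  refine Measurable.add (Finset.measurable_sum _ fun i _ => ?_)
    (Finset.measurable_sum _ fun i _ => Finset.measurable_sum _ fun j _ => ?_)
  · exact hf.continuous_deriv_deriv.measurable.comp (continuous_eigFun n i).measurable
  · exact (measurable_derivQuotient hf).comp
      ((continuous_eigFun n i).measurable.prodMk (continuous_eigFun n j).measurable)

end Measurability

section TimeIntegrals

theorem IntervalIntegrable.fun_sum {ι : Type*} {s : Finset ι} {f : ι → ℝ → ℝ} {μ : Measure ℝ}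
    {a b : ℝ} (h : ∀ i ∈ s, IntervalIntegrable (f i) μ a b) :
    IntervalIntegrable (fun x => ∑ i ∈ s, f i x) μ a b := by
  simpa only [Finset.sum_fn] using IntervalIntegrable.sum s h

variable {Ω : Type*} [MeasurableSpace Ω] {P : Measure Ω} [IsProbabilityMeasure P]

theorem integrable_prod_mul_of_bounded {c : ℝ → ℝ} {ψ : ℝ → Ω → ℝ} {C t : ℝ} (ht : 0 ≤ t)
    (hc : IntervalIntegrable c volume 0 t) (hψ : Measurable fun z : Ω × ℝ => ψ z.2 z.1)
    (hψC : ∀ s ω, |ψ s ω| ≤ C) :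
    Integrable (fun z : Ω × ℝ => c z.2 * ψ z.2 z.1) (P.prod (volume.restrict (Ioc 0 t))) := by
  have h1 : Integrable (fun z : Ω × ℝ => c z.2) (P.prod (volume.restrict (Ioc 0 t))) :=
    ((intervalIntegrable_iff_integrableOn_Ioc_of_le ht).1 hc).comp_snd P
  exact h1.mul_bdd (c := C) hψ.aestronglyMeasurable (Eventually.of_forall fun z => hψC _ _)

theorem abs_integral_mul_le_of_bounded {c ψ : ℝ → ℝ} {C t : ℝ} (ht : 0 ≤ t)
    (hc : IntervalIntegrable c volume 0 t) (hψC : ∀ s, |ψ s| ≤ C) :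
    |∫ s in (0 : ℝ)..t, c s * ψ s| ≤ (∫ s in (0 : ℝ)..t, |c s|) * C := by
  rw [← intervalIntegral.integral_mul_const]
  rw [← Real.norm_eq_abs]
  refine intervalIntegral.norm_integral_le_of_norm_le ht (Eventually.of_forall fun s _ => ?_)
    (hc.abs.mul_const C)
  rw [norm_mul]
  exact mul_le_mul_of_nonneg_left (hψC s) (abs_nonneg _)

theorem measurable_integral_mul {Ω : Type*} [MeasurableSpace Ω] {c : ℝ → ℝ} {ψ : ℝ → Ω → ℝ} {t : ℝ}
    (ht : 0 ≤ t) (hc : IntervalIntegrable c volume 0 t)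
    (hψ : Measurable fun z : Ω × ℝ => ψ z.2 z.1) :
    Measurable fun ω => ∫ s in (0 : ℝ)..t, c s * ψ s ω := by
  obtain ⟨c', hc', hcc'⟩ := hc.1.aestronglyMeasurable
  have h1 : ∀ ω, ∫ s in (0 : ℝ)..t, c s * ψ s ω = ∫ s in Ioc 0 t, c' s * ψ s ω := fun ω => by
    rw [intervalIntegral.integral_of_le ht]
    exact integral_congr_ae (hcc'.mono fun s hs => by simp only [hs])
  simp only [h1]
  have h2 : Measurable fun z : Ω × ℝ => c' z.2 * ψ z.2 z.1 :=
    (hc'.measurable.comp measurable_snd).mul hψ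
  exact h2.stronglyMeasurable.integral_prod_right'.measurable

theorem integral_mul_integral_comm {c : ℝ → ℝ} {ψ : ℝ → Ω → ℝ} {B : Ω → ℝ} {C K t : ℝ}
    (ht : 0 ≤ t) (hc : IntervalIntegrable c volume 0 t)
    (hψ : Measurable fun z : Ω × ℝ => ψ z.2 z.1) (hψC : ∀ s ω, |ψ s ω| ≤ C)
    (hB : Measurable B) (hBK : ∀ ω, |B ω| ≤ K) :
    ∫ s in (0 : ℝ)..t, c s * ∫ ω, B ω * ψ s ω ∂P =
      ∫ ω, B ω * (∫ s in (0 : ℝ)..t, c s * ψ s ω) ∂P := by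
  have hint := (integrable_prod_mul_of_bounded (P := P) ht hc hψ hψC).bdd_mul (c := K)
    (f := fun z : Ω × ℝ => B z.1) (hB.comp measurable_fst).aestronglyMeasurable
    (Eventually.of_forall fun z => hBK _)
  simp only [intervalIntegral.integral_of_le ht, ← integral_const_mul]
  rw [integral_integral_swap]
  · refine integral_congr_ae (Eventually.of_forall fun s => integral_congr_ae
      (Eventually.of_forall fun ω => ?_))
    simp only
    ring
  · refine hint.swap.congr (Eventually.of_forall fun z => ?_)
    simp only [Function.comp_apply, Prod.fst_swap, Prod.snd_swap, Function.uncurry]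
    ring

theorem intervalIntegrable_mul_integral {c : ℝ → ℝ} {ψ : ℝ → Ω → ℝ} {B : Ω → ℝ} {C K t : ℝ}
    (ht : 0 ≤ t) (hc : IntervalIntegrable c volume 0 t)
    (hψ : Measurable fun z : Ω × ℝ => ψ z.2 z.1) (hψC : ∀ s ω, |ψ s ω| ≤ C)
    (hB : Measurable B) (hBK : ∀ ω, |B ω| ≤ K) :
    IntervalIntegrable (fun s => c s * ∫ ω, B ω * ψ s ω ∂P) volume 0 t := by
  have hint := (integrable_prod_mul_of_bounded (P := P) ht hc hψ hψC).bdd_mul (c := K)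
    (f := fun z : Ω × ℝ => B z.1) (hB.comp measurable_fst).aestronglyMeasurable
    (Eventually.of_forall fun z => hBK _)
  rw [intervalIntegrable_iff_integrableOn_Ioc_of_le ht]
  refine hint.integral_prod_right.congr (Eventually.of_forall fun s => ?_)
  simp only [← integral_const_mul]
  refine integral_congr_ae (Eventually.of_forall fun ω => ?_)
  simp only
  ring

theorem tendsto_integral_mul_integral {c : ℝ → ℝ} {ψ : ℕ → ℝ → Ω → ℝ} {φ : ℝ → Ω → ℝ} {B : Ω → ℝ}
    {C K t : ℝ} (ht : 0 ≤ t) (hc : IntervalIntegrable c volume 0 t)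
    (hψ : ∀ N, Measurable fun z : Ω × ℝ => ψ N z.2 z.1)
    (hψC : ∀ᵐ s, s ∈ Icc 0 t → ∀ᵐ ω ∂P, ∀ N, |ψ N s ω| ≤ C)
    (hlim : ∀ᵐ s, s ∈ Icc 0 t → ∀ᵐ ω ∂P, Tendsto (fun N => ψ N s ω) atTop (nhds (φ s ω)))
    (hB : Measurable B) (hBK : ∀ ω, |B ω| ≤ K) (hK : 0 ≤ K) :
    Tendsto (fun N => ∫ s in (0 : ℝ)..t, c s * ∫ ω, B ω * ψ N s ω ∂P) atTop
      (nhds (∫ s in (0 : ℝ)..t, c s * ∫ ω, B ω * φ s ω ∂P)) := by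
  have hIoc : uIoc 0 t ⊆ Icc 0 t := by
    rw [uIoc_of_le ht]
    exact Ioc_subset_Icc_self
  have hψm : ∀ N s, Measurable (ψ N s) := fun N s => (hψ N).comp measurable_prodMk_right
  refine intervalIntegral.tendsto_integral_filter_of_dominated_convergence
    (fun s => |c s| * (K * C)) (Eventually.of_forall fun N => ?_) (Eventually.of_forall fun N => ?_)
    (hc.abs.mul_const _) ?_
  · refine AEStronglyMeasurable.mul ?_ ?_
    · rw [uIoc_of_le ht]
      exact hc.1.aestronglyMeasurable
    · have h1 : Measurable fun z : Ω × ℝ => B z.1 * ψ N z.2 z.1 :=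
        (hB.comp measurable_fst).mul (hψ N)
      exact (h1.stronglyMeasurable.integral_prod_left' (μ := P)).aestronglyMeasurable
  · filter_upwards [hψC] with s hs hst
    rw [Real.norm_eq_abs, abs_mul]
    refine mul_le_mul_of_nonneg_left ?_ (abs_nonneg _)
    have := norm_integral_le_of_norm_le_const (μ := P) (f := fun ω => B ω * ψ N s ω) (C := K * C)
      (by
        filter_upwards [hs (hIoc hst)] with ω hω
        rw [Real.norm_eq_abs, abs_mul]
        exact mul_le_mul (hBK ω) (hω N) (abs_nonneg _) hK)
    simpa using this
  · filter_upwards [hψC, hlim] with s hs hl hst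
    refine Tendsto.const_mul _ ?_
    refine tendsto_integral_of_dominated_convergence (fun _ => K * C)
      (fun N => (hB.mul (hψm N s)).aestronglyMeasurable) (integrable_const _) (fun N => ?_) ?_
    · filter_upwards [hs (hIoc hst)] with ω hω
      rw [Real.norm_eq_abs, abs_mul]
      exact mul_le_mul (hBK ω) (hω N) (abs_nonneg _) hK
    · filter_upwards [hl (hIoc hst)] with ω hω
      exact hω.const_mul _

end TimeIntegrals

/-! ### The pairing with step functions and the marginals of the matrix process -/

section Divergence

variable {Ω ι : Type*} [Fintype ι]

theorem measurable_gaussianInt [MeasurableSpace Ω] {W : ι → ℝ → Ω → ℝ} {T : ℝ}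
    (hW : ∀ i, ∀ s ∈ Icc 0 T, Measurable (W i s)) (h : ι → StepFun T) :
    Measurable (gaussianInt W h) := by
  unfold gaussianInt Finsupp.sum
  exact Finset.measurable_sum _ fun i _ => Finset.measurable_sum _ fun τ _ =>
    (hW i τ τ.2).const_mul _

/-- The density of `s ↦ ⟨ψ, 1_{[0,s]}⟩`. -/
def stepDeriv (R : ℝ → ℝ → ℝ) {T : ℝ} (ψ : StepFun T) (s : ℝ) : ℝ :=
  ψ.sum fun τ c => c * deriv (fun r => R r (τ : ℝ)) s

variable {R : ℝ → ℝ → ℝ} {T t : ℝ}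

theorem CovarianceH1.intervalIntegrable_deriv (hR : CovarianceH1 R) (hT : 0 < T)
    (ht : t ∈ Icc 0 T) (τ : Icc (0 : ℝ) T) :
    IntervalIntegrable (deriv fun r => R r (τ : ℝ)) volume 0 t := by
  refine ((hR.absolutelyContinuous T hT τ τ.2).mono ?_).intervalIntegrable_deriv
  rw [uIcc_of_le ht.1, uIcc_of_le hT.le]
  exact Icc_subset_Icc_right ht.2

theorem CovarianceH1.intervalIntegrable_stepDeriv (hR : CovarianceH1 R) (hT : 0 < T)
    (ht : t ∈ Icc 0 T) (ψ : StepFun T) : IntervalIntegrable (stepDeriv R ψ) volume 0 t := by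
  have : stepDeriv R ψ =
      ∑ τ ∈ ψ.support, fun s => ψ τ * deriv (fun r => R r (τ : ℝ)) s := by
    ext s
    simp [stepDeriv, Finsupp.sum]
  rw [this]
  exact IntervalIntegrable.sum _ fun τ _ => (hR.intervalIntegrable_deriv hT ht τ).const_mul _

/-- `⟨ψ, φ 1_{[0,t]}⟩` as an integral over `[0, t]`. -/
theorem CovarianceH1.extInner_indicator (hR : CovarianceH1 R) (hT : 0 < T) (ht : t ∈ Icc 0 T)
    (ψ : StepFun T) {φ : ℝ → ℝ} {C : ℝ} (hφ : Measurable φ) (hφC : ∀ s, |φ s| ≤ C) :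
    extInner R ψ ((Icc 0 t).indicator φ) = ∫ s in (0 : ℝ)..t, stepDeriv R ψ s * φ s := by
  have h1 : ∀ τ : Icc (0 : ℝ) T, IntervalIntegrable
      (fun s => ψ τ * deriv (fun r => R r (τ : ℝ)) s * φ s) volume 0 t := fun τ => by
    have := (hR.intervalIntegrable_deriv hT ht τ).const_mul (ψ τ)
    rw [intervalIntegrable_iff] at this ⊢
    exact this.mul_bdd (c := C) hφ.aestronglyMeasurable (Eventually.of_forall fun s => hφC s)
  simp only [stepDeriv, extInner, Finsupp.sum, Finset.sum_mul]
  rw [intervalIntegral.integral_finsetSum fun τ _ => h1 τ]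
  refine Finset.sum_congr rfl fun τ _ => ?_
  simp only [mul_assoc, intervalIntegral.integral_const_mul]
  congr 1
  rw [intervalIntegral.integral_of_le hT.le, intervalIntegral.integral_of_le ht.1,
    ← integral_Icc_eq_integral_Ioc, ← integral_Icc_eq_integral_Ioc]
  have h2 : ∀ s, (Icc 0 t).indicator φ s * deriv (fun r => R r (τ : ℝ)) s =
      (Icc 0 t).indicator (fun s => deriv (fun r => R r (τ : ℝ)) s * φ s) s := fun s => by
    by_cases hs : s ∈ Icc 0 t <;> simp [hs, mul_comm]
  simp only [h2]
  rw [setIntegral_indicator measurableSet_Icc, inter_eq_right.2 (Icc_subset_Icc_right ht.2)]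

end Divergence

section AffineImage

variable {Ω : Type*} [MeasurableSpace Ω] {P : Measure Ω} [IsProbabilityMeasure P]
  {ι : Type*} [Fintype ι] {W : ι → ℝ → Ω → ℝ} {R : ℝ → ℝ → ℝ} {κ : ℝ} {a : ι → ℝ}

namespace IndepGaussianProcesses

/-- The law of `κ W_s + a` does not charge Lebesgue-null sets. -/
theorem ae_affine_mem (hW : IndepGaussianProcesses P W R) {s : ℝ} (hs : 0 ≤ s) (h : 0 < R s s)
    (hκ : κ ≠ 0) {G : Set (ι → ℝ)} (hG : volume Gᶜ = 0) :
    ∀ᵐ ω ∂P, (fun q => κ * W q s ω + a q) ∈ G := by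
  have h1 : volume ((fun x : ι → ℝ => κ • x) ⁻¹' ((fun x => x + a) ⁻¹' Gᶜ)) = 0 := by
    rw [MeasureTheory.Measure.addHaar_preimage_smul _ hκ,
      (measurePreserving_add_right volume a).quasiMeasurePreserving.preimage_null hG, mul_zero]
  have h2 := hW.map_absolutelyContinuous hs h h1
  have h3 := ae_of_ae_map (μ := P) (f := fun ω i => W i s ω)
    (measurable_pi_lambda _ fun i => hW.measurable i s hs).aemeasurable
    (p := fun x => x ∉ (fun x : ι → ℝ => κ • x) ⁻¹' ((fun x => x + a) ⁻¹' Gᶜ))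
    (measure_eq_zero_iff_ae_notMem.1 h2)
  filter_upwards [h3] with ω hω
  simpa [mem_preimage, Pi.add_def, Pi.smul_def] using hω

theorem memLp_affine (hW : IndepGaussianProcesses P W R) {s : ℝ} (hs : 0 ≤ s) :
    MemLp (fun ω q => κ * W q s ω + a q) 2 P :=
  MemLp.of_eval fun q => ((hW.memLp_two q hs).const_mul κ).add (memLp_const (a q))

end IndepGaussianProcesses

end AffineImage

section LinearGrowth

variable {n : ℕ}

theorem continuous_sum_comp_eigFun {f : ℝ → ℝ} (hf : MemCb 2 f) :
    Continuous fun y : UpperPair n → ℝ => ∑ i, f (eigFun n i y) :=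
  continuous_finsetSum _ fun i _ => hf.contDiff.continuous.comp (continuous_eigFun n i)

/-- Linear growth of `∑_i f(Φ_i)`, read off from the approximating functions. -/
theorem exists_abs_sum_comp_eigFun_le {f : ℝ → ℝ} (hf : MemCb 2 f) (n : ℕ) :
    ∃ C, 0 ≤ C ∧ ∀ y : UpperPair n → ℝ, |∑ i, f (eigFun n i y)| ≤ C * (1 + ‖y‖) := by
  obtain ⟨G, hG⟩ := exists_isRegularSet n
  obtain ⟨g, C, hC, -, -, hg, hlim, -⟩ := exists_smooth_approximation hf hG
  exact ⟨C, hC, fun y => le_of_tendsto (hlim y).abs (Eventually.of_forall fun N => hg N y)⟩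

end LinearGrowth

/-! ### The Itô formula tested against cylindrical random variables -/

section Duality

variable {Ω : Type*} [MeasurableSpace Ω] {P : Measure Ω} [IsProbabilityMeasure P] {n : ℕ}
  {W : UpperPair n → ℝ → Ω → ℝ} {R : ℝ → ℝ → ℝ} {T t κ : ℝ} {a : UpperPair n → ℝ}
  {V : ℝ → Ω → UpperPair n → ℝ}

/-- The Itô formula for a smooth compactly supported function of `κ W + a`, tested against a
cylindrical random variable. -/
theorem integral_cylinder_mul_sub [Nonempty (UpperPair n)] (hW : IndepGaussianProcesses P W R)
    (hR : CovarianceH1 R) (hT : 0 < T) (ht : t ∈ Icc 0 T)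
    (hV : Measurable fun z : Ω × ℝ => V z.2 z.1)
    (hVW : ∀ s ∈ Icc 0 T, ∀ᵐ ω ∂P, V s ω = fun q => κ * W q s ω + a q)
    (F : Cylinder (UpperPair n) T) {g : (UpperPair n → ℝ) → ℝ} (hg : ContDiff ℝ (⊤ : ℕ∞) g)
    (hgc : HasCompactSupport g) :
    (∫ ω, F.eval W ω * g (V t ω) ∂P) - ∫ ω, F.eval W ω * g (V 0 ω) ∂P =
      (∑ j, ∑ q, ∫ s in (0 : ℝ)..t, κ * stepDeriv R (F.h j q) s *
        ∫ ω, fderiv ℝ F.g (fun l => gaussianInt W (F.h l) ω) (Pi.single j 1) *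
          fderiv ℝ g (V s ω) (Pi.single q 1) ∂P) +
      ∫ s in (0 : ℝ)..t, κ ^ 2 * deriv (fun r => R r r) s / 2 *
        ∫ ω, F.eval W ω * ∑ q, fderiv ℝ (fun z => fderiv ℝ g z (Pi.single q 1)) (V s ω)
          (Pi.single q 1) ∂P := by
  have hWm : ∀ q, ∀ s ∈ Icc 0 T, Measurable (W q s) := fun q s hs => hW.measurable q s hs.1
  have hU : Measurable fun ω l => gaussianInt W (F.h l) ω :=
    measurable_pi_lambda _ fun l => measurable_gaussianInt hWm (F.h l)
  have hsub : ∀ {s}, s ∈ Icc 0 t → s ∈ Icc 0 T := fun hs => ⟨hs.1, hs.2.trans ht.2⟩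
  have hc : ∀ j q, IntervalIntegrable (fun s => κ * stepDeriv R (F.h j q) s) volume 0 t :=
    fun j q => (hR.intervalIntegrable_stepDeriv hT ht _).const_mul κ
  have hr0 : IntervalIntegrable (deriv fun r => R r r) volume 0 t := by
    refine (hR.intervalIntegrable_deriv_diag hT).mono_set ?_
    rw [uIcc_of_le ht.1, uIcc_of_le hT.le]
    exact Icc_subset_Icc_right ht.2
  have hr : IntervalIntegrable (fun s => κ ^ 2 * deriv (fun r => R r r) s) volume 0 t :=
    hr0.const_mul _
  have hF1 := fun j => contDiff_fderiv_apply F.smooth (Pi.single j (1 : ℝ))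
  have hg1 := fun q => contDiff_fderiv_apply hg (Pi.single q (1 : ℝ))
  have hg2 := fun q => contDiff_fderiv_apply (hg1 q) (Pi.single q (1 : ℝ))
  have hgc1 := fun q : UpperPair n => hgc.fderiv_apply ℝ (Pi.single q (1 : ℝ))
  have hgc2 := fun q : UpperPair n => (hgc1 q).fderiv_apply ℝ (Pi.single q (1 : ℝ))
  obtain ⟨B, hB⟩ := F.smooth.continuous.bounded_above_of_compact_support F.compact
  choose B1 hB1 using fun j => (hF1 j).continuous.bounded_above_of_compact_support
    (F.compact.fderiv_apply ℝ (Pi.single j (1 : ℝ)))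
  choose C1 hC1 using fun q => (hg1 q).continuous.bounded_above_of_compact_support (hgc1 q)
  choose C2 hC2 using fun q => (hg2 q).continuous.bounded_above_of_compact_support (hgc2 q)
  have key := integral_mul_evolution (P := P) hU hV (t := t)
    (fun j q s => κ * stepDeriv R (F.h j q) s) (fun s => κ ^ 2 * deriv (fun r => R r r) s) hc hr
    (fun η ξ => ?_) F.g F.smooth F.compact g hg hgc
  · change (∫ ω, F.g (fun l => gaussianInt W (F.h l) ω) * g (V t ω) ∂P) -
      ∫ ω, F.g (fun l => gaussianInt W (F.h l) ω) * g (V 0 ω) ∂P = _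
    rw [key]
    have hint1 : ∀ j q, IntervalIntegrable (fun s => κ * stepDeriv R (F.h j q) s *
        ∫ ω, fderiv ℝ F.g (fun l => gaussianInt W (F.h l) ω) (Pi.single j 1) *
          fderiv ℝ g (V s ω) (Pi.single q 1) ∂P) volume 0 t := fun j q =>
      intervalIntegrable_mul_integral ht.1 (hc j q)
        (ψ := fun s ω => fderiv ℝ g (V s ω) (Pi.single q 1))
        ((hg1 q).continuous.measurable.comp hV) (fun s ω => hC1 q _)
        ((hF1 j).continuous.measurable.comp hU) (fun ω => hB1 j _)
    have hint2 : ∀ q, IntervalIntegrable (fun s => κ ^ 2 * deriv (fun r => R r r) s / 2 *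
        ∫ ω, F.g (fun l => gaussianInt W (F.h l) ω) *
          fderiv ℝ (fun z => fderiv ℝ g z (Pi.single q 1)) (V s ω) (Pi.single q 1) ∂P)
        volume 0 t := fun q =>
      intervalIntegrable_mul_integral ht.1 (hr.div_const 2)
        (ψ := fun s ω => fderiv ℝ (fun z => fderiv ℝ g z (Pi.single q 1)) (V s ω)
          (Pi.single q 1))
        ((hg2 q).continuous.measurable.comp hV) (fun s ω => hC2 q _)
        (F.smooth.continuous.measurable.comp hU) (fun ω => hB _)
    rw [intervalIntegral.integral_add]
    · congr 1
      · rw [intervalIntegral.integral_finsetSum fun j _ => ?_]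
        · refine Finset.sum_congr rfl fun j _ => ?_
          rw [intervalIntegral.integral_finsetSum fun q _ => hint1 j q]
        · exact IntervalIntegrable.fun_sum fun q _ => hint1 j q
      · refine intervalIntegral.integral_congr fun s _ => ?_
        simp only [Finset.mul_sum]
        rw [integral_finsetSum]
        · simp only [Finset.mul_sum]
          rfl
        · intro q _
          refine Integrable.of_bound (C := B * C2 q) ?_ (Eventually.of_forall fun ω => ?_)
          · exact ((F.smooth.continuous.measurable.comp hU).mul
              ((hg2 q).continuous.measurable.comp
                (hV.comp measurable_prodMk_right))).aestronglyMeasurable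
          · rw [norm_mul]
            exact mul_le_mul (hB _) (hC2 q _) (norm_nonneg _) ((norm_nonneg _).trans (hB 0))
    · exact IntervalIntegrable.fun_sum fun j _ => IntervalIntegrable.fun_sum fun q _ => hint1 j q
    · exact IntervalIntegrable.fun_sum fun q _ => hint2 q
  · have hE : ∀ s ∈ Icc 0 t, ∫ ω, Complex.exp (↑(∑ j, η j * gaussianInt W (F.h j) ω +
        ∑ q, ξ q * V s ω q) * Complex.I) ∂P = ∫ ω, Complex.exp (↑(∑ j, η j *
        gaussianInt W (F.h j) ω + ∑ q, ξ q * (κ * W q s ω + a q)) * Complex.I) ∂P :=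
      fun s hs => integral_congr_ae <| by
        filter_upwards [hVW s (hsub hs)] with ω hω
        rw [hω]
    rw [hE t ⟨ht.1, le_rfl⟩, hE 0 ⟨le_rfl, ht.1⟩, hW.charFun_evolution hR hT F.h κ a ht η ξ]
    refine intervalIntegral.integral_congr fun s hs => ?_
    rw [uIcc_of_le ht.1] at hs
    simp only [hE s hs]
    rfl

/-- The Itô formula for `∑_i f(Φ_i)`, tested against a cylindrical random variable: the limit of the
formulas for smooth approximations. Their gradients are controlled only on `G`, which suffices
because the variance is positive at almost every time, so that `V_s ∈ G` almost surely. -/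
theorem integral_cylinder_mul_statistic [Nonempty (UpperPair n)]
    (hW : IndepGaussianProcesses P W R)
    (hR : CovarianceH1 R) (hT : 0 < T) (ht : t ∈ Icc 0 T) (hκ : κ ≠ 0)
    (hV : Measurable fun z : Ω × ℝ => V z.2 z.1)
    (hVW : ∀ s ∈ Icc 0 T, ∀ᵐ ω ∂P, V s ω = fun q => κ * W q s ω + a q)
    {G : Set (UpperPair n → ℝ)} (hG : IsRegularSet n G) {f : ℝ → ℝ} (hf : MemCb 2 f)
    (F : Cylinder (UpperPair n) T) :
    ∫ ω, F.eval W ω * (∑ i, f (eigFun n i (V t ω)) - ∑ i, f (eigFun n i (V 0 ω)) -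
        ∫ s in (0 : ℝ)..t, κ ^ 2 * deriv (fun r => R r r) s / 2 * statLap n f (V s ω)) ∂P =
      κ * ∫ ω, F.derivInner R W (fun q s ω => (Icc 0 t).indicator
        (fun r => G.indicator (statGrad n f q) (V r ω)) s) ω ∂P := by
  have hWm : ∀ q, ∀ s ∈ Icc 0 T, Measurable (W q s) := fun q s hs => hW.measurable q s hs.1
  have hU : Measurable fun ω l => gaussianInt W (F.h l) ω :=
    measurable_pi_lambda _ fun l => measurable_gaussianInt hWm (F.h l)
  have hsub : ∀ {s}, s ∈ Icc 0 t → s ∈ Icc 0 T := fun hs => ⟨hs.1, hs.2.trans ht.2⟩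
  have hc : ∀ j q, IntervalIntegrable (fun s => κ * stepDeriv R (F.h j q) s) volume 0 t :=
    fun j q => (hR.intervalIntegrable_stepDeriv hT ht _).const_mul κ
  have hr0 : IntervalIntegrable (deriv fun r => R r r) volume 0 t := by
    refine (hR.intervalIntegrable_deriv_diag hT).mono_set ?_
    rw [uIcc_of_le ht.1, uIcc_of_le hT.le]
    exact Icc_subset_Icc_right ht.2
  have hr : IntervalIntegrable (fun s => κ ^ 2 * deriv (fun r => R r r) s / 2) volume 0 t :=
    (hr0.const_mul _).div_const 2
  have hF1 := fun j => contDiff_fderiv_apply F.smooth (Pi.single j (1 : ℝ))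
  obtain ⟨B, hB⟩ := F.smooth.continuous.bounded_above_of_compact_support F.compact
  have hB0 : 0 ≤ B := (norm_nonneg _).trans (hB 0)
  choose B1 hB1 using fun j => (hF1 j).continuous.bounded_above_of_compact_support
    (F.compact.fderiv_apply ℝ (Pi.single j (1 : ℝ)))
  have hB10 : ∀ j, 0 ≤ B1 j := fun j => (norm_nonneg _).trans (hB1 j 0)
  have hFm : Measurable (F.eval W) := F.smooth.continuous.measurable.comp hU
  have hF1m : ∀ j, Measurable fun ω =>
      fderiv ℝ F.g (fun l => gaussianInt W (F.h l) ω) (Pi.single j 1) :=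
    fun j => (hF1 j).continuous.measurable.comp hU
  obtain ⟨C₀, hC₀, hf1, hf2⟩ := hf.exists_bound
  obtain ⟨g, C, hC, hg, hgc, hgrow, hglim, hg1, hg1lim, hg2, hg2lim⟩ :=
    exists_smooth_approximation hf hG
  have hVs : ∀ s, Measurable (V s) := fun s => hV.comp measurable_prodMk_right
  have hVint : ∀ s ∈ Icc 0 T, Integrable (fun ω => C * (1 + ‖V s ω‖)) P := fun s hs => by
    have h1 : Integrable (fun ω q => κ * W q s ω + a q) P :=
      (hW.memLp_affine hs.1).integrable (by norm_num)
    exact ((integrable_const 1).add ((h1.congr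
      ((hVW s hs).mono fun ω hω => hω.symm)).norm)).const_mul C
  have hmem : ∀ᵐ s, s ∈ Icc 0 t → ∀ᵐ ω ∂P, V s ω ∈ G := by
    filter_upwards [hR.ae_pos_diag (fun s hs => hW.covariance_self_nonneg hs) hT] with s hs hst
    filter_upwards [hVW s (hsub hst), hW.ae_affine_mem (hsub hst).1 (hs (hsub hst)) hκ (a := a)
      hG.volume_compl] with ω h1 h2
    rwa [h1]
  -- convergence of the boundary terms
  have hbdry : ∀ s ∈ Icc 0 T, Tendsto (fun N => ∫ ω, F.eval W ω * g N (V s ω) ∂P) atTop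
      (nhds (∫ ω, F.eval W ω * ∑ i, f (eigFun n i (V s ω)) ∂P)) := fun s hs => by
    refine tendsto_integral_of_dominated_convergence (fun ω => B * (C * (1 + ‖V s ω‖)))
      (fun N => (hFm.mul ((hg N).continuous.measurable.comp (hVs s))).aestronglyMeasurable)
      ((hVint s hs).const_mul B) (fun N => Eventually.of_forall fun ω => ?_)
      (Eventually.of_forall fun ω => (hglim _).const_mul _)
    rw [norm_mul]
    exact mul_le_mul (hB _) (hgrow N _) (norm_nonneg _) hB0
  have hstat_int : ∀ s ∈ Icc 0 T,
      Integrable (fun ω => F.eval W ω * ∑ i, f (eigFun n i (V s ω))) P := fun s hs => by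
    refine ((hVint s hs).const_mul B).mono' (hFm.mul
      ((continuous_sum_comp_eigFun hf).measurable.comp (hVs s))).aestronglyMeasurable
      (Eventually.of_forall fun ω => ?_)
    rw [norm_mul]
    exact mul_le_mul (hB _) (le_of_tendsto (hglim _).abs (Eventually.of_forall fun N => hgrow N _))
      (norm_nonneg _) hB0
  -- convergence of the first order terms
  let D : UpperPair n → ℝ → Ω → ℝ := fun q s ω => G.indicator (statGrad n f q) (V s ω)
  have hDm : ∀ q, Measurable fun z : Ω × ℝ => D q z.2 z.1 := fun q =>
    ((measurable_statGrad hf q).indicator hG.isOpen.measurableSet).comp hV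
  have hDC : ∀ q s ω, |D q s ω| ≤ n * (C₀ * (2 * n)) := fun q s ω => by
    by_cases h : V s ω ∈ G
    · simp only [D, indicator_of_mem h]
      exact abs_statGrad_le hf1 q _
    · simp only [D, indicator_of_notMem h, abs_zero]
      positivity
  have hlim1 : ∀ j q, Tendsto (fun N => ∫ s in (0 : ℝ)..t, κ * stepDeriv R (F.h j q) s *
        ∫ ω, fderiv ℝ F.g (fun l => gaussianInt W (F.h l) ω) (Pi.single j 1) *
          fderiv ℝ (g N) (V s ω) (Pi.single q 1) ∂P) atTop
      (nhds (∫ s in (0 : ℝ)..t, κ * stepDeriv R (F.h j q) s *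
        ∫ ω, fderiv ℝ F.g (fun l => gaussianInt W (F.h l) ω) (Pi.single j 1) * D q s ω ∂P)) := by
    intro j q
    refine tendsto_integral_mul_integral (C := C) ht.1 (hc j q)
      (ψ := fun N s ω => fderiv ℝ (g N) (V s ω) (Pi.single q 1))
      (fun N => (contDiff_fderiv_apply (hg N) _).continuous.measurable.comp hV) ?_ ?_
      (hF1m j) (fun ω => hB1 j _) (hB10 j)
    · filter_upwards [hmem] with s hs hst
      filter_upwards [hs hst] with ω hω N
      exact hg1 N _ hω q
    · filter_upwards [hmem] with s hs hst
      filter_upwards [hs hst] with ω hω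
      simp only [D, indicator_of_mem hω]
      exact hg1lim _ hω q
  -- convergence of the second order terms
  have hLm : Measurable fun z : Ω × ℝ => statLap n f (V z.2 z.1) := (measurable_statLap hf).comp hV
  have hlim2 : Tendsto (fun N => ∫ s in (0 : ℝ)..t, κ ^ 2 * deriv (fun r => R r r) s / 2 *
        ∫ ω, F.eval W ω * ∑ q, fderiv ℝ (fun z => fderiv ℝ (g N) z (Pi.single q 1)) (V s ω)
          (Pi.single q 1) ∂P) atTop
      (nhds (∫ s in (0 : ℝ)..t, κ ^ 2 * deriv (fun r => R r r) s / 2 *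
        ∫ ω, F.eval W ω * statLap n f (V s ω) ∂P)) := by
    refine tendsto_integral_mul_integral (C := C) ht.1 hr
      (ψ := fun N s ω => ∑ q, fderiv ℝ (fun z => fderiv ℝ (g N) z (Pi.single q 1)) (V s ω)
          (Pi.single q 1))
      (fun N => Finset.measurable_sum _ fun q _ => (contDiff_fderiv_apply
        (contDiff_fderiv_apply (hg N) _) _).continuous.measurable.comp hV) ?_ ?_
      hFm (fun ω => hB _) hB0
    · filter_upwards [hmem] with s hs hst
      filter_upwards [hs hst] with ω hω N
      exact hg2 N _ hω
    · exact Eventually.of_forall fun s _ => Eventually.of_forall fun ω => hg2lim _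
  have hmain : (∫ ω, F.eval W ω * ∑ i, f (eigFun n i (V t ω)) ∂P) -
      ∫ ω, F.eval W ω * ∑ i, f (eigFun n i (V 0 ω)) ∂P =
      (∑ j, ∑ q, ∫ s in (0 : ℝ)..t, κ * stepDeriv R (F.h j q) s *
        ∫ ω, fderiv ℝ F.g (fun l => gaussianInt W (F.h l) ω) (Pi.single j 1) * D q s ω ∂P) +
      ∫ s in (0 : ℝ)..t, κ ^ 2 * deriv (fun r => R r r) s / 2 *
        ∫ ω, F.eval W ω * statLap n f (V s ω) ∂P := by
    refine tendsto_nhds_unique ((hbdry t ht).sub (hbdry 0 ⟨le_rfl, hT.le⟩)) ?_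
    refine ((tendsto_finsetSum _ fun j _ => tendsto_finsetSum _ fun q _ => hlim1 j q).add
      hlim2).congr fun N => ?_
    exact (integral_cylinder_mul_sub hW hR hT ht hV hVW F (hg N) (hgc N)).symm
  rw [integral_mul_integral_comm (C := n * C₀ + n * (n * C₀)) ht.1 hr hLm
    (fun s ω => abs_statLap_le hf hf2 _) hFm (fun ω => hB _)] at hmain
  have he : ∀ j q ω, extInner R (F.h j q) ((Icc 0 t).indicator fun r => D q r ω) =
      ∫ s in (0 : ℝ)..t, stepDeriv R (F.h j q) s * D q s ω := fun j q ω =>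
    hR.extInner_indicator hT ht _ (φ := fun r => D q r ω) ((hDm q).comp measurable_prodMk_left)
      (fun s => hDC q s ω)
  have hswap : ∀ j q, ∫ s in (0 : ℝ)..t, κ * stepDeriv R (F.h j q) s *
        ∫ ω, fderiv ℝ F.g (fun l => gaussianInt W (F.h l) ω) (Pi.single j 1) * D q s ω ∂P =
      ∫ ω, κ * (fderiv ℝ F.g (fun l => gaussianInt W (F.h l) ω) (Pi.single j 1) *
        extInner R (F.h j q) ((Icc 0 t).indicator fun r => D q r ω)) ∂P := fun j q => by
    rw [integral_mul_integral_comm ht.1 (hc j q) (hDm q) (hDC q) (hF1m j) (fun ω => hB1 j _)]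
    refine integral_congr_ae (Eventually.of_forall fun ω => ?_)
    simp only
    rw [he]
    simp only [mul_assoc, intervalIntegral.integral_const_mul]
    ring
  have hint : ∀ j q, Integrable (fun ω => κ * (fderiv ℝ F.g (fun l => gaussianInt W (F.h l) ω)
      (Pi.single j 1) * extInner R (F.h j q) ((Icc 0 t).indicator fun r => D q r ω))) P := by
    intro j q
    simp only [he]
    have hs := hR.intervalIntegrable_stepDeriv hT ht (F.h j q)
    refine (Integrable.of_bound ((hF1m j).mul
      (measurable_integral_mul ht.1 hs (hDm q))).aestronglyMeasurable
      (B1 j * ((∫ s in (0 : ℝ)..t, |stepDeriv R (F.h j q) s|) * (n * (C₀ * (2 * n)))))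
      (Eventually.of_forall fun ω => ?_)).const_mul κ
    rw [Pi.mul_apply, norm_mul]
    exact mul_le_mul (hB1 j _) (abs_integral_mul_le_of_bounded ht.1 hs fun s => hDC q s ω)
      (norm_nonneg _) (hB10 j)
  have hintL : Integrable (fun ω => F.eval W ω * ∫ s in (0 : ℝ)..t,
      κ ^ 2 * deriv (fun r => R r r) s / 2 * statLap n f (V s ω)) P := by
    refine Integrable.of_bound (hFm.mul
      (measurable_integral_mul ht.1 hr hLm)).aestronglyMeasurable (B * ((∫ s in (0 : ℝ)..t,
        |κ ^ 2 * deriv (fun r => R r r) s / 2|) * (n * C₀ + n * (n * C₀))))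
      (Eventually.of_forall fun ω => ?_)
    rw [norm_mul]
    exact mul_le_mul (hB _) (abs_integral_mul_le_of_bounded ht.1 hr fun s => abs_statLap_le hf hf2 _)
      (norm_nonneg _) hB0
  simp only [mul_sub]
  rw [integral_sub (by exact (hstat_int t ht).sub (hstat_int 0 ⟨le_rfl, hT.le⟩)) hintL,
    integral_sub (hstat_int t ht) (hstat_int 0 ⟨le_rfl, hT.le⟩), hmain, add_sub_cancel_right,
    ← integral_const_mul]
  simp only [hswap, Cylinder.derivInner, Finset.mul_sum]
  rw [integral_finsetSum _ fun j _ => integrable_finsetSum _ fun q _ => hint j q]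
  exact Finset.sum_congr rfl fun j _ => (integral_finsetSum _ fun q _ => hint j q).symm

end Duality

/-! ### Existence and uniqueness of the Skorokhod integral -/

section SkorokhodIntegral

variable {Ω : Type*} [MeasurableSpace Ω] {P : Measure Ω}

theorem abs_integral_mul_le_eLpNorm_two {f g : Ω → ℝ} (hf : MemLp f 2 P) (hg : MemLp g 2 P) :
    |∫ ω, f ω * g ω ∂P| ≤ (eLpNorm g 2 P).toReal * (eLpNorm f 2 P).toReal := by
  have h2 : ∀ {f : Ω → ℝ}, MemLp f 2 P → (eLpNorm f 2 P).toReal =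
      (∫ ω, ‖f ω‖ ^ (2 : ℝ) ∂P) ^ (1 / (2 : ℝ)) := fun hf => by
    rw [hf.eLpNorm_eq_integral_rpow_norm (by norm_num) (by norm_num), ENNReal.toReal_ofReal
      (by positivity)]
    simp
  rw [h2 hf, h2 hg, mul_comm]
  refine (norm_integral_le_integral_norm (fun ω => f ω * g ω)).trans ?_
  simp only [norm_mul]
  exact integral_mul_norm_le_Lp_mul_Lq Real.HolderConjugate.two_two (by simpa using hf)
    (by simpa using hg)

variable [IsProbabilityMeasure P]

/-- The divergence is unique. -/
theorem IsExtDivergence.ae_eq {ι : Type*} [Fintype ι] {W : ι → ℝ → Ω → ℝ} {R : ℝ → ℝ → ℝ} {T β : ℝ}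
    {u : ι → ℝ → Ω → ℝ} {Z Z' : Ω → ℝ} (hW : ∀ i, ∀ s ∈ Icc 0 T, Measurable (W i s))
    (hZ : IsExtDivergence P R W T β u Z) (hZ' : IsExtDivergence P R W T β u Z') : Z =ᵐ[P] Z' := by
  have hint : ∀ {Z}, IsExtDivergence P R W T β u Z → Integrable Z P := fun h => by
    obtain ⟨q, hq, h⟩ := h.memLp
    exact h.integrable (by simpa using ENNReal.ofReal_le_ofReal hq.le)
  have hFint : ∀ (F : Cylinder ι T) {Z}, Integrable Z P → Integrable (fun ω => F.eval W ω * Z ω) P :=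
    fun F Z h => by
      obtain ⟨B, hB⟩ := F.smooth.continuous.bounded_above_of_compact_support F.compact
      exact h.bdd_mul (c := B) (F.smooth.continuous.measurable.comp
        (measurable_pi_lambda _ fun l => measurable_gaussianInt hW (F.h l))).aestronglyMeasurable
        (Eventually.of_forall fun ω => hB _)
  have h0 : (fun ω => Z ω - Z' ω) =ᵐ[P] 0 := by
    refine ae_eq_zero_of_forall_cylinder hW ((hint hZ).sub (hint hZ'))
      (hZ.measurable.sub hZ'.measurable) fun F => ?_
    simp only [mul_sub]
    rw [integral_sub (hFint F (hint hZ)) (hFint F (hint hZ')), hZ.duality, hZ'.duality, sub_self]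
  filter_upwards [h0] with ω hω
  exact sub_eq_zero.1 hω

variable {n : ℕ} {W : UpperPair n → ℝ → Ω → ℝ} {R : ℝ → ℝ → ℝ} {T t κ : ℝ} {a : UpperPair n → ℝ}
  {V : ℝ → Ω → UpperPair n → ℝ}

theorem pathSigma_le (hW : ∀ q, ∀ s ∈ Icc 0 T, Measurable (W q s)) :
    pathSigma W T ≤ (inferInstance : MeasurableSpace Ω) :=
  iSup_le fun i => iSup_le fun s => (hW i s s.2).comap_le

/-- The linear statistic `∑_i f(Φ_i)` of `κ W + a`, compensated by its second order part, is `κ`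
times the Skorokhod integral of its gradient. -/
theorem isSkorokhodIntegral_statistic [Nonempty (UpperPair n)]
    (hW : IndepGaussianProcesses P W R) (hR : CovarianceH1 R) (hT : 0 < T) (ht : t ∈ Icc 0 T)
    (hκ : κ ≠ 0) (hV : Measurable[(pathSigma W T).prod inferInstance] fun z : Ω × ℝ => V z.2 z.1)
    (hVW : ∀ᵐ ω ∂P, ∀ s ∈ Icc 0 T, V s ω = fun q => κ * W q s ω + a q)
    {G : Set (UpperPair n → ℝ)} (hG : IsRegularSet n G) {f : ℝ → ℝ} (hf : MemCb 2 f) (β : ℝ) :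
    IsSkorokhodIntegral P R W T β t
      (fun q s ω => G.indicator (statGrad n f q) fun q' => κ * W q' s ω + a q')
      (fun ω => κ⁻¹ * (∑ i, f (eigFun n i (V t ω)) - ∑ i, f (eigFun n i (V 0 ω)) -
        ∫ s in (0 : ℝ)..t, κ ^ 2 * deriv (fun r => R r r) s / 2 * statLap n f (V s ω))) := by
  have hWm : ∀ q, ∀ s ∈ Icc 0 T, Measurable (W q s) := fun q s hs => hW.measurable q s hs.1
  have hle := pathSigma_le hWm
  have hV' : Measurable fun z : Ω × ℝ => V z.2 z.1 :=
    hV.mono (sup_le_sup (MeasurableSpace.comap_mono hle) le_rfl) le_rfl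
  have hVs : ∀ s, Measurable[pathSigma W T] (V s) := fun s =>
    hV.comp (@measurable_prodMk_right _ _ (pathSigma W T) _ s)
  have h0T : (0 : ℝ) ∈ Icc 0 T := ⟨le_rfl, hT.le⟩
  have hr0 : IntervalIntegrable (deriv fun r => R r r) volume 0 t := by
    refine (hR.intervalIntegrable_deriv_diag hT).mono_set ?_
    rw [uIcc_of_le ht.1, uIcc_of_le hT.le]
    exact Icc_subset_Icc_right ht.2
  have hr : IntervalIntegrable (fun s => κ ^ 2 * deriv (fun r => R r r) s / 2) volume 0 t :=
    (hr0.const_mul _).div_const 2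
  obtain ⟨C₀, hC₀, hf1, hf2⟩ := hf.exists_bound
  obtain ⟨C, hC, hgrow⟩ := exists_abs_sum_comp_eigFun_le hf n
  have hLm : Measurable[(pathSigma W T).prod inferInstance]
      fun z : Ω × ℝ => statLap n f (V z.2 z.1) := (measurable_statLap hf).comp hV
  have hIm : Measurable[pathSigma W T] fun ω => ∫ s in (0 : ℝ)..t,
      κ ^ 2 * deriv (fun r => R r r) s / 2 * statLap n f (V s ω) :=
    @measurable_integral_mul Ω (pathSigma W T) _ (fun s ω => statLap n f (V s ω)) _ ht.1 hr hLm
  have hHm : ∀ s, Measurable[pathSigma W T] fun ω => ∑ i, f (eigFun n i (V s ω)) := fun s =>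
    (continuous_sum_comp_eigFun hf).measurable.comp (hVs s)
  have hZm : Measurable[pathSigma W T] fun ω => κ⁻¹ * (∑ i, f (eigFun n i (V t ω)) -
      ∑ i, f (eigFun n i (V 0 ω)) -
        ∫ s in (0 : ℝ)..t, κ ^ 2 * deriv (fun r => R r r) s / 2 * statLap n f (V s ω)) :=
    (((hHm t).sub (hHm 0)).sub hIm).const_mul _
  have hH2 : ∀ s ∈ Icc 0 T, MemLp (fun ω => ∑ i, f (eigFun n i (V s ω))) 2 P := fun s hs => by
    have h1 : MemLp (V s) 2 P :=
      (memLp_congr_ae (hVW.mono fun ω hω => hω s hs)).2 (hW.memLp_affine hs.1)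
    refine (((memLp_const (1 : ℝ)).add h1.norm).const_mul C).mono
      ((hHm s).mono hle le_rfl).aestronglyMeasurable (Eventually.of_forall fun ω => ?_)
    refine (hgrow (V s ω)).trans (le_of_eq ?_)
    rw [Real.norm_eq_abs, abs_of_nonneg]
    · rfl
    · exact mul_nonneg hC (add_nonneg zero_le_one (norm_nonneg _))
  have hZ2 : MemLp (fun ω => κ⁻¹ * (∑ i, f (eigFun n i (V t ω)) - ∑ i, f (eigFun n i (V 0 ω)) -
      ∫ s in (0 : ℝ)..t, κ ^ 2 * deriv (fun r => R r r) s / 2 * statLap n f (V s ω))) 2 P := by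
    refine (((hH2 t ht).sub (hH2 0 h0T)).sub (MemLp.of_bound
      (hIm.mono hle le_rfl).aestronglyMeasurable
      ((∫ s in (0 : ℝ)..t, |κ ^ 2 * deriv (fun r => R r r) s / 2|) * (n * C₀ + n * (n * C₀)))
      (Eventually.of_forall fun ω => ?_))).const_mul _
    exact abs_integral_mul_le_of_bounded ht.1 hr fun s => abs_statLap_le hf hf2 _
  have hdual : ∀ F : Cylinder (UpperPair n) T, ∫ ω, F.eval W ω *
      (κ⁻¹ * (∑ i, f (eigFun n i (V t ω)) - ∑ i, f (eigFun n i (V 0 ω)) -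
        ∫ s in (0 : ℝ)..t, κ ^ 2 * deriv (fun r => R r r) s / 2 * statLap n f (V s ω))) ∂P =
      ∫ ω, F.derivInner R W (fun q s ω => (Icc 0 t).indicator (fun r =>
        G.indicator (statGrad n f q) fun q' => κ * W q' r ω + a q') s) ω ∂P := fun F => by
    have h1 := integral_cylinder_mul_statistic hW hR hT ht hκ hV'
      (fun s hs => hVW.mono fun ω hω => hω s hs) hG hf F
    simp only [mul_left_comm _ κ⁻¹, integral_const_mul]
    rw [h1, inv_mul_cancel_left₀ hκ]
    refine integral_congr_ae ?_
    filter_upwards [hVW] with ω hω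
    have h2 : ∀ q, (fun s => (Icc 0 t).indicator
        (fun r => G.indicator (statGrad n f q) (V r ω)) s) = fun s => (Icc 0 t).indicator (fun r =>
          G.indicator (statGrad n f q) fun q' => κ * W q' r ω + a q') s := fun q => by
      funext s
      by_cases hs : s ∈ Icc 0 t
      · rw [indicator_of_mem hs, indicator_of_mem hs, hω s ⟨hs.1, hs.2.trans ht.2⟩]
      · rw [indicator_of_notMem hs, indicator_of_notMem hs]
    simp only [Cylinder.derivInner, h2]
  have hub : ∀ q (y : UpperPair n → ℝ), |G.indicator (statGrad n f q) y| ≤ n * (C₀ * (2 * n)) :=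
    fun q y => by
      by_cases h : y ∈ G
      · rw [indicator_of_mem h]
        exact abs_statGrad_le hf1 q _
      · rw [indicator_of_notMem h, abs_zero]
        positivity
  have h1 : MemL1Lbeta P T β fun q s ω => (Icc 0 t).indicator (fun r =>
      G.indicator (statGrad n f q) fun q' => κ * W q' r ω + a q') s := by
    intro q
    constructor
    · have hm : Measurable fun z : Ω × ℝ => (Icc 0 t).indicator (fun r =>
          G.indicator (statGrad n f q) (V r z.1)) z.2 := by
        have h3 : Measurable fun z : Ω × ℝ => G.indicator (statGrad n f q) (V z.2 z.1) :=
          ((measurable_statGrad hf q).indicator hG.isOpen.measurableSet).comp hV'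
        exact h3.indicator (measurable_snd measurableSet_Icc)
      refine hm.aestronglyMeasurable.congr ?_
      have h4 : ∀ᵐ z ∂(P.prod (volume.restrict (Icc 0 T))), ∀ s ∈ Icc 0 T,
          V s z.1 = fun q => κ * W q s z.1 + a q :=
        Measure.quasiMeasurePreserving_fst.ae hVW
      filter_upwards [h4] with z hz
      by_cases hs : z.2 ∈ Icc 0 t
      · rw [indicator_of_mem hs, indicator_of_mem hs, hz _ ⟨hs.1, hs.2.trans ht.2⟩]
      · rw [indicator_of_notMem hs, indicator_of_notMem hs]
    · have h5 : ∀ ω, eLpNorm (fun s => (Icc 0 t).indicator (fun r =>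
          G.indicator (statGrad n f q) fun q' => κ * W q' r ω + a q') s) (ENNReal.ofReal β)
          (volume.restrict (Icc 0 T)) ≤ (volume.restrict (Icc 0 T)) univ ^
            (ENNReal.ofReal β).toReal⁻¹ * ENNReal.ofReal (n * (C₀ * (2 * n))) := fun ω => by
        refine eLpNorm_le_of_ae_bound (Eventually.of_forall fun s => ?_)
        by_cases hs : s ∈ Icc 0 t
        · rw [indicator_of_mem hs]
          exact hub q _
        · rw [indicator_of_notMem hs, norm_zero]
          positivity
      refine (lintegral_mono h5).trans_lt ?_
      rw [lintegral_const, measure_univ (μ := P), mul_one]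
      refine ENNReal.mul_lt_top (ENNReal.rpow_lt_top_of_nonneg (by positivity) ?_)
        ENNReal.ofReal_lt_top
      simp
  refine ⟨⟨h1, 2, by norm_num, (eLpNorm (fun ω => κ⁻¹ * (∑ i, f (eigFun n i (V t ω)) -
    ∑ i, f (eigFun n i (V 0 ω)) - ∫ s in (0 : ℝ)..t, κ ^ 2 * deriv (fun r => R r r) s / 2 *
      statLap n f (V s ω))) 2 P).toReal, fun F => ?_⟩, hZm.stronglyMeasurable.aestronglyMeasurable,
    ⟨2, by norm_num, by simpa using hZ2⟩, hdual⟩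
  rw [← hdual F]
  have hF2 : MemLp (F.eval W) 2 P := by
    obtain ⟨B, hB⟩ := F.smooth.continuous.bounded_above_of_compact_support F.compact
    exact MemLp.of_bound (F.smooth.continuous.measurable.comp (measurable_pi_lambda _ fun l =>
      measurable_gaussianInt hWm (F.h l))).aestronglyMeasurable B
      (Eventually.of_forall fun ω => hB _)
  simpa using abs_integral_mul_le_eLpNorm_two hF2 hZ2

end SkorokhodIntegral

/-! ### The matrix-valued process -/

section MatrixProcess

variable {Ω : Type*} {n : ℕ}

theorem symCoord_matrixProcess (X : ℕ → ℕ → ℝ → Ω → ℝ) (A : Matrix (Fin n) (Fin n) ℝ)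
    (s : ℝ) (ω : Ω) :
    symCoord (matrixProcess X A s ω) =
      fun q => 1 / √n * upperProcess n X q s ω + symCoord A q := by
  funext ⟨⟨i, j⟩, hij⟩
  have h2 : √(2 : ℝ) ≠ 0 := by positivity
  rcases (show i ≤ j from hij).eq_or_lt with h | h
  · subst h
    simp only [symCoord, matrixProcess, upperProcess, Matrix.of_apply, lt_irrefl, if_true, if_false]
    field_simp
  · simp [symCoord, matrixProcess, upperProcess, h, h.ne]

theorem eigIntegrand_eq (X : ℕ → ℕ → ℝ → Ω → ℝ) (A : Matrix (Fin n) (Fin n) ℝ) (f : ℝ → ℝ)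
    (G : Set (UpperPair n → ℝ)) :
    eigIntegrand X A f G = fun q s ω => G.indicator (statGrad n f q)
      fun q' => 1 / √n * upperProcess n X q' s ω + symCoord A q' := by
  funext q s ω
  rw [← symCoord_matrixProcess]
  by_cases h : symCoord (matrixProcess X A s ω) ∈ G
  · simp [eigIntegrand, statGrad, h]
  · simp [eigIntegrand, h]

theorem integral_spectralMeasure (M : Matrix (Fin n) (Fin n) ℝ) (f : ℝ → ℝ) :
    ∫ x, f x ∂(spectralMeasure M) = 1 / n * ∑ j, f (orderedEig M j) := by
  rw [spectralMeasure, integral_smul_measure,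
    integral_finsetSum_measure fun j _ => integrable_dirac (by simp)]
  simp

theorem matrixProcess_eq_of_eq_zero {X : ℕ → ℕ → ℝ → Ω → ℝ} {A : Matrix (Fin n) (Fin n) ℝ}
    (hA : A.IsSymm) {s : ℝ} {ω : Ω} (h : ∀ q, upperProcess n X q s ω = 0) :
    matrixProcess X A s ω = A := by
  rw [← symMatrix_symCoord (matrixProcess_isSymm X A s ω), symCoord_matrixProcess]
  simp only [h, mul_zero, zero_add]
  exact symMatrix_symCoord hA

end MatrixProcess

theorem intervalIntegrable_of_eq_mul {c ψ φ : ℝ → ℝ} {C t : ℝ} (ht : 0 ≤ t)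
    (hc : IntervalIntegrable c volume 0 t) (hψ : Measurable ψ) (hψC : ∀ s, |ψ s| ≤ C)
    (h : ∀ s ∈ Icc 0 t, φ s = ψ s * c s) : IntervalIntegrable φ volume 0 t := by
  rw [intervalIntegrable_iff_integrableOn_Ioc_of_le ht] at hc ⊢
  refine IntegrableOn.congr_fun (f := fun s => ψ s * c s) ?_
    (fun s hs => (h s (Ioc_subset_Icc_self hs)).symm) measurableSet_Ioc
  exact hc.bdd_mul hψ.aestronglyMeasurable (Eventually.of_forall hψC)

end

theorem lemma3p1 {Ω : Type*} [MeasurableSpace Ω] (P : Measure Ω) [IsProbabilityMeasure P]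
    (X : ℕ → ℕ → ℝ → Ω → ℝ) (R : ℝ → ℝ → ℝ) (hX : IsGaussianFamily P X R)
    (hR1 : CovarianceH1 R) (hR2 : CovarianceH2 R)
    (n : ℕ) (hn : 1 ≤ n) (A : Matrix (Fin n) (Fin n) ℝ) (hA : A.IsSymm) :
    (∃ G : Set (UpperPair n → ℝ), IsRegularSet n G) ∧
    (R 0 0 = 0 → ∀ᵐ ω ∂P, spectralMeasure (matrixProcess X A 0 ω) = spectralMeasure A) ∧
    ∀ (G : Set (UpperPair n → ℝ)), IsRegularSet n G →
    ∀ (T α : ℝ), 0 < T → 1 < α → PartialDerivBound R T α →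
    ∀ (f : ℝ → ℝ), MemCb 2 f → ∀ t ∈ Set.Icc (0 : ℝ) T,
      (∀ᵐ ω ∂P,
        (∀ i : Fin n, IntervalIntegrable
          (fun s => deriv (deriv f) (eigFun n i (symCoord (matrixProcess X A s ω))) *
            deriv (fun r => R r r) s) volume 0 t) ∧
        IntervalIntegrable
          (fun s => ∫ x, ∫ y, derivQuotient f x y * deriv (fun r => R r r) s
            ∂(spectralMeasure (matrixProcess X A s ω))
            ∂(spectralMeasure (matrixProcess X A s ω))) volume 0 t) ∧
      (∃ Z : Ω → ℝ, IsSkorokhodIntegral P R (upperProcess n X) T (α / (α - 1)) t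
        (eigIntegrand X A f G) Z) ∧
      ∀ Z : Ω → ℝ, IsSkorokhodIntegral P R (upperProcess n X) T (α / (α - 1)) t
        (eigIntegrand X A f G) Z →
        ∀ᵐ ω ∂P,
          (∫ x, f x ∂(spectralMeasure (matrixProcess X A t ω))) =
            (∫ x, f x ∂(spectralMeasure (matrixProcess X A 0 ω)))
            + (1 / (2 * (n : ℝ) ^ 2)) * (∑ i : Fin n, (∫ s in (0 : ℝ)..t,
                deriv (deriv f) (eigFun n i (symCoord (matrixProcess X A s ω))) *
                  deriv (fun r => R r r) s))
            + (1 / (n : ℝ) ^ (3 / 2 : ℝ)) * Z ω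
            + (1 / 2) * (∫ s in (0 : ℝ)..t, (∫ x, (∫ y,
                derivQuotient f x y * deriv (fun r => R r r) s
                  ∂(spectralMeasure (matrixProcess X A s ω)))
                  ∂(spectralMeasure (matrixProcess X A s ω)))) := by
  have hW := hX.upperProcess n
  refine ⟨exists_isRegularSet n, fun h0 => ?_, ?_⟩
  · filter_upwards [ae_all_iff.2 fun q => hW.ae_eq_zero q le_rfl h0] with ω hω
    rw [matrixProcess_eq_of_eq_zero hA hω]
  intro G hG T α hT hα hbound f hf t ht
  have : Nonempty (UpperPair n) := ⟨⟨(⟨0, hn⟩, ⟨0, hn⟩), le_rfl⟩⟩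
  have hn0 : (0 : ℝ) < n := by exact_mod_cast hn
  have hκ : 1 / √(n : ℝ) ≠ 0 := by positivity
  -- a version of the coordinates of `Y` that is measurable jointly in the time and the paths
  obtain ⟨V, hV, hVX⟩ := @exists_measurable_affine_version Ω _
    (pathSigma (upperProcess n X) T) _ (upperProcess n X) T hT.le (fun q s hs =>
      (comap_measurable _).mono
        ((le_iSup (fun s : Icc (0 : ℝ) T => MeasurableSpace.comap (upperProcess n X q s)
          inferInstance) ⟨s, hs⟩).trans
          (le_iSup (fun q => ⨆ s : Icc (0 : ℝ) T, MeasurableSpace.comap (upperProcess n X q s)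
            inferInstance) q)) le_rfl) (1 / √n) (symCoord A)
  have hVW : ∀ᵐ ω ∂P, ∀ s ∈ Icc 0 T,
      V s ω = fun q => 1 / √n * upperProcess n X q s ω + symCoord A q := by
    filter_upwards [ae_all_iff.2 fun q => hW.continuous q] with ω hω
    exact hVX ω fun q => (hω q).mono Icc_subset_Ici_self
  have hVm : ∀ ω, Measurable fun s => V s ω := fun ω =>
    hV.comp (@measurable_prodMk_left _ _ (pathSigma (upperProcess n X) T) _ ω)
  have hVY : ∀ᵐ ω ∂P, ∀ s ∈ Icc 0 t, symCoord (matrixProcess X A s ω) = V s ω := by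
    filter_upwards [hVW] with ω hω s hs
    rw [symCoord_matrixProcess, hω s ⟨hs.1, hs.2.trans ht.2⟩]
  have hr : IntervalIntegrable (deriv fun r => R r r) volume 0 t := by
    refine (hR1.intervalIntegrable_deriv_diag hT).mono_set ?_
    rw [uIcc_of_le ht.1, uIcc_of_le hT.le]
    exact Icc_subset_Icc_right ht.2
  obtain ⟨C, hC, hf1, hf2⟩ := hf.exists_bound
  have hdouble : ∀ s ω, ∫ x, ∫ y, derivQuotient f x y * deriv (fun r => R r r) s
      ∂(spectralMeasure (matrixProcess X A s ω)) ∂(spectralMeasure (matrixProcess X A s ω)) =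
      1 / (n : ℝ) ^ 2 * ((∑ i, ∑ j, derivQuotient f
        (eigFun n i (symCoord (matrixProcess X A s ω)))
        (eigFun n j (symCoord (matrixProcess X A s ω)))) * deriv (fun r => R r r) s) := by
    intro s ω
    simp only [integral_spectralMeasure, eigFun_matrixProcess, ← Finset.mul_sum, ← Finset.sum_mul]
    ring
  have hint1 : ∀ᵐ ω ∂P, ∀ i, IntervalIntegrable
      (fun s => deriv (deriv f) (eigFun n i (symCoord (matrixProcess X A s ω))) *
        deriv (fun r => R r r) s) volume 0 t := by
    filter_upwards [hVY] with ω hω i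
    refine intervalIntegrable_of_eq_mul ht.1 hr
      (ψ := fun s => deriv (deriv f) (eigFun n i (V s ω)))
      (hf.continuous_deriv_deriv.measurable.comp
        ((continuous_eigFun n i).measurable.comp (hVm ω))) (fun s => hf2 _) fun s hs => ?_
    rw [hω s hs]
  have hint2 : ∀ᵐ ω ∂P, IntervalIntegrable
      (fun s => (∑ i, ∑ j, derivQuotient f (eigFun n i (symCoord (matrixProcess X A s ω)))
        (eigFun n j (symCoord (matrixProcess X A s ω)))) * deriv (fun r => R r r) s)
        volume 0 t := by
    filter_upwards [hVY] with ω hω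
    refine intervalIntegrable_of_eq_mul (C := ∑ _i : Fin n, ∑ _j : Fin n, C) ht.1 hr
      (ψ := fun s => ∑ i, ∑ j, derivQuotient f (eigFun n i (V s ω)) (eigFun n j (V s ω)))
      (Finset.measurable_sum _ fun i _ => Finset.measurable_sum _ fun j _ =>
        (measurable_derivQuotient hf).comp
          (((continuous_eigFun n i).measurable.comp (hVm ω)).prodMk
            ((continuous_eigFun n j).measurable.comp (hVm ω)))) (fun s => ?_) fun s hs => ?_
    · refine (Finset.abs_sum_le_sum_abs _ _).trans (Finset.sum_le_sum fun i _ =>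
        (Finset.abs_sum_le_sum_abs _ _).trans (Finset.sum_le_sum fun j _ => ?_))
      exact abs_derivQuotient_le hf hf2 _ _
    · simp only [hω s hs]
  have hZ₀ := isSkorokhodIntegral_statistic hW hR1 hT ht hκ hV hVW hG hf (α / (α - 1))
  rw [← eigIntegrand_eq] at hZ₀
  refine ⟨?_, ⟨_, hZ₀⟩, fun Z hZ => ?_⟩
  · filter_upwards [hint1, hint2] with ω h1 h2
    refine ⟨h1, ?_⟩
    simp only [hdouble]
    exact h2.const_mul _
  filter_upwards [hint1, hint2, hVY,
    IsExtDivergence.ae_eq (fun q s hs => hW.measurable q s hs.1) hZ hZ₀] with ω h1 h2 hω hZω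
  have hlap : ∫ s in (0 : ℝ)..t, (1 / √(n : ℝ)) ^ 2 * deriv (fun r => R r r) s / 2 *
      statLap n f (V s ω) = 1 / (2 * n) *
        ((∑ i, ∫ s in (0 : ℝ)..t, deriv (deriv f)
          (eigFun n i (symCoord (matrixProcess X A s ω))) * deriv (fun r => R r r) s) +
        ∫ s in (0 : ℝ)..t, (∑ i, ∑ j, derivQuotient f
          (eigFun n i (symCoord (matrixProcess X A s ω)))
          (eigFun n j (symCoord (matrixProcess X A s ω)))) * deriv (fun r => R r r) s) := by
    rw [← intervalIntegral.integral_finsetSum fun i _ => h1 i, ← intervalIntegral.integral_add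
      (IntervalIntegrable.fun_sum fun i _ => h1 i) h2, ← intervalIntegral.integral_const_mul]
    refine intervalIntegral.integral_congr fun s hs => ?_
    rw [uIcc_of_le ht.1] at hs
    simp only [hω s hs, statLap, ← Finset.sum_mul, div_pow, one_pow, Real.sq_sqrt hn0.le]
    field_simp
  have hpow : (n : ℝ) ^ (3 / 2 : ℝ) = n * √n := by
    rw [show (3 / 2 : ℝ) = 1 + 1 / 2 by norm_num, Real.rpow_add hn0, Real.rpow_one,
      Real.sqrt_eq_rpow]
  rw [hZω, hlap, hpow]
  simp only [hdouble]
  simp only [integral_spectralMeasure, ← eigFun_matrixProcess,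
    hω t ⟨ht.1, le_rfl⟩, hω 0 ⟨le_rfl, ht.1⟩, intervalIntegral.integral_const_mul]
  have hs : √(n : ℝ) ≠ 0 := by positivity
  field_simp
  ring
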